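/- **Setting.** Let $G$ be a group, $s,h\colon G\to\mathbb Z_2$ homomorphisms, and $\omega$ a $2$-cocycle on $G$ with values in $U(1)$, where $g\in G$ acts on $U(1)$ trivially if $s(g)=0$ and by complex conjugation if $s(g)=1$. Let $A=\mathbb C[G,\omega,s]$ be the real algebra generated by $\mathbb C$ and $G$ with $g\cdot g'=\omega(g,g')\,gg'$ and $g\,\mathrm i=(-1)^{s(g)}\,\mathrm i\,g$, graded by $h$. Let $\rho_V$ be an orthogonal representation of $G$ on a finite-dimensional real inner product space $V$, and let $A^V$ be the $\mathbb Z_2$-graded real algebra generated by $A$ and odd elements $v\in V$, linear in $v$, with $v^2=|v|^2$, $v\,\mathrm i=\mathrm i\,v$ and $(-1)^{h(g)}\,g\,v\,(g)^{-1}=\rho_V(g)v$. Let $S^V=\{(k_0,v)\in\mathbb R\oplus V: k_0^2+|v|^2=1\}$ be the representation sphere with the action of $G$ on $V$, base point $\infty=(-1,0)$ and hemispheres $S^V_\pm=\{\pm k_0\ge 0\}$. For operators $M,M_0$ on an $A^V$-module, each with square $1$ and anticommuting with the action of every $v\in V$, the Dirac Hamiltonian is $$H(k)=\begin{cases}-k_0M+\rho(v),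 & k=(k_0,v)\in S^V_+,\\ \ \ k_0M_0+\rho(v), & k=(k_0,v)\in S^V_-.\end{cases}$$ A $\mathbb Z_2$-graded $A^V$-module $W=W_0\oplus W_1$ is the same as an ungraded module over the super tensor product $Cl^{0,1}\hat\otimes A^V$, whose element $\tilde e_1\hat\otimes 1$ acts as $M_0=\pm1$ on $W_0$, $W_1$ respectively. Write $\epsilon_0=1$, $\epsilon_1=-1$, and read indices modulo $2$. The *clutched bundle* $E=E_0\oplus E_1$ of the ABS construction is the following: $E_i$ is the gluing of $S^V_+\times W_i$ and $S^V_-\times W_{i+1}$ over $k_0=0$ along $(k,w)\mapsto(k,\epsilon_i\,\rho_W(v)w)$, $k=(0,v)$. The bundle $F=F_0\oplus F_1\subset S^V\times W$ obtained by *solving the Dirac Hamiltonian* with $M=-M_0$ has fibres $(F_i)_k=\{w\in W: H(k)w=\epsilon_iw\}$. On both bundles $A$ acts through its action on $W$; a group element $g$ maps the fibre over $k$ to the fibre over $gk$, and preserves or exchanges the two degrees according to $h(g)$. **Part 1.** Let $W$ be a finite-dimensional $\mathbb Z_2$-graded $A^V$-module. Then $E$ and $F$ are (locally trivial, continuous)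 graded vector bundles with $A$-action over $S^V$, and there is an isomorphism $\Psi\colon F\to E$ of such bundles, given for $i=0,1$ by the following formulas. Over $S^V_+$, $\Psi$ is the map $$F_i\to S^V_+\times W_i,\quad (k,w)\mapsto (k,\;w+\epsilon_iM_0w),\qquad\text{with inverse}\quad (k,w)\mapsto \Bigl(k,\ \tfrac{1}{2(1+k_0)}\bigl(w+\epsilon_iH(k)w\bigr)\Bigr);$$ over $S^V_-$ it is the map $$F_i\to S^V_-\times W_{i+1},\quad (k,w)\mapsto (k,\;w-\epsilon_iM_0w),\qquad\text{with inverse}\quad (k,w)\mapsto \Bigl(k,\ \tfrac{1}{2(1-k_0)}\bigl(w+\epsilon_iH(k)w\bigr)\Bigr).$$ **Part 2.** Let $G$ be finite. Let $\mathcal U$ be a universe of $Cl^{0,1}\hat\otimes A^V$: a module that is the union of an increasing sequence of finite-dimensional submodules (*stages*), with compatible module projections onto them, and that contains every irreducible module infinitely often. Let $M_0$ be the action of $\tilde e_1\hat\otimes1$ on $\mathcal U$ and put $H_0=-M_0$. Consider the following four classifications. * *Algebraic:* $\mathcal A(A^V)$ is the cokernel of the restriction map from the Grothendieck group of finite-dimensional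 modules over $Cl^{0,2}\hat\otimes A^V$ to that over $Cl^{0,1}\hat\otimes A^V$. * *Dirac:* $\pi_0(\mathcal K(A^V)^G)$, where $\mathcal K(A^V)^G$ is the space of operators $M$ on $\mathcal U$ that differ from $M_0$ only on a stage, satisfy $M^2=1$, and may replace $M_0$ in the action of $Cl^{0,1}\hat\otimes A^V$. * *Hamiltonian:* $\pi_0((\Omega^V\mathcal K(A))^G)$, where $\mathcal K(A)$ is the space of complex linear operators $H$ on $\mathcal U$ that differ from $H_0$ only on a stage and satisfy $H^2=1$, and $(\Omega^V\mathcal K(A))^G$ is the space of continuous maps $H\colon S^V\to\mathcal K(A)$ with $H(\infty)=H_0$ and $(-1)^{h(g)}gH(k)(g)^{-1}=H(gk)$. (Both $\mathcal K(A^V)^G$ and $\mathcal K(A)$ carry the direct limit topology over the stages.) * *Bundle-theoretic:* $\tilde K_A(S^V)$ is the set of product bundles $S^V\times U$, $U$ a finite-dimensional $A$-module, with a $\mathbb Z_2$-grading compatible with $A$, modulo the equivalence relation generated by isomorphism and by $E\sim E\oplus T$, where $T$ is a trivial object, i.e. the grading of $T$ is constant on $S^V$. There are unique well-defined maps as follows.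 * $L\colon\mathcal A(A^V)\to\pi_0(\mathcal K(A^V)^G)$ (changing the sign of the mass term) sends $[W]$ to the component of any $M$ that is $-M_0$ on an embedded copy of $W$ in $\mathcal U$ and $M_0$ on an invariant complement. * $\mathcal D\colon\pi_0(\mathcal K(A^V)^G)\to\pi_0((\Omega^V\mathcal K(A))^G)$ sends $[M]$ to the class of the Dirac Hamiltonian of $M$ and $M_0$ on any stage outside of which $M=M_0$, extended by $H_0$ on the complementary submodule. * $S\colon\pi_0((\Omega^V\mathcal K(A))^G)\to\tilde K_A(S^V)$ (solving the Hamiltonian) sends $[H]$ to the class of the product of $S^V$ with a stage outside of which $H=H_0$, graded by the eigenspaces $H=\pm1$. * $\Phi\colon\mathcal A(A^V)\to\tilde K_A(S^V)$ (ABS construction) sends $[W]$ to the class of the clutched bundle of $W$. The square commutes: $S\circ\mathcal D\circ L=\Phi$. -/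

import Mathlib

open scoped TensorProduct

namespace FreeFermion

noncomputable section

/-- The real associative unital algebra with a set `X` of generators and relations `r`. -/
def Presented {X : Type*} (r : FreeAlgebra ℝ X → FreeAlgebra ℝ X → Prop) : Type _ := RingQuot r

namespace Presented

variable {X : Type*} (r : FreeAlgebra ℝ X → FreeAlgebra ℝ X → Prop)

instance : Semiring (Presented r) := inferInstanceAs (Semiring (RingQuot r))

instance : Algebra ℝ (Presented r) := inferInstanceAs (Algebra ℝ (RingQuot r))

instance : Ring (Presented r) := Algebra.semiringToRing ℝ

/-- The canonical map from the free algebra. -/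
def mk : FreeAlgebra ℝ X →ₐ[ℝ] Presented r := RingQuot.mkAlgHom ℝ r

/-- The class of a generator. -/
def gen (x : X) : Presented r := mk r (FreeAlgebra.ι ℝ x)

@[simp] theorem mk_ι (x : X) : mk r (FreeAlgebra.ι ℝ x) = gen r x := rfl

theorem mk_rel {a b : FreeAlgebra ℝ X} (hab : r a b) : mk r a = mk r b :=
  RingQuot.mkAlgHom_rel ℝ hab

/-- The universal property of the presentation. -/
def lift {B : Type*} [Semiring B] [Algebra ℝ B] (f : FreeAlgebra ℝ X →ₐ[ℝ] B)
    (hf : ∀ ⦃a b⦄, r a b → f a = f b) : Presented r →ₐ[ℝ] B :=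
  RingQuot.liftAlgHom ℝ ⟨f, hf⟩

@[simp] theorem lift_mk {B : Type*} [Semiring B] [Algebra ℝ B] (f : FreeAlgebra ℝ X →ₐ[ℝ] B)
    (hf : ∀ ⦃a b⦄, r a b → f a = f b) (a : FreeAlgebra ℝ X) : lift r f hf (mk r a) = f a :=
  RingQuot.liftAlgHom_mkAlgHom_apply ℝ f hf a

@[simp] theorem lift_gen {B : Type*} [Semiring B] [Algebra ℝ B] (f : FreeAlgebra ℝ X →ₐ[ℝ] B)
    (hf : ∀ ⦃a b⦄, r a b → f a = f b) (x : X) : lift r f hf (gen r x) = f (FreeAlgebra.ι ℝ x) :=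
  RingQuot.liftAlgHom_mkAlgHom_apply ℝ f hf _

theorem hom_ext {B : Type*} [Semiring B] [Algebra ℝ B] {f g : Presented r →ₐ[ℝ] B}
    (hfg : ∀ x, f (gen r x) = g (gen r x)) : f = g := by
  apply RingQuot.ringQuot_ext'
  apply FreeAlgebra.hom_ext
  funext x
  exact hfg x

end Presented

/-- The sign `±1`, as a real number.  Throughout, `ℤ₂` is written multiplicatively as
`ℤˣ = {1, -1}`: degree `0` is `1`, degree `1` is `-1`, and `(-1) ^ d` is the element itself. -/
abbrev sgn (u : ℤˣ) : ℝ := ((u : ℤ) : ℝ)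

/-- The action `ᵍa` on `U(1)` of an element whose linearity type is `u`: trivial for linear
elements, complex conjugation (which is inversion on `U(1)`) for antilinear elements. -/
def phaseTwist (u : ℤˣ) (a : Circle) : Circle := if u = 1 then a else a⁻¹

/-- Symmetry data of a free fermionic system: the group homomorphisms `s` (linear/antilinear) and
`h` (commuting/anticommuting with the Hamiltonian), and a `2`-cocycle `ω` with values in `U(1)`
twisted by `s`. -/
structure SymData (G : Type*) [Group G] where
  s : G →* ℤˣ
  h : G →* ℤˣ
  ω : G → G → Circle
  cocycle : ∀ a b c, ω a b * ω (a * b) c = phaseTwist (s a) (ω b c) * ω a (b * c)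

/-- Generators of the real algebra `ℂ[G, ω, s]`. -/
inductive AlgGen (G : Type*)
  | I : AlgGen G
  | elt (g : G) : AlgGen G

/-- The complex number `z` inside the free real algebra on the generators. -/
def freeScalar (G : Type*) (z : ℂ) : FreeAlgebra ℝ (AlgGen G) :=
  algebraMap ℝ _ z.re + z.im • FreeAlgebra.ι ℝ AlgGen.I

namespace SymData

variable {G : Type*} [Group G] (D : SymData G)

/-- Relations of `ℂ[G, ω, s]`.  The relation `one` identifies the unit of the twisted group algebra;
for a normalized cocycle it says that the neutral element of `G` is the unit. -/
inductive AlgRel : FreeAlgebra ℝ (AlgGen G) → FreeAlgebra ℝ (AlgGen G) → Prop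
  | I_sq : AlgRel (FreeAlgebra.ι ℝ AlgGen.I * FreeAlgebra.ι ℝ AlgGen.I) (-1)
  | one : AlgRel (FreeAlgebra.ι ℝ (AlgGen.elt 1)) (freeScalar G (D.ω 1 1))
  | mul (g g' : G) :
      AlgRel (FreeAlgebra.ι ℝ (AlgGen.elt g) * FreeAlgebra.ι ℝ (AlgGen.elt g'))
        (freeScalar G (D.ω g g') * FreeAlgebra.ι ℝ (AlgGen.elt (g * g')))
  | elt_I (g : G) :
      AlgRel (FreeAlgebra.ι ℝ (AlgGen.elt g) * FreeAlgebra.ι ℝ AlgGen.I)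
        (sgn (D.s g) • (FreeAlgebra.ι ℝ AlgGen.I * FreeAlgebra.ι ℝ (AlgGen.elt g)))

/-- The symmetry algebra `A = ℂ[G, ω, s]`, a real algebra. -/
abbrev Alg : Type _ := Presented D.AlgRel

/-- The imaginary unit in `A`. -/
def I : D.Alg := Presented.gen _ AlgGen.I

/-- The element of `A` given by a group element. -/
def elt (g : G) : D.Alg := Presented.gen _ (AlgGen.elt g)

/-- The complex number `z` in `A`. -/
def scalar (z : ℂ) : D.Alg := algebraMap ℝ _ z.re + z.im • D.I

theorem I_mul_I : D.I * D.I = -1 := by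
  simpa [I] using Presented.mk_rel _ (AlgRel.I_sq (D := D))

theorem mk_freeScalar (z : ℂ) : Presented.mk D.AlgRel (freeScalar G z) = D.scalar z := by
  simp [freeScalar, scalar, I]

theorem elt_one : D.elt 1 = D.scalar (D.ω 1 1) := by
  rw [← mk_freeScalar]; exact Presented.mk_rel _ (AlgRel.one (D := D))

theorem elt_mul (g g' : G) : D.elt g * D.elt g' = D.scalar (D.ω g g') * D.elt (g * g') := by
  rw [← mk_freeScalar]
  simpa [elt] using Presented.mk_rel _ (AlgRel.mul (D := D) g g')

theorem elt_mul_I (g : G) : D.elt g * D.I = sgn (D.s g) • (D.I * D.elt g) := by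
  simpa [elt, I] using Presented.mk_rel _ (AlgRel.elt_I (D := D) g)

end SymData

section DiracAlgebra

variable {G : Type*} [Group G] (D : SymData G)
variable {V : Type*} [NormedAddCommGroup V] [InnerProductSpace ℝ V] (ρV : G →* (V ≃ₗᵢ[ℝ] V))

/-- Generators of `Aⱽ`: those of `A`, and the vectors of `V`. -/
inductive VGen (G V : Type*)
  | base (x : AlgGen G) : VGen G V
  | vec (v : V) : VGen G V

/-- The inclusion of free algebras induced by the inclusion of generators. -/
def freeIncl (G V : Type*) : FreeAlgebra ℝ (AlgGen G) →ₐ[ℝ] FreeAlgebra ℝ (VGen G V) :=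
  FreeAlgebra.lift ℝ fun x => FreeAlgebra.ι ℝ (VGen.base x)

/-- Relations of `Aⱽ`: those of `A`; the vectors of `V` depend linearly on `v` and satisfy the
Clifford relation `v² = |v|²`; they commute with the complex numbers; and
`(-1)^{h(g)} g v g⁻¹ = ρ_V(g) v`. -/
inductive VRel : FreeAlgebra ℝ (VGen G V) → FreeAlgebra ℝ (VGen G V) → Prop
  | base {a b : FreeAlgebra ℝ (AlgGen G)} (hab : D.AlgRel a b) :
      VRel (freeIncl G V a) (freeIncl G V b)
  | add (v w : V) : VRel (FreeAlgebra.ι ℝ (VGen.vec (v + w)))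
      (FreeAlgebra.ι ℝ (VGen.vec v) + FreeAlgebra.ι ℝ (VGen.vec w))
  | smul (c : ℝ) (v : V) : VRel (FreeAlgebra.ι ℝ (VGen.vec (c • v)))
      (c • FreeAlgebra.ι ℝ (VGen.vec v))
  | sq (v : V) : VRel (FreeAlgebra.ι ℝ (VGen.vec v) * FreeAlgebra.ι ℝ (VGen.vec v))
      (algebraMap ℝ _ (‖v‖ ^ 2))
  | I_vec (v : V) :
      VRel (FreeAlgebra.ι ℝ (VGen.base AlgGen.I) * FreeAlgebra.ι ℝ (VGen.vec v))
        (FreeAlgebra.ι ℝ (VGen.vec v) * FreeAlgebra.ι ℝ (VGen.base AlgGen.I))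
  | elt_vec (g : G) (v : V) :
      VRel (sgn (D.h g) •
          (FreeAlgebra.ι ℝ (VGen.base (AlgGen.elt g)) * FreeAlgebra.ι ℝ (VGen.vec v)))
        (FreeAlgebra.ι ℝ (VGen.vec (ρV g v)) * FreeAlgebra.ι ℝ (VGen.base (AlgGen.elt g)))

/-- The algebra `Aⱽ` of Dirac Hamiltonians. -/
abbrev AlgV : Type _ := Presented (VRel D ρV)

/-- The inclusion `A → Aⱽ`. -/
def algIncl : D.Alg →ₐ[ℝ] AlgV D ρV :=
  Presented.lift _ ((Presented.mk (VRel D ρV)).comp (freeIncl G V))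
    fun _ _ hab => Presented.mk_rel _ (VRel.base hab)

/-- The vector `v ∈ V` as an element of `Aⱽ`. -/
def algVec (v : V) : AlgV D ρV := Presented.gen _ (VGen.vec v)

theorem algIncl_I : algIncl D ρV D.I = Presented.gen _ (VGen.base AlgGen.I) := by
  simp [algIncl, SymData.I, freeIncl]

theorem algIncl_elt (g : G) :
    algIncl D ρV (D.elt g) = Presented.gen _ (VGen.base (AlgGen.elt g)) := by
  simp [algIncl, SymData.elt, freeIncl]

theorem algVec_add (v w : V) : algVec D ρV (v + w) = algVec D ρV v + algVec D ρV w := by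
  simpa [algVec] using Presented.mk_rel _ (VRel.add (D := D) (ρV := ρV) v w)

theorem algVec_smul (c : ℝ) (v : V) : algVec D ρV (c • v) = c • algVec D ρV v := by
  simpa [algVec] using Presented.mk_rel _ (VRel.smul (D := D) (ρV := ρV) c v)

theorem algVec_sq (v : V) : algVec D ρV v * algVec D ρV v = algebraMap ℝ _ (‖v‖ ^ 2) := by
  simpa [algVec] using Presented.mk_rel _ (VRel.sq (D := D) (ρV := ρV) v)

theorem I_algVec (v : V) :
    algIncl D ρV D.I * algVec D ρV v = algVec D ρV v * algIncl D ρV D.I := by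
  rw [algIncl_I]
  simpa [algVec] using Presented.mk_rel _ (VRel.I_vec (D := D) (ρV := ρV) v)

theorem elt_algVec (g : G) (v : V) :
    sgn (D.h g) • (algIncl D ρV (D.elt g) * algVec D ρV v) =
      algVec D ρV (ρV g v) * algIncl D ρV (D.elt g) := by
  have := Presented.mk_rel _ (VRel.elt_vec (D := D) (ρV := ρV) g v)
  rw [algIncl_elt]
  rw [map_smul, map_mul, map_mul] at this
  exact this

theorem sgn_mul_self (u : ℤˣ) : sgn u * sgn u = 1 := by
  rcases Int.units_eq_one_or u with rfl | rfl <;> simp [sgn]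

/-- Action of the parity automorphism on generators. -/
def parityGen : VGen G V → AlgV D ρV
  | .base .I => algIncl D ρV D.I
  | .base (.elt g) => sgn (D.h g) • algIncl D ρV (D.elt g)
  | .vec v => - algVec D ρV v

theorem parityFree_incl (a b : FreeAlgebra ℝ (AlgGen G)) (hab : D.AlgRel a b) :
    FreeAlgebra.lift ℝ (parityGen D ρV) (freeIncl G V a) =
      FreeAlgebra.lift ℝ (parityGen D ρV) (freeIncl G V b) := by
  have hs : ∀ z : ℂ, FreeAlgebra.lift ℝ (parityGen D ρV) (freeIncl G V (freeScalar G z)) =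
      algIncl D ρV (D.scalar z) := by
    intro z; simp [freeScalar, freeIncl, parityGen, SymData.scalar]
  have hI : FreeAlgebra.lift ℝ (parityGen D ρV) (freeIncl G V (FreeAlgebra.ι ℝ AlgGen.I)) =
      algIncl D ρV D.I := by
    simp [freeIncl, parityGen]
  have hg : ∀ g, FreeAlgebra.lift ℝ (parityGen D ρV)
      (freeIncl G V (FreeAlgebra.ι ℝ (AlgGen.elt g))) =
        sgn (D.h g) • algIncl D ρV (D.elt g) := by
    intro g; simp [freeIncl, parityGen]
  cases hab with
  | I_sq => simp only [map_mul, hI, map_neg, map_one, ← map_mul (algIncl D ρV), D.I_mul_I]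
  | one => rw [hs, hg, D.elt_one, map_one]; simp [sgn]
  | mul g g' =>
    simp only [map_mul, hs, hg]
    rw [smul_mul_smul_comm, ← map_mul, D.elt_mul, map_mul, mul_smul_comm]
    simp [sgn]
  | elt_I g =>
    simp only [map_mul, map_smul, hI, hg]
    rw [smul_mul_assoc, ← map_mul, D.elt_mul_I, map_smul, mul_smul_comm, map_mul, smul_comm]

/-- The parity automorphism of `Aⱽ`: it fixes the complex numbers, multiplies `g ∈ G` by
`(-1)^{h(g)}` and every vector of `V` by `-1`. -/
def parity : AlgV D ρV →ₐ[ℝ] AlgV D ρV :=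
  Presented.lift _ (FreeAlgebra.lift ℝ (parityGen D ρV)) <| by
    intro x y hxy
    cases hxy with
    | base hab => exact parityFree_incl D ρV _ _ hab
    | add v w => simp [parityGen, algVec_add, add_comm]
    | smul c v => simp [parityGen, algVec_smul]
    | sq v =>
      have := algVec_sq D ρV v
      simpa [parityGen] using this
    | I_vec v =>
      have := I_algVec D ρV v
      simpa [parityGen] using this
    | elt_vec g v =>
      have := elt_algVec D ρV g v
      simp only [map_smul, map_mul, FreeAlgebra.lift_ι_apply, parityGen, smul_mul_assoc,
        mul_neg, smul_neg, neg_mul, mul_smul_comm, neg_inj]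
      rw [this]

@[simp] theorem parity_I : parity D ρV (algIncl D ρV D.I) = algIncl D ρV D.I := by
  conv_lhs => rw [algIncl_I]
  simp [parity, parityGen]

@[simp] theorem parity_elt (g : G) :
    parity D ρV (algIncl D ρV (D.elt g)) = sgn (D.h g) • algIncl D ρV (D.elt g) := by
  conv_lhs => rw [algIncl_elt]
  simp [parity, parityGen]

@[simp] theorem parity_vec (v : V) : parity D ρV (algVec D ρV v) = - algVec D ρV v := by
  conv_lhs => rw [algVec]
  simp [parity, parityGen]

theorem parity_parity (a : AlgV D ρV) : parity D ρV (parity D ρV a) = a := by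
  have : (parity D ρV).comp (parity D ρV) = AlgHom.id ℝ _ := by
    apply Presented.hom_ext
    rintro ((_ | g) | v)
    · rw [← algIncl_I]; simp
    · rw [← algIncl_elt]; simp [smul_smul, -Int.cast_mul, sgn_mul_self]
    · change parity D ρV (parity D ρV (algVec D ρV v)) = algVec D ρV v
      simp
  exact DFunLike.congr_fun this a

/-- The `ℤ₂`-grading of `Aⱽ`: the component of degree `j` consists of the elements on which the
parity automorphism is multiplication by `(-1) ^ j`. -/
def degPart (j : ZMod 2) : Submodule ℝ (AlgV D ρV) :=
  LinearMap.ker ((parity D ρV).toLinearMap - sgn ((-1 : ℤˣ) ^ j) • LinearMap.id)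

theorem mem_degPart {j : ZMod 2} {a : AlgV D ρV} :
    a ∈ degPart D ρV j ↔ parity D ρV a = sgn ((-1 : ℤˣ) ^ j) • a := by
  simp [degPart, sub_eq_zero]

instance : SetLike.GradedMonoid (degPart D ρV) where
  one_mem := by simp [mem_degPart, sgn]
  mul_mem := by
    intro i j a b ha hb
    rw [mem_degPart] at *
    rw [map_mul, ha, hb, smul_mul_smul_comm, uzpow_add]
    simp [sgn]

theorem half_add_mem (j : ZMod 2) (a : AlgV D ρV) :
    (1 / 2 : ℝ) • (a + sgn ((-1 : ℤˣ) ^ j) • parity D ρV a) ∈ degPart D ρV j := by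
  rw [mem_degPart, map_smul, map_add, map_smul, parity_parity, smul_comm (sgn _) (1 / 2 : ℝ),
    smul_add (sgn _), smul_smul (sgn _) (sgn _), sgn_mul_self, one_smul, add_comm]

/-- The projection to the component of degree `j`. -/
def degProj (j : ZMod 2) : AlgV D ρV →ₗ[ℝ] degPart D ρV j :=
  LinearMap.codRestrict _
    ((1 / 2 : ℝ) • (LinearMap.id + sgn ((-1 : ℤˣ) ^ j) • (parity D ρV).toLinearMap))
    (fun a => half_add_mem D ρV j a)

theorem coe_degProj (j : ZMod 2) (a : AlgV D ρV) :
    (degProj D ρV j a : AlgV D ρV) =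
      (1 / 2 : ℝ) • (a + sgn ((-1 : ℤˣ) ^ j) • parity D ρV a) := rfl

theorem zmod2_cases : ∀ i : ZMod 2, i = 0 ∨ i = 1 := by decide

theorem degProj_of_mem {i j : ZMod 2} {a : AlgV D ρV} (ha : a ∈ degPart D ρV i) :
    (degProj D ρV j a : AlgV D ρV) = if i = j then a else 0 := by
  rw [mem_degPart] at ha
  rw [coe_degProj, ha]
  have h01 : ((0 : ZMod 2) = 1) = False := by simp
  have h10 : ((1 : ZMod 2) = 0) = False := by simp
  rcases zmod2_cases i with rfl | rfl <;> rcases zmod2_cases j with rfl | rfl <;>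
    simp [sgn, h01, h10]
  all_goals module

instance : GradedAlgebra (degPart D ρV) where
  toDecomposition := DirectSum.Decomposition.ofLinearMap _
    (DirectSum.lof ℝ (ZMod 2) (fun j => degPart D ρV j) 0 ∘ₗ degProj D ρV 0 +
      DirectSum.lof ℝ (ZMod 2) (fun j => degPart D ρV j) 1 ∘ₗ degProj D ρV 1)
    (by
      apply LinearMap.ext
      intro a
      simp only [LinearMap.comp_apply, LinearMap.add_apply, map_add, DirectSum.coeLinearMap_lof,
        coe_degProj, LinearMap.id_apply]
      simp [sgn]
      module)
    (by
      ext i a : 2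
      simp only [LinearMap.comp_apply, LinearMap.add_apply, DirectSum.coeLinearMap_lof,
        LinearMap.id_apply]
      have h : ∀ j, degProj D ρV j (a : AlgV D ρV) =
          if hij : i = j then hij ▸ a else 0 := by
        intro j
        apply Subtype.ext
        rw [degProj_of_mem D ρV a.2]
        split_ifs with hij
        · subst hij; rfl
        · rfl
      rw [h, h]
      rcases zmod2_cases i with rfl | rfl <;> simp)

end DiracAlgebra

section Modules

/-- A finite-dimensional module over a real algebra `B`, given by its representation `ρ`. -/
structure FDMod (B : Type*) [Ring B] [Algebra ℝ B] where
  carrier : Type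
  [acg : AddCommGroup carrier]
  [mod : Module ℝ carrier]
  [fin : FiniteDimensional ℝ carrier]
  ρ : B →ₐ[ℝ] Module.End ℝ carrier

attribute [instance] FDMod.acg FDMod.mod FDMod.fin

namespace FDMod

variable {A B : Type*} [Ring A] [Algebra ℝ A] [Ring B] [Algebra ℝ B]

/-- The canonical topology of a finite-dimensional real vector space. -/
instance (W : FDMod B) : TopologicalSpace W.carrier := moduleTopology ℝ W.carrier

instance (W : FDMod B) : IsModuleTopology ℝ W.carrier := ⟨rfl⟩

/-- The canonical topology of the endomorphism algebra of a finite-dimensional module. -/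
instance (W : FDMod B) : TopologicalSpace (Module.End ℝ W.carrier) :=
  moduleTopology ℝ (Module.End ℝ W.carrier)

instance (W : FDMod B) : IsModuleTopology ℝ (Module.End ℝ W.carrier) := ⟨rfl⟩

/-- Isomorphism of modules. -/
def Iso (W W' : FDMod B) : Prop :=
  ∃ e : W.carrier ≃ₗ[ℝ] W'.carrier, ∀ b w, e (W.ρ b w) = W'.ρ b (e w)

/-- Irreducible modules. -/
def Irred (W : FDMod B) : Prop :=
  Nontrivial W.carrier ∧ ∀ N : Submodule ℝ W.carrier,
    (∀ b, ∀ w ∈ N, W.ρ b w ∈ N) → N = ⊥ ∨ N = ⊤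

/-- The direct sum of two modules. -/
def sum (W W' : FDMod B) : FDMod B where
  carrier := W.carrier × W'.carrier
  ρ := (LinearMap.prodMapAlgHom ℝ W.carrier W'.carrier).comp (W.ρ.prod W'.ρ)

@[simp] theorem sum_ρ (W W' : FDMod B) (b : B) :
    (W.sum W').ρ b = (W.ρ b).prodMap (W'.ρ b) := rfl

/-- Restriction of a module along an algebra homomorphism. -/
abbrev res (f : A →ₐ[ℝ] B) (W : FDMod B) : FDMod A where
  carrier := W.carrier
  ρ := W.ρ.comp f

end FDMod

/-- The relations `[W ⊕ W'] = [W] + [W']`, and `[W] = [W']` for isomorphic modules. -/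
def grothRel (B : Type*) [Ring B] [Algebra ℝ B] : AddSubgroup (FreeAbelianGroup (FDMod B)) :=
  AddSubgroup.closure
    ({x | ∃ W W' : FDMod B, x = FreeAbelianGroup.of (W.sum W') -
        (FreeAbelianGroup.of W + FreeAbelianGroup.of W')} ∪
      {x | ∃ W W' : FDMod B, W.Iso W' ∧ x = FreeAbelianGroup.of W - FreeAbelianGroup.of W'})

/-- The Grothendieck group of finite-dimensional modules over `B`. -/
abbrev Groth (B : Type*) [Ring B] [Algebra ℝ B] : Type _ :=
  FreeAbelianGroup (FDMod B) ⧸ grothRel B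

/-- The homomorphism of Grothendieck groups induced by an algebra homomorphism. -/
def Groth.res {A B : Type*} [Ring A] [Algebra ℝ A] [Ring B] [Algebra ℝ B] (f : A →ₐ[ℝ] B) :
    Groth B →+ Groth A :=
  QuotientAddGroup.map _ _ (FreeAbelianGroup.map (FDMod.res f)) <| by
    rw [grothRel, AddSubgroup.closure_le]
    rintro x (⟨W, W', rfl⟩ | ⟨W, W', ⟨e, he⟩, rfl⟩)
    · refine AddSubgroup.subset_closure (Or.inl ⟨W.res f, W'.res f, ?_⟩)
      simp only [map_sub, map_add, FreeAbelianGroup.map_of_apply]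
      rfl
    · refine AddSubgroup.subset_closure (Or.inr ⟨W.res f, W'.res f, ⟨e, fun b w => he _ _⟩, ?_⟩)
      simp only [map_sub, FreeAbelianGroup.map_of_apply]

end Modules

section Clifford

/-- The positive definite quadratic form `∑ xᵢ²` on `ℝⁿ`. -/
abbrev posForm (n : ℕ) : QuadraticForm ℝ (Fin n → ℝ) :=
  QuadraticMap.weightedSumSquares ℝ (fun _ : Fin n => (1 : ℝ))

/-- The real Clifford algebra `Cl^{0,n}`, with `n` anticommuting generators of square `1`. -/
abbrev Cl (n : ℕ) : Type := CliffordAlgebra (posForm n)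

/-- The `i`-th generator of `Cl^{0,n}`. -/
def clGen (n : ℕ) (i : Fin n) : Cl n := CliffordAlgebra.ι (posForm n) (Pi.single i 1)

/-- The isometric inclusion `ℝ¹ → ℝ²`, `e₁ ↦ e₁`. -/
def inclIsometry : posForm 1 →qᵢ posForm 2 where
  toLinearMap := LinearMap.pi ![LinearMap.proj 0, 0]
  map_app' := by intro v; simp [QuadraticMap.weightedSumSquares_apply]

/-- The inclusion `Cl^{0,1} → Cl^{0,2}`. -/
def clIncl : Cl 1 →ₐ[ℝ] Cl 2 := CliffordAlgebra.map inclIsometry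

theorem clIncl_gen : clIncl (clGen 1 0) = clGen 2 0 := by
  rw [clIncl, clGen, CliffordAlgebra.map_apply_ι, clGen]
  congr 1
  ext i
  change (LinearMap.pi ![LinearMap.proj 0, 0] : (Fin 1 → ℝ) →ₗ[ℝ] (Fin 2 → ℝ))
    (Pi.single 0 1) i = _
  fin_cases i <;> simp

theorem clIncl_mem {i : ZMod 2} {a : Cl 1} (ha : a ∈ CliffordAlgebra.evenOdd (posForm 1) i) :
    clIncl a ∈ CliffordAlgebra.evenOdd (posForm 2) i := by
  have key : (CliffordAlgebra.evenOdd (posForm 1) i).map clIncl.toLinearMap ≤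
      CliffordAlgebra.evenOdd (posForm 2) i := by
    rw [CliffordAlgebra.evenOdd, CliffordAlgebra.evenOdd, Submodule.map_iSup]
    refine iSup_mono fun n => ?_
    rw [Submodule.map_pow]
    refine pow_le_pow_left' ?_ _
    rintro _ ⟨_, ⟨v, rfl⟩, rfl⟩
    exact ⟨inclIsometry v, (CliffordAlgebra.map_apply_ι inclIsometry v).symm⟩
  exact key (Submodule.mem_map_of_mem ha)

variable {G : Type*} [Group G] (D : SymData G)
variable {V : Type*} [NormedAddCommGroup V] [InnerProductSpace ℝ V] (ρV : G →* (V ≃ₗᵢ[ℝ] V))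

/-- The super tensor product `Cl^{0,n} ⊗̂ Aⱽ`. -/
abbrev DirAlg (n : ℕ) : Type _ := CliffordAlgebra.evenOdd (posForm n) ᵍ⊗[ℝ] degPart D ρV

/-- The inclusion `Aⱽ → Cl^{0,n} ⊗̂ Aⱽ`. -/
def fromAlgV (n : ℕ) : AlgV D ρV →ₐ[ℝ] DirAlg D ρV n := GradedTensorProduct.includeRight _ _

/-- The inclusion `Cl^{0,n} → Cl^{0,n} ⊗̂ Aⱽ`. -/
def fromCl (n : ℕ) : Cl n →ₐ[ℝ] DirAlg D ρV n := GradedTensorProduct.includeLeft _ _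

/-- The element `ẽ₁ ⊗̂ 1` of `Cl^{0,1} ⊗̂ Aⱽ`. -/
def massElt : DirAlg D ρV 1 := fromCl D ρV 1 (clGen 1 0)

theorem fromCl_mul_fromAlgV (n : ℕ) {i j : ZMod 2} {a : Cl n}
    (ha : a ∈ CliffordAlgebra.evenOdd (posForm n) i) {b : AlgV D ρV} (hb : b ∈ degPart D ρV j) :
    fromCl D ρV n a * fromAlgV D ρV n b =
      (-1 : ℤˣ) ^ (j * i) • (fromAlgV D ρV n b * fromCl D ρV n a) :=
  ((GradedTensorProduct.liftEquiv (R := ℝ) (CliffordAlgebra.evenOdd (posForm n))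
    (degPart D ρV)).symm (AlgHom.id ℝ _)).2 ⟨a, ha⟩ ⟨b, hb⟩

/-- The inclusion `Cl^{0,1} ⊗̂ Aⱽ → Cl^{0,2} ⊗̂ Aⱽ`. -/
def dirIncl : DirAlg D ρV 1 →ₐ[ℝ] DirAlg D ρV 2 :=
  GradedTensorProduct.lift _ _ ((fromCl D ρV 2).comp clIncl) (fromAlgV D ρV 2)
    fun _ _ a b => fromCl_mul_fromAlgV D ρV 2 (clIncl_mem a.2) b.2

/-- The algebraic classification: the cokernel of the restriction homomorphism from the
Grothendieck group of `Cl^{0,2} ⊗̂ Aⱽ` to that of `Cl^{0,1} ⊗̂ Aⱽ`. -/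
abbrev AlgClass : Type _ := Groth (DirAlg D ρV 1) ⧸ (Groth.res (dirIncl D ρV)).range

/-- The class of a module in the algebraic classification. -/
def AlgClass.mk (W : FDMod (DirAlg D ρV 1)) : AlgClass D ρV :=
  QuotientAddGroup.mk (QuotientAddGroup.mk (FreeAbelianGroup.of W))

end Clifford

section Bundles

variable {G : Type*} [Group G]

/-- A family of `ℤ₂`-graded finite-dimensional vector spaces `E = E₀ ⊕ E₁` over a `G`-space `X`,
with an action of `A = ℂ[G, ω, s]` covering the action of `G` on `X`.  `Fib i x` is the fibre of
degree `i` at `x`, the total spaces of both degrees carry a topology, `J` is multiplication by the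
imaginary unit and `act g` maps the fibre over `x` to the fibre over `g • x`, preserving or
exchanging the degrees according to `h g`. -/
structure GrFamily (D : SymData G) (X : Type*) [MulAction G X] where
  Fib : ℤˣ → X → Type
  [acg : ∀ i x, AddCommGroup (Fib i x)]
  [mod : ∀ i x, Module ℝ (Fib i x)]
  [top : ∀ i, TopologicalSpace (Σ x, Fib i x)]
  J : ∀ i x, Fib i x →ₗ[ℝ] Fib i x
  act : ∀ g i x, Fib i x →ₗ[ℝ] Fib (D.h g * i) (g • x)
  J_J : ∀ i x e, J i x (J i x e) = - e
  act_J : ∀ g i x e, act g i x (J i x e) = sgn (D.s g) • J _ _ (act g i x e)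
  act_one : ∀ i x e, (⟨(D.h 1 * i, (1 : G) • x), act 1 i x e⟩ : Σ p : ℤˣ × X, Fib p.1 p.2) =
    ⟨(i, x), (D.ω 1 1 : ℂ).re • e + (D.ω 1 1 : ℂ).im • J i x e⟩
  act_mul : ∀ g g' i x e,
    (⟨(D.h g * (D.h g' * i), g • g' • x), act g _ _ (act g' i x e)⟩ :
        Σ p : ℤˣ × X, Fib p.1 p.2) =
      ⟨(D.h (g * g') * i, (g * g') • x),
        (D.ω g g' : ℂ).re • act (g * g') i x e +
          (D.ω g g' : ℂ).im • J _ _ (act (g * g') i x e)⟩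

attribute [instance] GrFamily.acg GrFamily.mod GrFamily.top

namespace GrFamily

variable {D : SymData G} {X : Type*} [MulAction G X]

/-- The total space of degree `i`. -/
abbrev Tot (E : GrFamily D X) (i : ℤˣ) : Type _ := Σ x, E.Fib i x

/-- The family is a vector bundle: `E₀` and `E₁` are locally trivial, and the action of `A` is
continuous. -/
def IsBundle [TopologicalSpace X] (E : GrFamily D X) : Prop :=
  (∀ i, Continuous (fun e : E.Tot i => (⟨e.1, E.J i e.1 e.2⟩ : E.Tot i))) ∧
  (∀ g i, Continuous (fun e : E.Tot i =>
    (⟨g • e.1, E.act g i e.1 e.2⟩ : E.Tot (D.h g * i)))) ∧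
  (∀ i, Continuous (fun e : E.Tot i => e.1)) ∧
  ∀ i x₀, ∃ (O : Set X) (n : ℕ) (t : ∀ x : O, E.Fib i x ≃ₗ[ℝ] (Fin n → ℝ)),
    IsOpen O ∧ x₀ ∈ O ∧
    Continuous (fun e : {e : E.Tot i // e.1 ∈ O} => t ⟨e.1.1, e.2⟩ e.1.2) ∧
    Continuous (fun p : O × (Fin n → ℝ) => (⟨p.1, (t p.1).symm p.2⟩ : E.Tot i))

/-- An isomorphism: fibrewise linear isomorphisms preserving the degree, commuting with the action
of `A`, which together form homeomorphisms of the total spaces. -/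
structure Iso (E E' : GrFamily D X) where
  toEquiv : ∀ i x, E.Fib i x ≃ₗ[ℝ] E'.Fib i x
  cont : ∀ i, Continuous (fun e : E.Tot i => (⟨e.1, toEquiv i e.1 e.2⟩ : E'.Tot i))
  cont_symm : ∀ i, Continuous (fun e : E'.Tot i => (⟨e.1, (toEquiv i e.1).symm e.2⟩ : E.Tot i))
  map_J : ∀ i x e, toEquiv i x (E.J i x e) = E'.J i x (toEquiv i x e)
  map_act : ∀ g i x e, toEquiv _ _ (E.act g i x e) = E'.act g i x (toEquiv i x e)

end GrFamily

theorem sigma_sub_ext {ι M : Type*} [AddCommGroup M] [Module ℝ M] {S : ι → Submodule ℝ M}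
    {p q : ι} (hpq : p = q) (a : S p) (b : S q) (hab : (a : M) = b) :
    (⟨p, a⟩ : Σ p, S p) = ⟨q, b⟩ := by
  subst hpq
  rw [Subtype.ext hab]

theorem sgn_mul (u v : ℤˣ) : sgn (u * v) = sgn u * sgn v := by simp [sgn]

section Rep

variable (D : SymData G)

theorem rep_I_I {W : Type*} [AddCommGroup W] [Module ℝ W] (ρ : D.Alg →ₐ[ℝ] Module.End ℝ W)
    (w : W) : ρ D.I (ρ D.I w) = - w := by
  rw [← Module.End.mul_apply, ← map_mul, D.I_mul_I]; simp

theorem rep_elt_I {W : Type*} [AddCommGroup W] [Module ℝ W] (ρ : D.Alg →ₐ[ℝ] Module.End ℝ W)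
    (g : G) (w : W) : ρ (D.elt g) (ρ D.I w) = sgn (D.s g) • ρ D.I (ρ (D.elt g) w) := by
  rw [← Module.End.mul_apply, ← map_mul, D.elt_mul_I, map_smul, map_mul]; rfl

theorem rep_scalar {W : Type*} [AddCommGroup W] [Module ℝ W] (ρ : D.Alg →ₐ[ℝ] Module.End ℝ W)
    (z : ℂ) (w : W) : ρ (D.scalar z) w = z.re • w + z.im • ρ D.I w := by
  simp [SymData.scalar]

theorem rep_one {W : Type*} [AddCommGroup W] [Module ℝ W] (ρ : D.Alg →ₐ[ℝ] Module.End ℝ W)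
    (w : W) : ρ (D.elt 1) w = (D.ω 1 1 : ℂ).re • w + (D.ω 1 1 : ℂ).im • ρ D.I w := by
  rw [D.elt_one, rep_scalar]

theorem rep_mul {W : Type*} [AddCommGroup W] [Module ℝ W] (ρ : D.Alg →ₐ[ℝ] Module.End ℝ W)
    (g g' : G) (w : W) : ρ (D.elt g) (ρ (D.elt g') w) =
      (D.ω g g' : ℂ).re • ρ (D.elt (g * g')) w +
        (D.ω g g' : ℂ).im • ρ D.I (ρ (D.elt (g * g')) w) := by
  rw [← Module.End.mul_apply, ← map_mul, D.elt_mul, map_mul, Module.End.mul_apply, rep_scalar]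

end Rep

/-- An object of `Vect_A(X)`: the product bundle `X × U` of a `G`-space `X` and an ungraded
`A`-module `U`, with a `ℤ₂`-grading compatible with the action of `A`.  The grading is given by the
continuous family of involutions `ε x` of `U` equal to `1` on `(E₀)ₓ` and to `-1` on `(E₁)ₓ`. -/
structure VectObj (D : SymData G) (X : Type*) [TopologicalSpace X] [MulAction G X] where
  U : FDMod D.Alg
  ε : X → Module.End ℝ U.carrier
  cont : Continuous ε
  sq : ∀ x, ε x * ε x = 1
  comm_I : ∀ x, ε x * U.ρ D.I = U.ρ D.I * ε x
  equivariant : ∀ g x, ε (g • x) * U.ρ (D.elt g) = sgn (D.h g) • (U.ρ (D.elt g) * ε x)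

namespace VectObj

variable {D : SymData G} {X : Type*} [TopologicalSpace X] [MulAction G X]

/-- The fibre of `Eᵢ` at `x`: the eigenspace of `ε x` for the eigenvalue `(-1)^i`. -/
def fib (E : VectObj D X) (i : ℤˣ) (x : X) : Submodule ℝ E.U.carrier :=
  LinearMap.ker (E.ε x - sgn i • LinearMap.id)

theorem mem_fib (E : VectObj D X) {i : ℤˣ} {x : X} {u : E.U.carrier} :
    u ∈ E.fib i x ↔ E.ε x u = sgn i • u := by
  simp [fib, sub_eq_zero]

theorem I_mem_fib (E : VectObj D X) {i : ℤˣ} {x : X} {u : E.U.carrier} (hu : u ∈ E.fib i x) :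
    E.U.ρ D.I u ∈ E.fib i x := by
  rw [mem_fib] at *
  rw [← Module.End.mul_apply, E.comm_I, Module.End.mul_apply, hu, map_smul]

theorem elt_mem_fib (E : VectObj D X) (g : G) {i : ℤˣ} {x : X} {u : E.U.carrier}
    (hu : u ∈ E.fib i x) : E.U.ρ (D.elt g) u ∈ E.fib (D.h g * i) (g • x) := by
  rw [mem_fib] at *
  rw [← Module.End.mul_apply, E.equivariant, LinearMap.smul_apply, Module.End.mul_apply, hu,
    map_smul, smul_smul, sgn_mul]

/-- The graded family `E₀ ⊕ E₁`; the total space of `Eᵢ` is a subspace of `X × U`. -/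
def toFamily (E : VectObj D X) : GrFamily D X where
  Fib i x := E.fib i x
  top _ := TopologicalSpace.induced (fun e => ((e.1, e.2.1) : X × E.U.carrier)) inferInstance
  J _ _ := (E.U.ρ D.I).restrict fun _ hu => E.I_mem_fib hu
  act g _ _ := (E.U.ρ (D.elt g)).restrict fun _ hu => E.elt_mem_fib g hu
  J_J _ _ e := Subtype.ext (rep_I_I D E.U.ρ e.1)
  act_J g _ _ e := Subtype.ext (rep_elt_I D E.U.ρ g e.1)
  act_one i x e := sigma_sub_ext (S := fun p : ℤˣ × X => E.fib p.1 p.2) (by simp) _ _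
    (rep_one D E.U.ρ e.1)
  act_mul g g' i x e := sigma_sub_ext (S := fun p : ℤˣ × X => E.fib p.1 p.2)
    (by simp [mul_assoc, mul_smul]) _ _ (rep_mul D E.U.ρ g g' e.1)

/-- The direct sum of two objects. -/
def sum (E E' : VectObj D X) : VectObj D X where
  U := E.U.sum E'.U
  ε x := (E.ε x).prodMap (E'.ε x)
  cont := by
    let : TopologicalSpace (Module.End ℝ (E.U.carrier × E'.U.carrier)) := moduleTopology ℝ _
    have : IsModuleTopology ℝ (Module.End ℝ (E.U.carrier × E'.U.carrier)) := ⟨rfl⟩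
    have : ContinuousAdd (Module.End ℝ (E.U.carrier × E'.U.carrier)) :=
      IsModuleTopology.toContinuousAdd ℝ _
    have : ContinuousSMul ℝ (Module.End ℝ (E.U.carrier × E'.U.carrier)) :=
      IsModuleTopology.toContinuousSMul ℝ _
    have h := IsModuleTopology.continuous_of_linearMap
      (LinearMap.prodMapLinear ℝ E.U.carrier E'.U.carrier E.U.carrier E'.U.carrier ℝ)
    exact h.comp (E.cont.prodMk E'.cont)
  sq x := LinearMap.ext fun p => Prod.ext (LinearMap.congr_fun (E.sq x) p.1)
    (LinearMap.congr_fun (E'.sq x) p.2)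
  comm_I x := LinearMap.ext fun p => Prod.ext (LinearMap.congr_fun (E.comm_I x) p.1)
    (LinearMap.congr_fun (E'.comm_I x) p.2)
  equivariant g x := LinearMap.ext fun p => Prod.ext (LinearMap.congr_fun (E.equivariant g x) p.1)
    (LinearMap.congr_fun (E'.equivariant g x) p.2)

/-- Trivial objects: products of `X` with a graded `A`-module. -/
def IsTrivial (E : VectObj D X) : Prop := ∀ x y, E.ε x = E.ε y

end VectObj

/-- The relations defining the bundle-theoretic classification: isomorphism of objects of
`Vect_A(X)`, and addition of a trivial object. -/
inductive KRel (D : SymData G) (X : Type*) [TopologicalSpace X] [MulAction G X] :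
    VectObj D X → VectObj D X → Prop
  | iso {E E' : VectObj D X} (e : E.toFamily.Iso E'.toFamily) : KRel D X E E'
  | add (E : VectObj D X) {F : VectObj D X} (hF : F.IsTrivial) : KRel D X E (E.sum F)

/-- The bundle-theoretic classification `K̃_A(X)`: objects of `Vect_A(X)` up to the equivalence
relation generated by isomorphism and by `E ∼ E ⊕ F` for trivial `F`. -/
def KTilde (D : SymData G) (X : Type*) [TopologicalSpace X] [MulAction G X] : Type _ :=
  Quot (KRel D X)

/-- The class of an object of `Vect_A(X)`. -/
def KTilde.mk {D : SymData G} {X : Type*} [TopologicalSpace X] [MulAction G X]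
    (E : VectObj D X) : KTilde D X := Quot.mk _ E

end Bundles

section Sphere

variable {G : Type*} [Group G] (D : SymData G)
variable {V : Type*} [NormedAddCommGroup V] [InnerProductSpace ℝ V] (ρV : G →* (V ≃ₗᵢ[ℝ] V))

/-- The representation sphere `S^V`, as the unit sphere of `ℝ ⊕ V`; the point `k` has the
coordinates `k₀ = k.1.1` and `(k₁, …, k_q) = k.1.2`. -/
def RepSphere (_ : G →* (V ≃ₗᵢ[ℝ] V)) : Type _ := {k : ℝ × V // k.1 ^ 2 + ‖k.2‖ ^ 2 = 1}

instance : TopologicalSpace (RepSphere ρV) :=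
  inferInstanceAs (TopologicalSpace {k : ℝ × V // k.1 ^ 2 + ‖k.2‖ ^ 2 = 1})

/-- `G` acts on the summand `V`. -/
instance : MulAction G (RepSphere ρV) where
  smul g k := ⟨(k.1.1, ρV g k.1.2), by simpa using k.2⟩
  one_smul k := by
    apply Subtype.ext
    change (k.1.1, ρV 1 k.1.2) = k.1
    simp
  mul_smul g g' k := by
    apply Subtype.ext
    change (k.1.1, ρV (g * g') k.1.2) = (k.1.1, ρV g (ρV g' k.1.2))
    simp

/-- The base point of `S^V`, the point at infinity of the one-point compactification of `V`: the
south pole `k₀ = -1`. -/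
def infty : RepSphere ρV := ⟨(-1, 0), by simp⟩

@[simp] theorem smul_fst (g : G) (k : RepSphere ρV) : (g • k).1.1 = k.1.1 := rfl

@[simp] theorem smul_snd (g : G) (k : RepSphere ρV) : (g • k).1.2 = ρV g k.1.2 := rfl

variable {ρV} in
/-- The Dirac Hamiltonian with mass term `M` on the northern hemisphere `k₀ ≥ 0` and mass term `M₀`
on the southern hemisphere `k₀ ≤ 0`; `Γ v = ∑ vᵢ Γ̃ᵢ`. -/
def dirac {U : Type*} [AddCommGroup U] [Module ℝ U] (M M₀ : Module.End ℝ U)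
    (Γ : V → Module.End ℝ U) (k : RepSphere ρV) : Module.End ℝ U :=
  if 0 ≤ k.1.1 then -(k.1.1 • M) + Γ k.1.2 else k.1.1 • M₀ + Γ k.1.2

/-- A finite-dimensional `ℤ₂`-graded `Aⱽ`-module `W = W₀ ⊕ W₁`. -/
structure GrMod where
  W : FDMod (AlgV D ρV)
  gr : ℤˣ → Submodule ℝ W.carrier
  compl : IsCompl (gr 1) (gr (-1))
  map_mem : ∀ (j : ZMod 2) (a : AlgV D ρV), a ∈ degPart D ρV j →
    ∀ i, ∀ w ∈ gr i, W.ρ a w ∈ gr ((-1 : ℤˣ) ^ j * i)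

namespace GrMod

variable {D ρV}
variable (W : GrMod D ρV)

/-- The operator of Clifford multiplication by `v ∈ V`. -/
def Γ (v : V) : Module.End ℝ W.W.carrier := W.W.ρ (algVec D ρV v)

/-- The underlying `A`-module. -/
abbrev baseMod : FDMod D.Alg := W.W.res (algIncl D ρV)

/-- The grading operator `M₀`, equal to `1` on `W₀` and to `-1` on `W₁`; it is the action of
`ẽ₁ ⊗̂ 1` on `W` regarded as an ungraded module over `Cl^{0,1} ⊗̂ Aⱽ`. -/
def M₀ : Module.End ℝ W.W.carrier :=
  (W.gr 1).projection (W.gr (-1)) W.compl - (W.gr (-1)).projection (W.gr 1) W.compl.symm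

theorem M₀_apply {i : ℤˣ} {w : W.W.carrier} (hw : w ∈ W.gr i) : W.M₀ w = sgn i • w := by
  rcases Int.units_eq_one_or i with rfl | rfl
  · simp [M₀, Submodule.projection_apply_of_mem_left W.compl hw,
      Submodule.projection_apply_of_mem_right W.compl.symm hw, sgn]
  · simp [M₀, Submodule.projection_apply_of_mem_left W.compl.symm hw,
      Submodule.projection_apply_of_mem_right W.compl hw, sgn]

theorem hom_ext {f f' : Module.End ℝ W.W.carrier} (hff : ∀ i, ∀ w ∈ W.gr i, f w = f' w) :
    f = f' := by
  apply LinearMap.ext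
  intro w
  have hw : w ∈ W.gr 1 ⊔ W.gr (-1) := by rw [W.compl.sup_eq_top]; trivial
  obtain ⟨a, ha, b, hb, rfl⟩ := Submodule.mem_sup.1 hw
  rw [map_add, map_add, hff _ a ha, hff _ b hb]

theorem M₀_sq : W.M₀ * W.M₀ = 1 := by
  apply W.hom_ext
  intro i w hw
  rw [Module.End.mul_apply, W.M₀_apply hw, map_smul, W.M₀_apply hw, smul_smul, sgn_mul_self,
    one_smul, Module.End.one_apply]

theorem M₀_mul {j : ZMod 2} {a : AlgV D ρV} (ha : a ∈ degPart D ρV j) :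
    W.M₀ * W.W.ρ a = sgn ((-1 : ℤˣ) ^ j) • (W.W.ρ a * W.M₀) := by
  apply W.hom_ext
  intro i w hw
  rw [Module.End.mul_apply, W.M₀_apply (W.map_mem j a ha i w hw), LinearMap.smul_apply,
    Module.End.mul_apply, W.M₀_apply hw, map_smul, smul_smul, sgn_mul]

theorem algVec_mem (v : V) : algVec D ρV v ∈ degPart D ρV 1 := by
  rw [mem_degPart]; simp [sgn]

theorem I_mem : algIncl D ρV D.I ∈ degPart D ρV 0 := by
  rw [mem_degPart]; simp [sgn]

theorem exists_deg (u : ℤˣ) : ∃ j : ZMod 2, (-1 : ℤˣ) ^ j = u := by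
  rcases Int.units_eq_one_or u with rfl | rfl
  · exact ⟨0, by simp⟩
  · exact ⟨1, by simp⟩

theorem elt_mem (g : G) {j : ZMod 2} (hj : (-1 : ℤˣ) ^ j = D.h g) :
    algIncl D ρV (D.elt g) ∈ degPart D ρV j := by
  rw [mem_degPart, hj]; simp

theorem Γ_mem {i : ℤˣ} {w : W.W.carrier} (v : V) (hw : w ∈ W.gr i) : W.Γ v w ∈ W.gr (-i) := by
  have := W.map_mem 1 _ (algVec_mem v) i w hw
  rw [uzpow_one, neg_one_mul] at this
  exact this

theorem I_apply_mem {i : ℤˣ} {w : W.W.carrier} (hw : w ∈ W.gr i) :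
    W.baseMod.ρ D.I w ∈ W.gr i := by
  have := W.map_mem 0 _ (I_mem (ρV := ρV)) i w hw
  rw [uzpow_zero, one_mul] at this
  exact this

theorem elt_apply_mem (g : G) {i : ℤˣ} {w : W.W.carrier} (hw : w ∈ W.gr i) :
    W.baseMod.ρ (D.elt g) w ∈ W.gr (D.h g * i) := by
  obtain ⟨j, hj⟩ := exists_deg (D.h g)
  rw [← hj]
  exact W.map_mem j _ (elt_mem g hj) i w hw

theorem M₀_mul_Γ (v : V) : W.M₀ * W.Γ v = - (W.Γ v * W.M₀) := by
  have := W.M₀_mul (algVec_mem (D := D) (ρV := ρV) v)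
  simpa [Γ, sgn] using this

theorem M₀_mul_I : W.M₀ * W.baseMod.ρ D.I = W.baseMod.ρ D.I * W.M₀ := by
  have := W.M₀_mul (I_mem (D := D) (ρV := ρV))
  rw [uzpow_zero] at this
  simpa [sgn] using this

theorem M₀_mul_elt (g : G) :
    W.M₀ * W.baseMod.ρ (D.elt g) = sgn (D.h g) • (W.baseMod.ρ (D.elt g) * W.M₀) := by
  obtain ⟨j, hj⟩ := exists_deg (D.h g)
  rw [← hj]
  exact W.M₀_mul (elt_mem g hj)

theorem Γ_sq (v : V) : W.Γ v * W.Γ v = ‖v‖ ^ 2 • 1 := by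
  rw [Γ, ← map_mul, algVec_sq, AlgHom.commutes, Algebra.algebraMap_eq_smul_one]

theorem Γ_mul_I (v : V) : W.Γ v * W.baseMod.ρ D.I = W.baseMod.ρ D.I * W.Γ v := by
  have := congrArg W.W.ρ (I_algVec D ρV v)
  rw [map_mul, map_mul] at this
  exact this.symm

theorem Γ_mul_elt (g : G) (v : V) :
    W.Γ (ρV g v) * W.baseMod.ρ (D.elt g) = sgn (D.h g) • (W.baseMod.ρ (D.elt g) * W.Γ v) := by
  have := congrArg W.W.ρ (elt_algVec D ρV g v)
  rw [map_smul, map_mul, map_mul] at this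
  exact this.symm

/-- Clifford multiplication as a linear map. -/
def Γₗ : V →ₗ[ℝ] Module.End ℝ W.W.carrier where
  toFun := W.Γ
  map_add' v w := by simp [Γ, algVec_add]
  map_smul' c v := by simp [Γ, algVec_smul]

theorem dirac_neg (k : RepSphere ρV) :
    dirac (-W.M₀) W.M₀ W.Γ k = k.1.1 • W.M₀ + W.Γ k.1.2 := by
  unfold dirac
  split_ifs <;> simp

/-- The bundle `F` obtained by solving the Dirac Hamiltonian of `W` with `M = -M₀`: `F₀` and `F₁`
are the subbundles of `S^V × W` on which the Hamiltonian is `1` and `-1`. -/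
def solved [FiniteDimensional ℝ V] : VectObj D (RepSphere ρV) where
  U := W.baseMod
  ε k := dirac (-W.M₀) W.M₀ W.Γ k
  cont := by
    have : Continuous fun k : ℝ × V => k.1 • W.M₀ + W.Γₗ k.2 := by
      have : IsTopologicalAddGroup (Module.End ℝ W.W.carrier) :=
        IsModuleTopology.topologicalAddGroup ℝ _
      have : ContinuousSMul ℝ (Module.End ℝ W.W.carrier) :=
        IsModuleTopology.toContinuousSMul ℝ _
      have h2 : Continuous W.Γₗ := LinearMap.continuous_of_finiteDimensional _
      exact (continuous_fst.smul continuous_const).add (h2.comp continuous_snd)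
    have h3 := this.comp (continuous_subtype_val :
      Continuous fun k : {k : ℝ × V // k.1 ^ 2 + ‖k.2‖ ^ 2 = 1} => k.1)
    convert! h3 using 1
    funext k
    exact W.dirac_neg k
  sq k := by
    rw [dirac_neg, add_mul, mul_add, mul_add, W.Γ_sq, smul_mul_smul_comm, W.M₀_sq,
      smul_mul_assoc, W.M₀_mul_Γ, mul_smul_comm, smul_neg]
    have := k.2
    rw [← pow_two, add_assoc, neg_add_cancel_left, ← add_smul, this, one_smul]
  comm_I k := by
    rw [dirac_neg, add_mul, mul_add, smul_mul_assoc, W.M₀_mul_I, W.Γ_mul_I, mul_smul_comm]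
  equivariant g k := by
    rw [dirac_neg, dirac_neg, smul_fst, smul_snd, add_mul, mul_add, smul_mul_assoc,
      W.M₀_mul_elt, W.Γ_mul_elt, mul_smul_comm, smul_add, smul_comm]

/-- The fibre at `k` of the clutching of `S^V_+ × Wᵢ` and `S^V_- × Wᵢ₊₁` along the boundary
`k₀ = 0` with the transition function `v ↦ (-1)^i ρ_W(v)`.  A point of the fibre is described by
its coordinates `(a, b)` in the two pieces, where the coordinate in a piece which does not contain
`k` is set to `0`. -/
def clutchFib (i : ℤˣ) (k : RepSphere ρV) : Submodule ℝ (W.W.carrier × W.W.carrier) where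
  carrier := {p | p.1 ∈ W.gr i ∧ p.2 ∈ W.gr (-i) ∧ (k.1.1 < 0 → p.1 = 0) ∧
    (0 < k.1.1 → p.2 = 0) ∧ (k.1.1 = 0 → p.2 = sgn i • W.Γ k.1.2 p.1)}
  zero_mem' := by simp
  add_mem' := by
    rintro ⟨a, b⟩ ⟨a', b'⟩ ⟨h1, h2, h3, h4, h5⟩ ⟨h1', h2', h3', h4', h5'⟩
    refine ⟨add_mem h1 h1', add_mem h2 h2', fun h => ?_, fun h => ?_, fun h => ?_⟩
    · simpa using congrArg₂ (· + ·) (h3 h) (h3' h)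
    · simpa using congrArg₂ (· + ·) (h4 h) (h4' h)
    · simpa using congrArg₂ (· + ·) (h5 h) (h5' h)
  smul_mem' := by
    rintro c ⟨a, b⟩ ⟨h1, h2, h3, h4, h5⟩
    refine ⟨Submodule.smul_mem _ c h1, Submodule.smul_mem _ c h2, fun h => ?_, fun h => ?_,
      fun h => ?_⟩
    · simpa using congrArg (c • ·) (h3 h)
    · simpa using congrArg (c • ·) (h4 h)
    · simpa [smul_comm c] using congrArg (c • ·) (h5 h)

/-- The inclusion of the fibre `{k} × Wᵢ`, `k₀ ≥ 0`, of the northern piece. -/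
def north (i : ℤˣ) (k : RepSphere ρV) (hk : 0 ≤ k.1.1) (w : W.gr i) : W.clutchFib i k :=
  ⟨(w, if k.1.1 = 0 then sgn i • W.Γ k.1.2 w else 0), w.2, by
      split_ifs
      · exact Submodule.smul_mem _ _ (W.Γ_mem _ w.2)
      · exact zero_mem _,
    fun h => absurd h (not_lt.2 hk), fun h => if_neg h.ne', fun h => if_pos h⟩

/-- The inclusion of the fibre `{k} × Wᵢ₊₁`, `k₀ ≤ 0`, of the southern piece. -/
def south (i : ℤˣ) (k : RepSphere ρV) (hk : k.1.1 ≤ 0) (w : W.gr (-i)) : W.clutchFib i k :=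
  ⟨(if k.1.1 = 0 then sgn i • W.Γ k.1.2 w else 0, w), by
      split_ifs
      · simpa using Submodule.smul_mem _ (sgn i) (W.Γ_mem k.1.2 w.2)
      · exact zero_mem _,
    w.2, fun h => if_neg h.ne, fun h => absurd h (not_lt.2 hk), fun h => by
      have hn : ‖k.1.2‖ ^ 2 = 1 := by have := k.2; rw [h] at this; simpa using this
      have hs := LinearMap.congr_fun (W.Γ_sq k.1.2) (w : W.W.carrier)
      simp only [if_pos h, map_smul, smul_smul, sgn_mul_self, one_smul]
      rw [hn, one_smul] at hs
      exact hs.symm⟩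

/-- The total space of the clutching in degree `i` carries the quotient topology of the disjoint
union of `S^V_+ × Wᵢ` and `S^V_- × Wᵢ₊₁`. -/
@[reducible] def clutchTop (i : ℤˣ) : TopologicalSpace (Σ k, W.clutchFib i k) :=
  TopologicalSpace.coinduced
    (fun p : {k : RepSphere ρV // 0 ≤ k.1.1} × W.gr i =>
      (⟨p.1.1, W.north i p.1.1 p.1.2 p.2⟩ : Σ k, W.clutchFib i k)) inferInstance ⊔
  TopologicalSpace.coinduced
    (fun p : {k : RepSphere ρV // k.1.1 ≤ 0} × W.gr (-i) =>
      (⟨p.1.1, W.south i p.1.1 p.1.2 p.2⟩ : Σ k, W.clutchFib i k)) inferInstance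

theorem clutch_cover (i : ℤˣ) (k : RepSphere ρV) (e : W.clutchFib i k) :
    (∃ (hk : 0 ≤ k.1.1) (w : W.gr i), W.north i k hk w = e) ∨
      ∃ (hk : k.1.1 ≤ 0) (w : W.gr (-i)), W.south i k hk w = e := by
  obtain ⟨⟨a, b⟩, h1, h2, h3, h4, h5⟩ := e
  rcases le_or_gt 0 k.1.1 with hk | hk
  · refine Or.inl ⟨hk, ⟨a, h1⟩, ?_⟩
    apply Subtype.ext
    refine Prod.ext rfl ?_
    rcases hk.eq_or_lt with h | h
    · simp only [north, if_pos h.symm]; exact (h5 h.symm).symm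
    · simp only [north, if_neg h.ne']; exact (h4 h).symm
  · refine Or.inr ⟨hk.le, ⟨b, h2⟩, ?_⟩
    apply Subtype.ext
    refine Prod.ext ?_ rfl
    simp only [south, if_neg hk.ne]; exact (h3 hk).symm

theorem north_injective (i : ℤˣ) (k : RepSphere ρV) (hk : 0 ≤ k.1.1) :
    Function.Injective (W.north i k hk) := fun _ _ h =>
  Subtype.ext (congrArg (fun e => e.1.1) h)

theorem south_injective (i : ℤˣ) (k : RepSphere ρV) (hk : k.1.1 ≤ 0) :
    Function.Injective (W.south i k hk) := fun _ _ h =>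
  Subtype.ext (congrArg (fun e => e.1.2) h)

/-- Points of the two pieces are identified exactly over the boundary, by the transition
function. -/
theorem north_eq_south_iff (i : ℤˣ) (k : RepSphere ρV) (hk : 0 ≤ k.1.1) (hk' : k.1.1 ≤ 0)
    (w : W.gr i) (w' : W.gr (-i)) :
    W.north i k hk w = W.south i k hk' w' ↔
      (w' : W.W.carrier) = sgn i • W.Γ k.1.2 (w : W.W.carrier) := by
  have h0 : k.1.1 = 0 := le_antisymm hk' hk
  constructor
  · intro h
    have := congrArg (fun e => e.1.2) h
    simpa [north, south, h0] using this.symm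
  · intro h
    have : W.south i k hk' w' = W.north i k hk w := by
      have h5 := (W.south i k hk' w').2.2.2.2.2 h0
      have hn : ‖k.1.2‖ ^ 2 = 1 := by have := k.2; rw [h0] at this; simpa using this
      have hs := LinearMap.congr_fun (W.Γ_sq k.1.2) (w : W.W.carrier)
      rw [hn, one_smul] at hs
      apply Subtype.ext
      refine Prod.ext ?_ ?_
      · simp only [north, south, if_pos h0, h, map_smul, smul_smul, sgn_mul_self, one_smul]
        exact hs
      · simp only [north, south, if_pos h0, h]
    exact this.symm

theorem I_mem_clutch {i : ℤˣ} {k : RepSphere ρV} {p : W.W.carrier × W.W.carrier}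
    (hp : p ∈ W.clutchFib i k) :
    (W.baseMod.ρ D.I).prodMap (W.baseMod.ρ D.I) p ∈ W.clutchFib i k := by
  obtain ⟨h1, h2, h3, h4, h5⟩ := hp
  refine ⟨W.I_apply_mem h1, W.I_apply_mem h2, fun h => ?_, fun h => ?_, fun h => ?_⟩
  · change W.baseMod.ρ D.I p.1 = 0
    rw [h3 h]; exact map_zero _
  · change W.baseMod.ρ D.I p.2 = 0
    rw [h4 h]; exact map_zero _
  · change W.baseMod.ρ D.I p.2 = sgn i • W.Γ k.1.2 (W.baseMod.ρ D.I p.1)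
    rw [h5 h]
    have := LinearMap.congr_fun (W.Γ_mul_I k.1.2) p.1
    exact (map_smul (W.baseMod.ρ D.I) _ _).trans (congrArg (sgn i • ·) this.symm)

theorem elt_mem_clutch (g : G) {i : ℤˣ} {k : RepSphere ρV} {p : W.W.carrier × W.W.carrier}
    (hp : p ∈ W.clutchFib i k) :
    (W.baseMod.ρ (D.elt g)).prodMap (W.baseMod.ρ (D.elt g)) p ∈
      W.clutchFib (D.h g * i) (g • k) := by
  obtain ⟨h1, h2, h3, h4, h5⟩ := hp
  refine ⟨W.elt_apply_mem g h1, ?_, fun h => ?_, fun h => ?_, fun h => ?_⟩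
  · rw [← mul_neg]; exact W.elt_apply_mem g h2
  · change W.baseMod.ρ (D.elt g) p.1 = 0
    rw [h3 h]; exact map_zero _
  · change W.baseMod.ρ (D.elt g) p.2 = 0
    rw [h4 h]; exact map_zero _
  · change W.baseMod.ρ (D.elt g) p.2 =
      sgn (D.h g * i) • W.Γ (ρV g k.1.2) (W.baseMod.ρ (D.elt g) p.1)
    rw [h5 h]
    have := LinearMap.congr_fun (W.Γ_mul_elt g k.1.2) p.1
    refine (map_smul (W.baseMod.ρ (D.elt g)) _ _).trans ?_
    refine Eq.trans ?_ (congrArg (sgn (D.h g * i) • ·) this.symm)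
    rw [LinearMap.smul_apply, smul_smul, sgn_mul, mul_right_comm, sgn_mul_self, one_mul]
    rfl

/-- The clutched bundle `E = E₀ ⊕ E₁` of the ABS construction; `A` acts on both pieces through its
action on `W`. -/
def abs : GrFamily D (RepSphere ρV) where
  Fib i k := W.clutchFib i k
  top := W.clutchTop
  J _ _ := ((W.baseMod.ρ D.I).prodMap (W.baseMod.ρ D.I)).restrict fun _ hp => W.I_mem_clutch hp
  act g _ _ := ((W.baseMod.ρ (D.elt g)).prodMap (W.baseMod.ρ (D.elt g))).restrict
    fun _ hp => W.elt_mem_clutch g hp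
  J_J _ _ e := Subtype.ext (Prod.ext (rep_I_I D W.baseMod.ρ e.1.1) (rep_I_I D W.baseMod.ρ e.1.2))
  act_J g _ _ e := Subtype.ext (Prod.ext (rep_elt_I D W.baseMod.ρ g e.1.1)
    (rep_elt_I D W.baseMod.ρ g e.1.2))
  act_one i x e := sigma_sub_ext (S := fun p : ℤˣ × RepSphere ρV => W.clutchFib p.1 p.2)
    (by simp) _ _ (Prod.ext (rep_one D W.baseMod.ρ e.1.1) (rep_one D W.baseMod.ρ e.1.2))
  act_mul g g' i x e := sigma_sub_ext (S := fun p : ℤˣ × RepSphere ρV => W.clutchFib p.1 p.2)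
    (by simp [mul_assoc, mul_smul]) _ _
    (Prod.ext (rep_mul D W.baseMod.ρ g g' e.1.1) (rep_mul D W.baseMod.ρ g g' e.1.2))

end GrMod

end Sphere

section Classification

variable {G : Type*} [Group G] (D : SymData G)
variable {V : Type*} [NormedAddCommGroup V] [InnerProductSpace ℝ V] (ρV : G →* (V ≃ₗᵢ[ℝ] V))

theorem massElt_mul_massElt : massElt D ρV * massElt D ρV = 1 := by
  have h : clGen 1 0 * clGen 1 0 = 1 := by
    rw [clGen, CliffordAlgebra.ι_sq_scalar]
    simp [QuadraticMap.weightedSumSquares_apply]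
  rw [massElt, ← map_mul, h, map_one]

theorem massElt_mul {j : ZMod 2} {a : AlgV D ρV} (ha : a ∈ degPart D ρV j) :
    massElt D ρV * fromAlgV D ρV 1 a =
      sgn ((-1 : ℤˣ) ^ j) • (fromAlgV D ρV 1 a * massElt D ρV) := by
  have hc : clGen 1 0 ∈ CliffordAlgebra.evenOdd (posForm 1) 1 :=
    CliffordAlgebra.ι_mem_evenOdd_one _ _
  rw [massElt, fromCl_mul_fromAlgV D ρV 1 hc ha, mul_one]
  rcases zmod2_cases j with rfl | rfl <;> simp [sgn]

variable {D ρV}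

/-- The operator `M₀` by which `ẽ₁ ⊗̂ 1` acts on an ungraded module over `Cl^{0,1} ⊗̂ Aⱽ`. -/
def massOp (W : FDMod (DirAlg D ρV 1)) : Module.End ℝ W.carrier := W.ρ (massElt D ρV)

/-- An ungraded module over `Cl^{0,1} ⊗̂ Aⱽ`, regarded as a `ℤ₂`-graded `Aⱽ`-module: `W₀` and `W₁`
are the subspaces on which `ẽ₁ ⊗̂ 1` is `1` and `-1`. -/
def toGraded (W : FDMod (DirAlg D ρV 1)) : GrMod D ρV where
  W := W.res (fromAlgV D ρV 1)
  gr i := LinearMap.ker (massOp W - sgn i • LinearMap.id)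
  compl := by
    have hsq : ∀ w : W.carrier, massOp W (massOp W w) = w := by
      intro w
      rw [massOp, ← Module.End.mul_apply, ← map_mul, massElt_mul_massElt, map_one]; rfl
    constructor
    · rw [Submodule.disjoint_def]
      intro w h1 h2
      simp only [LinearMap.mem_ker, LinearMap.sub_apply, LinearMap.smul_apply, LinearMap.id_apply,
        sub_eq_zero] at h1 h2
      have h3 := h1.symm.trans h2
      simp only [sgn, Units.val_one, Units.val_neg, Int.cast_neg, Int.cast_one, one_smul,
        neg_smul] at h3
      have h4 : (2 : ℝ) • w = 0 := by rw [two_smul]; exact add_eq_zero_iff_eq_neg.2 h3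
      exact (smul_eq_zero.1 h4).resolve_left two_ne_zero
    · rw [codisjoint_iff, eq_top_iff]
      intro w _
      have hw : w = (1 / 2 : ℝ) • (w + massOp W w) + (1 / 2 : ℝ) • (w - massOp W w) := by module
      rw [hw]
      refine Submodule.add_mem_sup ?_ ?_
      · simp [sgn, hsq, add_comm]
      · simp [sgn, hsq]
  map_mem j a ha i w hw := by
    simp only [LinearMap.mem_ker, LinearMap.sub_apply, LinearMap.smul_apply, LinearMap.id_apply,
      sub_eq_zero] at hw ⊢
    have h := LinearMap.congr_fun (congrArg W.ρ (massElt_mul D ρV ha)) w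
    rw [map_mul, map_smul, map_mul] at h
    refine h.trans ?_
    rw [LinearMap.smul_apply, Module.End.mul_apply]
    change _ • W.ρ (fromAlgV D ρV 1 a) (massOp W w) = _
    rw [hw, map_smul, smul_smul, sgn_mul]
    rfl

/-- An (infinite-dimensional) universe `𝓤` of modules over an algebra `B`: the union of an
increasing sequence of finite-dimensional submodules, the `n`-th of which is the range of the
projection `P n`, in which every irreducible `B`-module occurs infinitely often.  The projections
are compatible: `𝓤` is the direct sum of the ranges of `P 0` and of all `P (n + 1) - P n`. -/
structure ModUniverse (B : Type*) [Ring B] [Algebra ℝ B] where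
  carrier : Type
  [acg : AddCommGroup carrier]
  [mod : Module ℝ carrier]
  ρ : B →ₐ[ℝ] Module.End ℝ carrier
  P : ℕ → Module.End ℝ carrier
  P_comm : ∀ n b, P n * ρ b = ρ b * P n
  P_mul : ∀ m n, P m * P n = P (min m n)
  P_fin : ∀ n, FiniteDimensional ℝ (LinearMap.range (P n))
  exhaust : ∀ u, ∃ n, P n u = u
  rich : ∀ (n : ℕ) (S : FDMod B), S.Irred → ∃ j : S.carrier →ₗ[ℝ] carrier,
    Function.Injective j ∧ (∀ b w, j (S.ρ b w) = ρ b (j w)) ∧ ∀ w, P n (j w) = 0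

attribute [instance] ModUniverse.acg ModUniverse.mod

section ClassifyingSpace

variable {U : Type} [AddCommGroup U] [Module ℝ U] (P : ℕ → Module.End ℝ U)

/-- The operators on `U` which come from the `n`-th stage, the range of `P n`, extended by zero. -/
def stage (n : ℕ) : Submodule ℝ (Module.End ℝ U) where
  carrier := {T | T * P n = T ∧ P n * T = T}
  zero_mem' := by simp
  add_mem' := by
    rintro a b ⟨h1, h2⟩ ⟨h3, h4⟩
    exact ⟨by rw [add_mul, h1, h3], by rw [mul_add, h2, h4]⟩
  smul_mem' := by
    rintro c a ⟨h1, h2⟩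
    exact ⟨by rw [smul_mul_assoc, h1], by rw [mul_smul_comm, h2]⟩

/-- The canonical topology of the finite-dimensional space of operators of the `n`-th stage. -/
instance (n : ℕ) : TopologicalSpace (stage P n) := moduleTopology ℝ (stage P n)

/-- The space of the operators on `U` which have the property `p` and differ from the base point
`H₀` only on a finite-dimensional stage. -/
def ClsSpace (H₀ : Module.End ℝ U) (p : Module.End ℝ U → Prop) : Type :=
  {H : Module.End ℝ U // (∃ n, H - H₀ ∈ stage P n) ∧ p H}

/-- The inclusion of the `n`-th stage into the classifying space. -/
def ClsSpace.incl (H₀ : Module.End ℝ U) (p : Module.End ℝ U → Prop) (n : ℕ)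
    (T : {T : stage P n // p (H₀ + T)}) : ClsSpace P H₀ p :=
  ⟨H₀ + T.1, ⟨n, by rw [add_sub_cancel_left]; exact T.1.2⟩, T.2⟩

/-- The topology of the direct limit of the finite-dimensional stages. -/
instance (H₀ : Module.End ℝ U) (p : Module.End ℝ U → Prop) :
    TopologicalSpace (ClsSpace P H₀ p) :=
  ⨆ n, TopologicalSpace.coinduced (ClsSpace.incl P H₀ p n) inferInstance

end ClassifyingSpace

variable (𝒰 : ModUniverse (DirAlg D ρV 1))

namespace ModUniverse

/-- The base point `M₀`, by which `ẽ₁ ⊗̂ 1` acts on the universe. -/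
def M₀ : Module.End ℝ 𝒰.carrier := 𝒰.ρ (massElt D ρV)

/-- The operator `∑ vᵢ Γ̃ᵢ` of Clifford multiplication by `v ∈ V` on the universe. -/
def Γ (v : V) : Module.End ℝ 𝒰.carrier := 𝒰.ρ (fromAlgV D ρV 1 (algVec D ρV v))

/-- The operator by which `a ∈ A` acts on the universe. -/
def ρA (a : D.Alg) : Module.End ℝ 𝒰.carrier := 𝒰.ρ (fromAlgV D ρV 1 (algIncl D ρV a))

/-- The symmetric mass terms: `M² = 1`, and `M` may take the place of `ẽ₁ ⊗̂ 1` in the action of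
`Cl^{0,1} ⊗̂ Aⱽ`; in particular `(-1)^{h(g)} g M g⁻¹ = M`. -/
def IsMass (M : Module.End ℝ 𝒰.carrier) : Prop :=
  M * M = 1 ∧ ∀ (j : ZMod 2) (a : AlgV D ρV), a ∈ degPart D ρV j →
    M * 𝒰.ρ (fromAlgV D ρV 1 a) = sgn ((-1 : ℤˣ) ^ j) • (𝒰.ρ (fromAlgV D ρV 1 a) * M)

/-- The classifying space for symmetric Dirac Hamiltonians, with base point `M₀`. -/
abbrev MassSpace : Type := ClsSpace 𝒰.P 𝒰.M₀ 𝒰.IsMass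

/-- The (not necessarily symmetric) gapped Hamiltonians: complex linear `H` with `H² = 1`. -/
def IsHam (H : Module.End ℝ 𝒰.carrier) : Prop :=
  H * H = 1 ∧ H * 𝒰.ρA D.I = 𝒰.ρA D.I * H

/-- The base point `H₀ = -M₀` of the space of Hamiltonians, the value of every Dirac Hamiltonian at
the base point `k₀ = -1` of `S^V`. -/
def H₀ : Module.End ℝ 𝒰.carrier := -𝒰.M₀

/-- The classifying space for Hamiltonians, with base point `H₀`. -/
abbrev HamSpace : Type := ClsSpace 𝒰.P 𝒰.H₀ 𝒰.IsHam

/-- The space of symmetric Hamiltonians on `S^V`: base-point preserving continuous maps `H` from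
`S^V` to the classifying space with `(-1)^{h(g)} g H(k) g⁻¹ = H(g k)`, with the compact-open
topology. -/
abbrev HamLoops : Type _ :=
  {H : C(RepSphere ρV, 𝒰.HamSpace) // (H (infty ρV)).1 = 𝒰.H₀ ∧
    ∀ g k, (H (g • k)).1 * 𝒰.ρA (D.elt g) = sgn (D.h g) • (𝒰.ρA (D.elt g) * (H k).1)}

/-- `M` is `-M₀` on the image of an embedding of `W` into the universe, and `M₀` on an invariant
complement of it. -/
def SignChange (W : FDMod (DirAlg D ρV 1)) (M : Module.End ℝ 𝒰.carrier) : Prop :=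
  ∃ (j : W.carrier →ₗ[ℝ] 𝒰.carrier) (C : Submodule ℝ 𝒰.carrier),
    Function.Injective j ∧ (∀ b w, j (W.ρ b w) = 𝒰.ρ b (j w)) ∧
    IsCompl (LinearMap.range j) C ∧ (∀ b, ∀ c ∈ C, 𝒰.ρ b c ∈ C) ∧
    (∀ w, M (j w) = -𝒰.M₀ (j w)) ∧ ∀ c ∈ C, M c = 𝒰.M₀ c

/-- `L` is the map "changing the sign of the mass term": for every module `W` it sends `[W]` to the
component of the mass terms which are `-M₀` on a copy of `W` in the universe and `M₀` on a
complement. -/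
def IsSignMap (L : AlgClass D ρV → ZerothHomotopy 𝒰.MassSpace) : Prop :=
  ∀ W : FDMod (DirAlg D ρV 1), (∃ M : 𝒰.MassSpace, 𝒰.SignChange W M.1) ∧
    ∀ M : 𝒰.MassSpace, 𝒰.SignChange W M.1 → L (AlgClass.mk D ρV W) = .mk M

/-- `F` is the map from mass terms to Hamiltonians given by the Dirac Hamiltonian: for a mass term
`M` which differs from `M₀` only on the `n`-th stage, it takes the Dirac Hamiltonian of `M` on the
`n`-th stage and `H₀` on the complement. -/
def IsDiracMap (F : ZerothHomotopy 𝒰.MassSpace → ZerothHomotopy 𝒰.HamLoops) : Prop :=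
  ∀ (M : 𝒰.MassSpace) (n : ℕ), M.1 - 𝒰.M₀ ∈ stage 𝒰.P n → ∃ H : 𝒰.HamLoops,
    (∀ k, (H.1 k).1 = dirac M.1 𝒰.M₀ 𝒰.Γ k * 𝒰.P n + 𝒰.H₀ * (1 - 𝒰.P n)) ∧
      F (.mk M) = .mk H

/-- `T` is the object of `Vect_A(S^V)` obtained by solving the Hamiltonian `H`, which differs from
`H₀` only on the `n`-th stage: the product of `S^V` and the `n`-th stage, with `E₀` and `E₁` the
subbundles on which `H` is `1` and `-1`. -/
def IsSolution (H : 𝒰.HamLoops) (n : ℕ) (T : VectObj D (RepSphere ρV)) : Prop :=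
  (∀ k, (H.1 k).1 - 𝒰.H₀ ∈ stage 𝒰.P n) ∧
    ∃ j : T.U.carrier →ₗ[ℝ] 𝒰.carrier, Function.Injective j ∧
      LinearMap.range j = LinearMap.range (𝒰.P n) ∧
      (∀ a u, j (T.U.ρ a u) = 𝒰.ρA a (j u)) ∧ ∀ k u, j (T.ε k u) = (H.1 k).1 (j u)

/-- `S` is the map "solving the Hamiltonian". -/
def IsSolveMap (S : ZerothHomotopy 𝒰.HamLoops → KTilde D (RepSphere ρV)) : Prop :=
  ∀ H : 𝒰.HamLoops, (∃ n T, 𝒰.IsSolution H n T) ∧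
    ∀ n T, 𝒰.IsSolution H n T → S (.mk H) = KTilde.mk T

end ModUniverse

variable (D ρV) in
/-- `Φ` is the map given by the ABS construction: it sends `[W]` to the class of any object of
`Vect_A(S^V)` isomorphic to the clutched bundle of `W`. -/
def IsABSMap (Φ : AlgClass D ρV → KTilde D (RepSphere ρV)) : Prop :=
  ∀ W : FDMod (DirAlg D ρV 1),
    (∃ T : VectObj D (RepSphere ρV), Nonempty (T.toFamily.Iso (toGraded W).abs)) ∧
    ∀ T : VectObj D (RepSphere ρV), Nonempty (T.toFamily.Iso (toGraded W).abs) →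
      Φ (AlgClass.mk D ρV W) = KTilde.mk T

end Classification

end

end FreeFermion

open FreeFermion

/-! Part 1. With `M = -M₀` the Dirac Hamiltonian is `H = k₀ M₀ + Γ v` on the whole sphere, and `Γ v`
anticommutes with `M₀`, so `M₀ H + H M₀ = 2 k₀` is a scalar (`M₀_dirac`). For two involutions with
scalar anticommutator the eigenprojections compose to scalars: on the eigenspace `H = εᵢ` the
operator `(1 + εᵢ H)(1 ± εᵢ M₀)` is multiplication by `2 (1 ± k₀)`. Hence `1 + εᵢ M₀` identifies
`Fᵢ` with the constant bundle `Wᵢ` away from `k₀ = -1`, and `1 - εᵢ M₀` identifies it with `Wᵢ₊₁`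
away from `k₀ = 1` (`polar`). This trivializes `F`. Over the equator `H = Γ v`, so the change of
trivialization is `εᵢ Γ v`, the clutching function. The two trivializations therefore glue to `Ψ`
(`clutchIso`), and `E` is a bundle because `F` is.

Part 2, well-definedness. Adding opposite modules gives restrictions of `Cl^{0,2}`-modules
(`double_iso`), so every class in the cokernel comes from a module and equality of classes is stable
isomorphism (`AlgClass.stabIso_of_mk_eq`). For `L`, Maschke's theorem (`exists_retraction`) embeds
every module as a summand of the universe beyond any given stage, and rotations `cos θ • T + sin θ •
T'` in a plane of anticommuting mass operators connect the choices: the swap of two copies of `W`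
gives independence of the embedding, the second Clifford generator shows that restricted modules
contribute nothing. For the Dirac map, a path of mass terms is compact and lies in one stage
(`exists_stage_of_compact`), and the stage can be enlarged because the Dirac Hamiltonian of `M₀`
with itself contracts to the constant `H₀` through `shrunk`. For solving, nearby gradings `ε`, `ε'`
are intertwined by the invertible operator `1 + ε ε'` (`mk_slice`), and enlarging the stage adds a
trivial object. For the ABS map, Part 1 replaces the clutched bundle by the solved one, and a
grading which anticommutes with a constant grading is isomorphic to it (`mk_sum_of_anticommutator`).

Commutativity. Change the sign of the mass on a copy of `W` in a stage. On `W` the Dirac Hamiltonian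
is `k₀ M₀ + Γ v`, whose solution is the clutched bundle of `W` by Part 1. On the complement it is
`-|k₀| M₀ + Γ v`, whose anticommutator with `H₀ = -M₀` is `2 |k₀| ≥ 0`; the same lemma makes this
summand trivial. So the solution has the class of the clutched bundle (`IsSolution.of_signPoint`).
-/

namespace FreeFermion

/-! ### Continuity of linear algebra on finite-dimensional modules. -/

section Topology

instance FDMod.continuousAdd {B : Type*} [Ring B] [Algebra ℝ B] (W : FDMod B) :
    ContinuousAdd W.carrier := IsModuleTopology.toContinuousAdd ℝ _

instance FDMod.topologicalAddGroup {B : Type*} [Ring B] [Algebra ℝ B] (W : FDMod B) :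
    IsTopologicalAddGroup W.carrier := IsModuleTopology.topologicalAddGroup ℝ _

instance FDMod.topologicalAddGroup_end {B : Type*} [Ring B] [Algebra ℝ B] (W : FDMod B) :
    IsTopologicalAddGroup (Module.End ℝ W.carrier) := IsModuleTopology.topologicalAddGroup ℝ _

theorem FDMod.continuous_linearMap {B : Type*} [Ring B] [Algebra ℝ B] (W : FDMod B) {E : Type*}
    [AddCommGroup E] [Module ℝ E] [TopologicalSpace E] [ContinuousAdd E] [ContinuousSMul ℝ E]
    (f : W.carrier →ₗ[ℝ] E) : Continuous f := IsModuleTopology.continuous_of_linearMap f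

/-- Evaluation of endomorphisms is jointly continuous. -/
theorem FDMod.continuous_eval {B : Type*} [Ring B] [Algebra ℝ B] (W : FDMod B) :
    Continuous fun p : Module.End ℝ W.carrier × W.carrier => p.1 p.2 :=
  IsModuleTopology.continuous_bilinear_of_finite_left
    (LinearMap.id : Module.End ℝ W.carrier →ₗ[ℝ] W.carrier →ₗ[ℝ] W.carrier)

theorem FDMod.continuous_apply {B : Type*} [Ring B] [Algebra ℝ B] (W : FDMod B) {X : Type*}
    [TopologicalSpace X] {f : X → Module.End ℝ W.carrier} {u : X → W.carrier}
    (hf : Continuous f) (hu : Continuous u) : Continuous fun x => f x (u x) :=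
  W.continuous_eval.comp (hf.prodMk hu)

theorem FDMod.continuous_mul {B : Type*} [Ring B] [Algebra ℝ B] (W : FDMod B) :
    Continuous fun p : Module.End ℝ W.carrier × Module.End ℝ W.carrier => p.1 * p.2 :=
  IsModuleTopology.continuous_bilinear_of_finite_left (LinearMap.mul ℝ (Module.End ℝ W.carrier))

instance FDMod.continuousMul_end {B : Type*} [Ring B] [Algebra ℝ B] (W : FDMod B) :
    ContinuousMul (Module.End ℝ W.carrier) := ⟨W.continuous_mul⟩

end Topology

/-! ### Isomorphisms of graded families and of bundles. -/

namespace GrFamily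

variable {G : Type*} [Group G] {D : SymData G} {X : Type*} [MulAction G X]

/-- The inverse of an isomorphism. -/
def Iso.symm {E E' : GrFamily D X} (e : E.Iso E') : E'.Iso E where
  toEquiv i x := (e.toEquiv i x).symm
  cont := e.cont_symm
  cont_symm := e.cont
  map_J i x v := by
    rw [LinearEquiv.symm_apply_eq, e.map_J, LinearEquiv.apply_symm_apply]
  map_act g i x v := by
    rw [LinearEquiv.symm_apply_eq, e.map_act, LinearEquiv.apply_symm_apply]

/-- The composite of two isomorphisms. -/
def Iso.trans {E E' E'' : GrFamily D X} (e : E.Iso E') (e' : E'.Iso E'') : E.Iso E'' where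
  toEquiv i x := (e.toEquiv i x).trans (e'.toEquiv i x)
  cont i := (e'.cont i).comp (e.cont i)
  cont_symm i := (e.cont_symm i).comp (e'.cont_symm i)
  map_J i x v := by simp only [LinearEquiv.trans_apply, e.map_J, e'.map_J]
  map_act g i x v := by simp only [LinearEquiv.trans_apply, e.map_act, e'.map_act]

/-- A family isomorphic to a vector bundle is a vector bundle. -/
theorem Iso.isBundle [TopologicalSpace X] {E E' : GrFamily D X} (e : E.Iso E')
    (h : E.IsBundle) : E'.IsBundle := by
  obtain ⟨hJ, hg, hp, ht⟩ := h
  refine ⟨fun i => ?_, fun g i => ?_, fun i => ?_, fun i x₀ => ?_⟩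
  · have := (e.cont i).comp ((hJ i).comp (e.cont_symm i))
    convert! this using 2 with v
    simp [e.map_J]
  · have := (e.cont (D.h g * i)).comp ((hg g i).comp (e.cont_symm i))
    convert! this using 2 with v
    simp [e.map_act]
  · exact (hp i).comp (e.cont_symm i)
  · obtain ⟨O, n, t, hO, hx, ht1, ht2⟩ := ht i x₀
    refine ⟨O, n, fun x => (e.toEquiv i x).symm.trans (t x), hO, hx, ?_, ?_⟩
    · exact ht1.comp (Continuous.subtype_mk ((e.cont_symm i).comp continuous_subtype_val)
        (p := fun a : E.Tot i => a.1 ∈ O) fun a => a.2)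
    · exact (e.cont i).comp ht2

end GrFamily

namespace VectObj

variable {G : Type*} [Group G] {D : SymData G} {X : Type*} [TopologicalSpace X] [MulAction G X]

theorem continuous_toFamily_coe (E : VectObj D X) (i : ℤˣ) :
    Continuous fun e : E.toFamily.Tot i => ((e.1, e.2.1) : X × E.U.carrier) :=
  @continuous_induced_dom _ _ (fun e : E.toFamily.Tot i => ((e.1, e.2.1) : X × E.U.carrier)) _

theorem continuous_toFamily_fst (E : VectObj D X) (i : ℤˣ) :
    Continuous fun e : E.toFamily.Tot i => e.1 :=
  continuous_fst.comp (E.continuous_toFamily_coe i)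

theorem continuous_toFamily_snd (E : VectObj D X) (i : ℤˣ) :
    Continuous fun e : E.toFamily.Tot i => (e.2.1 : E.U.carrier) :=
  continuous_snd.comp (E.continuous_toFamily_coe i)

theorem continuous_toFamily_mk (E : VectObj D X) (i : ℤˣ) {Y : Type*} [TopologicalSpace Y]
    {f : Y → E.toFamily.Tot i} (h1 : Continuous fun y => (f y).1)
    (h2 : Continuous fun y => ((f y).2.1 : E.U.carrier)) : Continuous f :=
  continuous_induced_rng.2 (h1.prodMk h2)

/-- A continuous family of linear isomorphisms which is compatible with the gradings and with the
action of `A` gives an isomorphism of bundles. -/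
def isoOf {E E' : VectObj D X} (f : X → E.U.carrier ≃ₗ[ℝ] E'.U.carrier)
    (hf : Continuous fun p : X × E.U.carrier => f p.1 p.2)
    (hf' : Continuous fun p : X × E'.U.carrier => (f p.1).symm p.2)
    (hε : ∀ x u, f x (E.ε x u) = E'.ε x (f x u))
    (hI : ∀ x u, f x (E.U.ρ D.I u) = E'.U.ρ D.I (f x u))
    (hg : ∀ g x u, f (g • x) (E.U.ρ (D.elt g) u) = E'.U.ρ (D.elt g) (f x u)) :
    E.toFamily.Iso E'.toFamily where
  toEquiv i x := LinearEquiv.ofSubmodules (f x) (E.fib i x) (E'.fib i x) <| by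
    ext u
    rw [Submodule.mem_map_equiv, mem_fib, mem_fib, ← (f x).injective.eq_iff, hε, map_smul,
      LinearEquiv.apply_symm_apply]
  cont i := E'.continuous_toFamily_mk i (E.continuous_toFamily_fst i)
    (hf.comp ((E.continuous_toFamily_fst i).prodMk (E.continuous_toFamily_snd i)))
  cont_symm i := E.continuous_toFamily_mk i (E'.continuous_toFamily_fst i)
    (hf'.comp ((E'.continuous_toFamily_fst i).prodMk (E'.continuous_toFamily_snd i)))
  map_J i x e := Subtype.ext (hI x e.1)
  map_act g i x e := Subtype.ext (hg g x e.1)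

end VectObj

end FreeFermion

/-! ### The solved Dirac bundle and its trivializations away from the poles. -/

namespace FreeFermion

noncomputable section

namespace GrMod

variable {G : Type*} [Group G] {D : SymData G}
variable {V : Type*} [NormedAddCommGroup V] [InnerProductSpace ℝ V] {ρV : G →* (V ≃ₗᵢ[ℝ] V)}
variable (W : GrMod D ρV)

/-- In the decomposition `w = a + b`, the eigenvalue equation forces twice the component of the
wrong degree to vanish. -/
theorem mem_gr_iff {i : ℤˣ} {w : W.W.carrier} : w ∈ W.gr i ↔ W.M₀ w = sgn i • w := by
  refine ⟨W.M₀_apply, fun h => ?_⟩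
  have hw : w ∈ W.gr 1 ⊔ W.gr (-1) := by rw [W.compl.sup_eq_top]; trivial
  obtain ⟨a, ha, b, hb, rfl⟩ := Submodule.mem_sup.1 hw
  rw [map_add, W.M₀_apply ha, W.M₀_apply hb] at h
  rcases Int.units_eq_one_or i with rfl | rfl
  · have hb0 : (2 : ℝ) • b = 0 := by
      simp only [sgn, Units.val_one, Units.val_neg, Int.cast_neg, Int.cast_one, one_smul,
        neg_smul] at h
      rw [two_smul]; exact add_eq_zero_iff_eq_neg.2 (add_left_cancel h).symm
    rw [(smul_eq_zero.1 hb0).resolve_left two_ne_zero, add_zero]; exact ha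
  · have ha0 : (2 : ℝ) • a = 0 := by
      simp only [sgn, Units.val_one, Units.val_neg, Int.cast_neg, Int.cast_one, one_smul,
        neg_smul, neg_add] at h
      rw [two_smul]; exact add_eq_zero_iff_eq_neg.2 (add_right_cancel h)
    rw [(smul_eq_zero.1 ha0).resolve_left two_ne_zero, zero_add]; exact hb

theorem M₀_M₀ (w : W.W.carrier) : W.M₀ (W.M₀ w) = w := LinearMap.congr_fun W.M₀_sq w

/-- The Clifford term of `k₀ M₀ + Γ v` anticommutes with `M₀` and the mass term squares to `k₀`, so
only the scalar `2 k₀` survives in the anticommutator. All formulas of Part 1 come from this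
identity. -/
theorem M₀_dirac (k : RepSphere ρV) (w : W.W.carrier) :
    W.M₀ (dirac (-W.M₀) W.M₀ W.Γ k w) =
      (2 * k.1.1) • w - dirac (-W.M₀) W.M₀ W.Γ k (W.M₀ w) := by
  have h := LinearMap.congr_fun (W.M₀_mul_Γ k.1.2) w
  simp only [Module.End.mul_apply, LinearMap.neg_apply] at h
  simp only [dirac_neg, LinearMap.add_apply, LinearMap.smul_apply, map_add, map_smul, M₀_M₀, h]
  module

/-- Twice the projection to the component of degree `i`. -/
def toGr (i : ℤˣ) : W.W.carrier →ₗ[ℝ] W.gr i :=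
  (LinearMap.id + sgn i • W.M₀).codRestrict _ fun w => by
    rw [mem_gr_iff]
    simp only [LinearMap.add_apply, LinearMap.smul_apply, LinearMap.id_apply, map_add, map_smul,
      M₀_M₀, smul_add, smul_smul, sgn_mul_self, one_smul]
    rw [add_comm]

@[simp] theorem coe_toGr (i : ℤˣ) (w : W.W.carrier) :
    (W.toGr i w : W.W.carrier) = w + sgn i • W.M₀ w := rfl

theorem _root_.FreeFermion.RepSphere.continuous_fst : Continuous fun k : RepSphere ρV => k.1.1 :=
  _root_.continuous_fst.comp (continuous_subtype_val (p := fun k : ℝ × V =>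
    k.1 ^ 2 + ‖k.2‖ ^ 2 = 1))

/-- The fibres of the bundle `solved`, as subspaces of `W`. -/
def solvedFib (i : ℤˣ) (k : RepSphere ρV) : Submodule ℝ W.W.carrier :=
  LinearMap.ker (dirac (-W.M₀) W.M₀ W.Γ k - sgn i • LinearMap.id)

theorem mem_solvedFib {i : ℤˣ} {k : RepSphere ρV} {w : W.W.carrier} :
    w ∈ W.solvedFib i k ↔ dirac (-W.M₀) W.M₀ W.Γ k w = sgn i • w := by
  simp [solvedFib, sub_eq_zero]

variable [FiniteDimensional ℝ V]

theorem solved_sq_apply (k : RepSphere ρV) (w : W.W.carrier) :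
    dirac (-W.M₀) W.M₀ W.Γ k (dirac (-W.M₀) W.M₀ W.Γ k w) = w :=
  LinearMap.congr_fun (W.solved.sq k) w

/-- Up to scale, `1 + εᵢ H` is the projection to an eigenspace, since `H² = 1`. The factor `c` is
kept free for the normalization of the inverse of `Ψ`. -/
theorem add_dirac_mem (i : ℤˣ) (k : RepSphere ρV) (c : ℝ) (w : W.W.carrier) :
    c • (w + sgn i • dirac (-W.M₀) W.M₀ W.Γ k w) ∈ W.solvedFib i k := by
  refine Submodule.smul_mem _ _ ?_
  rw [mem_solvedFib, map_add, map_smul, solved_sq_apply, smul_add, smul_smul, sgn_mul_self,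
    one_smul, add_comm]

/-- Away from the pole `k₀ = -(-1)^u`, the fibres of the solution of the Dirac Hamiltonian are
identified with the components of `W`. -/
def polar (u i i' : ℤˣ) (h : i' = u * i) (k : RepSphere ρV) (hk : 1 + sgn u * k.1.1 ≠ 0) :
    W.solvedFib i k ≃ₗ[ℝ] W.gr i' where
  toLinearMap := (W.toGr i').comp (W.solvedFib i k).subtype
  invFun w := ⟨_, W.add_dirac_mem i k (1 / (2 * (1 + sgn u * k.1.1))) w.1⟩
  left_inv v := by
    apply Subtype.ext
    have hv := W.mem_solvedFib.1 v.2
    have hi := sgn_mul_self i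
    have hi' : sgn i * sgn i' = sgn u := by
      rw [h, sgn_mul, mul_comm, mul_assoc, hi, mul_one]
    have hu : sgn i' = sgn u * sgn i := by rw [h, sgn_mul]
    have h3 := W.M₀_dirac k v.1
    rw [hv, map_smul] at h3
    have h4 : dirac (-W.M₀) W.M₀ W.Γ k (W.M₀ v.1) = (2 * k.1.1) • v.1 - sgn i • W.M₀ v.1 := by
      rw [h3]; abel
    change (1 / (2 * (1 + sgn u * k.1.1))) • ((v.1 + sgn i' • W.M₀ v.1) +
      sgn i • dirac (-W.M₀) W.M₀ W.Γ k (v.1 + sgn i' • W.M₀ v.1)) = v.1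
    rw [map_add, map_smul, hv, h4]
    -- Here `(1 + εᵢ H)(1 + εᵢ' M₀)` is expanded on a vector with `H v = εᵢ v`: the terms in `M₀ v`
    -- cancel and `εᵢ εᵢ' = u` leaves `2 (1 + u k₀) v`.
    have : (v.1 + sgn i' • W.M₀ v.1) + sgn i • (sgn i • v.1 + sgn i' • ((2 * k.1.1) • v.1 -
        sgn i • W.M₀ v.1)) = (1 + sgn i * sgn i + 2 * (sgn i * sgn i') * k.1.1) • v.1 +
          (sgn i' - sgn i * sgn i * sgn i') • W.M₀ v.1 := by module
    rw [this, hi, hi', one_mul, sub_self, zero_smul, add_zero, smul_smul]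
    rw [show 1 / (2 * (1 + sgn u * k.1.1)) * (1 + 1 + 2 * sgn u * k.1.1) = 1 by
      field_simp; ring, one_smul]
  right_inv w := by
    apply Subtype.ext
    have hw := W.M₀_apply w.2
    have hi := sgn_mul_self i
    have hi' : sgn i' * sgn i = sgn u := by
      rw [h, sgn_mul, mul_assoc, hi, mul_one]
    have hi2 := sgn_mul_self i'
    have h4 := W.M₀_dirac k w.1
    rw [hw, map_smul] at h4
    change (1 / (2 * (1 + sgn u * k.1.1))) • (w.1 + sgn i • dirac (-W.M₀) W.M₀ W.Γ k w.1) +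
      sgn i' • W.M₀ ((1 / (2 * (1 + sgn u * k.1.1))) •
        (w.1 + sgn i • dirac (-W.M₀) W.M₀ W.Γ k w.1)) = w.1
    rw [map_smul, map_add, map_smul, hw, h4, smul_comm (sgn i'), ← smul_add]
    -- The same computation with the roles of `H` and `M₀` exchanged, now on a vector with `M₀ w =
    -- εᵢ' w`.
    have : (w.1 + sgn i • dirac (-W.M₀) W.M₀ W.Γ k w.1) + sgn i' • (sgn i' • w.1 +
        sgn i • ((2 * k.1.1) • w.1 - sgn i' • dirac (-W.M₀) W.M₀ W.Γ k w.1)) =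
        (1 + sgn i' * sgn i' + 2 * (sgn i' * sgn i) * k.1.1) • w.1 +
          (sgn i - sgn i' * sgn i' * sgn i) • dirac (-W.M₀) W.M₀ W.Γ k w.1 := by module
    rw [this, hi2, hi', one_mul, sub_self, zero_smul, add_zero, smul_smul]
    rw [show 1 / (2 * (1 + sgn u * k.1.1)) * (1 + 1 + 2 * sgn u * k.1.1) = 1 by
      field_simp; ring, one_smul]

theorem coe_polar_symm {u i i' : ℤˣ} (h : i' = u * i) (k : RepSphere ρV)
    (hk : 1 + sgn u * k.1.1 ≠ 0) (w : W.gr i') :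
    ((W.polar u i i' h k hk).symm w : W.W.carrier) =
      (1 / (2 * (1 + sgn u * k.1.1))) • (w.1 + sgn i • dirac (-W.M₀) W.M₀ W.Γ k w.1) := rfl

theorem continuous_polar_symm (u i : ℤˣ) {Y : Type*} [TopologicalSpace Y]
    {k : Y → RepSphere ρV} {w : Y → W.W.carrier} (hk : Continuous k) (hw : Continuous w)
    (hu : ∀ y, 1 + sgn u * (k y).1.1 ≠ 0) :
    Continuous fun y => (1 / (2 * (1 + sgn u * (k y).1.1))) •
      (w y + sgn i • dirac (-W.M₀) W.M₀ W.Γ (k y) (w y)) := by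
  have h1 : Continuous fun y => (k y).1.1 := RepSphere.continuous_fst.comp hk
  have h2 : Continuous fun y => dirac (-W.M₀) W.M₀ W.Γ (k y) (w y) :=
    W.W.continuous_apply (W.solved.cont.comp hk) hw
  refine Continuous.smul ?_ (hw.add (h2.const_smul _))
  refine continuous_const.div (continuous_const.mul (continuous_const.add
    (continuous_const.mul h1))) fun y => mul_ne_zero two_ne_zero (hu y)

/-- `polar` identifies all fibres over this open set with one fixed space, and a basis of that space
gives the trivialization; both directions are explicit and continuous in `k`. -/
theorem solved_locally_trivial (u i : ℤˣ) :
    ∃ (n : ℕ) (t : ∀ x : {k : RepSphere ρV | 1 + sgn u * k.1.1 ≠ 0},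
        W.solved.toFamily.Fib i x ≃ₗ[ℝ] (Fin n → ℝ)),
      Continuous (fun e : {e : W.solved.toFamily.Tot i //
        e.1 ∈ {k : RepSphere ρV | 1 + sgn u * k.1.1 ≠ 0}} => t ⟨e.1.1, e.2⟩ e.1.2) ∧
      Continuous (fun p : {k : RepSphere ρV | 1 + sgn u * k.1.1 ≠ 0} × (Fin n → ℝ) =>
        (⟨p.1, (t p.1).symm p.2⟩ : W.solved.toFamily.Tot i)) := by
  let b : W.gr (u * i) ≃ₗ[ℝ] (Fin (Module.finrank ℝ (W.gr (u * i))) → ℝ) :=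
    (Module.finBasis ℝ (W.gr (u * i))).equivFun
  refine ⟨Module.finrank ℝ (W.gr (u * i)), fun x => (W.polar u i (u * i) rfl x.1 x.2).trans b,
    ?_, ?_⟩
  · have h1 := W.W.continuous_linearMap (b.toLinearMap.comp (W.toGr (u * i)))
    exact h1.comp ((W.solved.continuous_toFamily_snd i).comp continuous_subtype_val)
  · refine W.solved.continuous_toFamily_mk i (continuous_subtype_val.comp continuous_fst) ?_
    refine W.continuous_polar_symm u i (Y := {k : RepSphere ρV | 1 + sgn u * k.1.1 ≠ 0} × (Fin _ → ℝ))
      (k := fun p => p.1.1) (w := fun p => (b.symm p.2).1)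
      (continuous_subtype_val.comp continuous_fst) ?_ fun p => p.1.2
    have := IsModuleTopology.continuous_of_linearMap (R := ℝ)
      ((W.gr (u * i)).subtype.comp b.symm.toLinearMap)
    exact this.comp continuous_snd

theorem isBundle_solved : W.solved.toFamily.IsBundle := by
  refine ⟨fun i => ?_, fun g i => ?_, W.solved.continuous_toFamily_fst, fun i x₀ => ?_⟩
  · exact W.solved.continuous_toFamily_mk i (W.solved.continuous_toFamily_fst i)
      ((W.baseMod.continuous_linearMap (W.baseMod.ρ D.I)).comp
        (W.solved.continuous_toFamily_snd i))
  · refine W.solved.continuous_toFamily_mk _ (?_ : Continuous fun e : W.solved.toFamily.Tot i => g • e.1)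
      ((W.baseMod.continuous_linearMap (W.baseMod.ρ (D.elt g))).comp
        (W.solved.continuous_toFamily_snd i))
    have : Continuous fun k : RepSphere ρV => g • k := by
      have h0 : Continuous fun k : ℝ × V => (k.1, ρV g k.2) := by fun_prop
      exact (h0.comp (continuous_subtype_val (p := fun k : ℝ × V =>
        k.1 ^ 2 + ‖k.2‖ ^ 2 = 1))).subtype_mk _
    exact this.comp (W.solved.continuous_toFamily_fst i)
  · have hO : ∀ u : ℤˣ, IsOpen {k : RepSphere ρV | 1 + sgn u * k.1.1 ≠ 0} := fun u =>
      isOpen_ne_fun (continuous_const.add (continuous_const.mul RepSphere.continuous_fst))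
        continuous_const
    -- The chart `u = 1` fails only at `k₀ = -1`, where the chart `u = -1` has `1 - k₀ = 2`.
    by_cases h : 1 + sgn 1 * x₀.1.1 = 0
    · obtain ⟨n, t, h1, h2⟩ := W.solved_locally_trivial (-1) i
      refine ⟨_, n, t, hO _, ?_, h1, h2⟩
      simp only [sgn, Units.val_one, Int.cast_one, one_mul] at h
      simp only [sgn, Units.val_neg, Units.val_one, Int.cast_neg, Int.cast_one, neg_mul, one_mul,
        Set.mem_ofPred_eq]
      intro h'
      linarith
    · obtain ⟨n, t, h1, h2⟩ := W.solved_locally_trivial 1 i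
      exact ⟨_, n, t, hO _, h, h1, h2⟩

end GrMod

end

end FreeFermion

/-! ### The isomorphism from the solved bundle to the clutched bundle. -/

namespace FreeFermion

noncomputable section

namespace GrMod

variable {G : Type*} [Group G] {D : SymData G}
variable {V : Type*} [NormedAddCommGroup V] [InnerProductSpace ℝ V] {ρV : G →* (V ≃ₗᵢ[ℝ] V)}
variable (W : GrMod D ρV)

/-- The isomorphism from the solution of the Dirac Hamiltonian to the clutched bundle, in the
coordinates of the two pieces. -/
def clutchFun (i : ℤˣ) (k : RepSphere ρV) : W.W.carrier →ₗ[ℝ] W.W.carrier × W.W.carrier :=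
  (if 0 ≤ k.1.1 then LinearMap.id + sgn i • W.M₀ else 0).prod
    (if k.1.1 ≤ 0 then LinearMap.id - sgn i • W.M₀ else 0)

theorem clutchFun_apply (i : ℤˣ) (k : RepSphere ρV) (v : W.W.carrier) :
    W.clutchFun i k v = (if 0 ≤ k.1.1 then v + sgn i • W.M₀ v else 0,
      if k.1.1 ≤ 0 then v - sgn i • W.M₀ v else 0) := by
  unfold clutchFun
  split_ifs <;> rfl

theorem toGr_neg_coe (i : ℤˣ) (v : W.W.carrier) :
    (W.toGr (-i) v : W.W.carrier) = v - sgn i • W.M₀ v := by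
  rw [coe_toGr, sub_eq_add_neg, ← neg_smul]
  simp [sgn]

/-- Only the equator needs an argument. There the Hamiltonian is `Γ`, so `Γ v = εᵢ v` and `Γ M₀ v =
-εᵢ M₀ v`; hence the transition function `εᵢ Γ` takes `v + εᵢ M₀ v` to `v - εᵢ M₀ v`, the southern
coordinate. -/
theorem clutchFun_north {i : ℤˣ} {k : RepSphere ρV} (hk : 0 ≤ k.1.1) {v : W.W.carrier}
    (hv : v ∈ W.solvedFib i k) : W.clutchFun i k v = (W.north i k hk (W.toGr i v)).1 := by
  have h := W.mem_solvedFib.1 hv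
  rw [dirac_neg] at h
  refine Prod.ext ?_ ?_
  · simp [clutchFun_apply, north, hk]
  · rcases hk.eq_or_lt with h0 | h0
    · rw [← h0, zero_smul, zero_add] at h
      have h2 := LinearMap.congr_fun (W.M₀_mul_Γ k.1.2) v
      simp only [Module.End.mul_apply, LinearMap.neg_apply, h, map_smul] at h2
      have h3 : W.Γ k.1.2 (W.M₀ v) = -(sgn i • W.M₀ v) := by rw [h2, neg_neg]
      simp only [clutchFun_apply, north, ← h0, le_refl, if_true, coe_toGr, map_add, map_smul,
        h, h3, smul_add, smul_smul, smul_neg, sgn_mul_self, one_smul]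
      rw [← sub_eq_add_neg]
    · simp [clutchFun_apply, north, h0.ne', not_le.2 h0]

/-- The equator computation in the opposite direction: `εᵢ Γ` is its own inverse there and takes `v
- εᵢ M₀ v` back to `v + εᵢ M₀ v`. -/
theorem clutchFun_south {i : ℤˣ} {k : RepSphere ρV} (hk : k.1.1 ≤ 0) {v : W.W.carrier}
    (hv : v ∈ W.solvedFib i k) : W.clutchFun i k v = (W.south i k hk (W.toGr (-i) v)).1 := by
  have h := W.mem_solvedFib.1 hv
  rw [dirac_neg] at h
  refine Prod.ext ?_ ?_
  · rcases hk.eq_or_lt with h0 | h0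
    · rw [h0, zero_smul, zero_add] at h
      have h2 := LinearMap.congr_fun (W.M₀_mul_Γ k.1.2) v
      simp only [Module.End.mul_apply, LinearMap.neg_apply, h, map_smul] at h2
      have h3 : W.Γ k.1.2 (W.M₀ v) = -(sgn i • W.M₀ v) := by rw [h2, neg_neg]
      simp only [clutchFun_apply, south, h0, le_refl, if_true, toGr_neg_coe, map_sub,
        map_smul, h, h3, smul_add, smul_smul, smul_neg, sgn_mul_self, one_smul, sub_neg_eq_add]
    · simp [clutchFun_apply, south, h0.ne, not_le.2 h0]
  · simp only [south, toGr_neg_coe]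
    simp [clutchFun_apply, hk]

theorem clutchFun_mem {i : ℤˣ} {k : RepSphere ρV} {v : W.W.carrier}
    (hv : v ∈ W.solvedFib i k) : W.clutchFun i k v ∈ W.clutchFib i k := by
  rcases le_total 0 k.1.1 with hk | hk
  · rw [W.clutchFun_north hk hv]; exact (W.north i k hk _).2
  · rw [W.clutchFun_south hk hv]; exact (W.south i k hk _).2

theorem north_ne {k : RepSphere ρV} (hk : 0 ≤ k.1.1) : 1 + sgn 1 * k.1.1 ≠ 0 := by
  simp only [sgn, Units.val_one, Int.cast_one, one_mul]; positivity

theorem south_ne {k : RepSphere ρV} (hk : k.1.1 ≤ 0) : 1 + sgn (-1) * k.1.1 ≠ 0 := by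
  simp only [sgn, Units.val_neg, Units.val_one, Int.cast_neg, Int.cast_one, neg_mul, one_mul]
  intro h; linarith

theorem continuous_north (i : ℤˣ) : Continuous
    (fun p : {k : RepSphere ρV // 0 ≤ k.1.1} × W.gr i =>
      (⟨p.1.1, W.north i p.1.1 p.1.2 p.2⟩ : W.abs.Tot i)) :=
  continuous_iff_coinduced_le.2 le_sup_left

theorem continuous_south (i : ℤˣ) : Continuous
    (fun p : {k : RepSphere ρV // k.1.1 ≤ 0} × W.gr (-i) =>
      (⟨p.1.1, W.south i p.1.1 p.1.2 p.2⟩ : W.abs.Tot i)) :=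
  continuous_iff_coinduced_le.2 le_sup_right

theorem continuous_abs_dom (i : ℤˣ) {Y : Type*} [TopologicalSpace Y] {f : W.abs.Tot i → Y}
    (h1 : Continuous fun p : {k : RepSphere ρV // 0 ≤ k.1.1} × W.gr i =>
      f ⟨p.1.1, W.north i p.1.1 p.1.2 p.2⟩)
    (h2 : Continuous fun p : {k : RepSphere ρV // k.1.1 ≤ 0} × W.gr (-i) =>
      f ⟨p.1.1, W.south i p.1.1 p.1.2 p.2⟩) : Continuous f :=
  continuous_sup_dom.2 ⟨continuous_coinduced_dom.2 h1, continuous_coinduced_dom.2 h2⟩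

theorem clutchFun_I (i : ℤˣ) (k : RepSphere ρV) (v : W.W.carrier) :
    W.clutchFun i k (W.baseMod.ρ D.I v) =
      (W.baseMod.ρ D.I).prodMap (W.baseMod.ρ D.I) (W.clutchFun i k v) := by
  have h : W.M₀ (W.baseMod.ρ D.I v) = W.baseMod.ρ D.I (W.M₀ v) :=
    LinearMap.congr_fun W.M₀_mul_I v
  refine Prod.ext ?_ ?_ <;>
    simp only [clutchFun_apply, LinearMap.prodMap_apply] <;> split_ifs <;>
    simp only [map_add, map_sub, map_smul, map_zero, h]

/-- Moving `M₀` past `g` costs the sign `(-1)^{h(g)}`, which is cancelled by the change of degree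
from `i` to `h(g) i`; the hemispheres are preserved because `G` fixes `k₀`. -/
theorem clutchFun_elt (g : G) (i : ℤˣ) (k : RepSphere ρV) (v : W.W.carrier) :
    W.clutchFun (D.h g * i) (g • k) (W.baseMod.ρ (D.elt g) v) =
      (W.baseMod.ρ (D.elt g)).prodMap (W.baseMod.ρ (D.elt g)) (W.clutchFun i k v) := by
  have h : sgn (D.h g * i) • W.M₀ (W.baseMod.ρ (D.elt g) v) =
      sgn i • W.baseMod.ρ (D.elt g) (W.M₀ v) := by
    have := LinearMap.congr_fun (W.M₀_mul_elt g) v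
    simp only [Module.End.mul_apply, LinearMap.smul_apply] at this
    rw [this, smul_smul, mul_comm (D.h g), sgn_mul, mul_assoc, sgn_mul_self, mul_one]
  refine Prod.ext ?_ ?_ <;>
    simp only [clutchFun_apply, LinearMap.prodMap_apply, smul_fst] <;>
    split_ifs <;>
    simp only [map_add, map_sub, map_smul, map_zero, h]

variable [FiniteDimensional ℝ V]

/-- The isomorphism `Ψ` on fibres, as a linear map. -/
def clutchLin (i : ℤˣ) (k : RepSphere ρV) : W.solvedFib i k →ₗ[ℝ] W.clutchFib i k :=
  (W.clutchFun i k).restrict fun _ hv => W.clutchFun_mem hv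

theorem clutchLin_north {i : ℤˣ} {k : RepSphere ρV} (hk : 0 ≤ k.1.1) (v : W.solvedFib i k) :
    W.clutchLin i k v = W.north i k hk (W.polar 1 i i (one_mul i).symm k (north_ne hk) v) :=
  Subtype.ext (W.clutchFun_north hk v.2)

theorem clutchLin_south {i : ℤˣ} {k : RepSphere ρV} (hk : k.1.1 ≤ 0) (v : W.solvedFib i k) :
    W.clutchLin i k v =
      W.south i k hk (W.polar (-1) i (-i) (neg_one_mul i).symm k (south_ne hk) v) :=
  Subtype.ext (W.clutchFun_south hk v.2)

/-- The isomorphism `Ψ` on fibres. -/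
def clutchEquiv (i : ℤˣ) (k : RepSphere ρV) : W.solvedFib i k ≃ₗ[ℝ] W.clutchFib i k :=
  LinearEquiv.ofBijective (W.clutchLin i k) <| by
    constructor
    · intro v v' h
      rcases le_total 0 k.1.1 with hk | hk
      · rw [W.clutchLin_north hk, W.clutchLin_north hk] at h
        exact LinearEquiv.injective _ (W.north_injective i k hk h)
      · rw [W.clutchLin_south hk, W.clutchLin_south hk] at h
        exact LinearEquiv.injective _ (W.south_injective i k hk h)
    · intro e
      rcases W.clutch_cover i k e with ⟨hk, w, rfl⟩ | ⟨hk, w, rfl⟩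
      · exact ⟨(W.polar 1 i i (one_mul i).symm k (north_ne hk)).symm w, by
          rw [W.clutchLin_north hk, LinearEquiv.apply_symm_apply]⟩
      · exact ⟨(W.polar (-1) i (-i) (neg_one_mul i).symm k (south_ne hk)).symm w, by
          rw [W.clutchLin_south hk, LinearEquiv.apply_symm_apply]⟩

theorem clutchEquiv_symm_north {i : ℤˣ} {k : RepSphere ρV} (hk : 0 ≤ k.1.1) (w : W.gr i) :
    (W.clutchEquiv i k).symm (W.north i k hk w) =
      (W.polar 1 i i (one_mul i).symm k (north_ne hk)).symm w := by
  rw [LinearEquiv.symm_apply_eq]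
  change _ = W.clutchLin i k _
  rw [W.clutchLin_north hk, LinearEquiv.apply_symm_apply]

theorem clutchEquiv_symm_south {i : ℤˣ} {k : RepSphere ρV} (hk : k.1.1 ≤ 0) (w : W.gr (-i)) :
    (W.clutchEquiv i k).symm (W.south i k hk w) =
      (W.polar (-1) i (-i) (neg_one_mul i).symm k (south_ne hk)).symm w := by
  rw [LinearEquiv.symm_apply_eq]
  change _ = W.clutchLin i k _
  rw [W.clutchLin_south hk, LinearEquiv.apply_symm_apply]

/-- Continuity can be checked over the two closed hemispheres, where the map is a continuous map
into a product piece followed by the inclusion of this piece into the quotient. -/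
theorem continuous_clutchEquiv (i : ℤˣ) : Continuous fun e : W.solved.toFamily.Tot i =>
    (⟨e.1, W.clutchEquiv i e.1 e.2⟩ : W.abs.Tot i) := by
  have hc : Continuous fun e : W.solved.toFamily.Tot i => e.1.1.1 :=
    RepSphere.continuous_fst.comp (W.solved.continuous_toFamily_fst i)
  rw [← continuousOn_univ, show (Set.univ : Set (W.solved.toFamily.Tot i)) =
    {e | 0 ≤ e.1.1.1} ∪ {e | e.1.1.1 ≤ 0} from
      (Set.eq_univ_of_forall fun e : W.solved.toFamily.Tot i => (le_total 0 e.1.1.1 : _ ∨ _)).symm]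
  refine ContinuousOn.union_of_isClosed ?_ ?_ (isClosed_le continuous_const hc)
    (isClosed_le hc continuous_const)
  · rw [continuousOn_iff_continuous_domRestrict]
    have h1 := (W.continuous_north i).comp (Continuous.prodMk
      (((W.solved.continuous_toFamily_fst i).comp continuous_subtype_val).subtype_mk
        (fun e : {e : W.solved.toFamily.Tot i | 0 ≤ e.1.1.1} => e.2))
      ((W.W.continuous_linearMap (W.toGr i)).comp
        ((W.solved.continuous_toFamily_snd i).comp continuous_subtype_val)))
    convert! h1 using 1
    funext e
    exact congrArg (Sigma.mk _) (W.clutchLin_north e.2 _)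
  · rw [continuousOn_iff_continuous_domRestrict]
    have h1 := (W.continuous_south i).comp (Continuous.prodMk
      (((W.solved.continuous_toFamily_fst i).comp continuous_subtype_val).subtype_mk
        (fun e : {e : W.solved.toFamily.Tot i | e.1.1.1 ≤ 0} => e.2))
      ((W.W.continuous_linearMap (W.toGr (-i))).comp
        ((W.solved.continuous_toFamily_snd i).comp continuous_subtype_val)))
    convert! h1 using 1
    funext e
    exact congrArg (Sigma.mk _) (W.clutchLin_south e.2 _)

/-- Out of the quotient topology, continuity is tested on the two pieces; on each the inverse is the
explicit formula of `polar`, with nonvanishing denominator. -/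
theorem continuous_clutchEquiv_symm (i : ℤˣ) : Continuous fun e : W.abs.Tot i =>
    (⟨e.1, (W.clutchEquiv i e.1).symm e.2⟩ : W.solved.toFamily.Tot i) := by
  refine W.continuous_abs_dom i ?_ ?_
  · refine W.solved.continuous_toFamily_mk i (continuous_subtype_val.comp continuous_fst) ?_
    have := W.continuous_polar_symm 1 i (Y := {k : RepSphere ρV // 0 ≤ k.1.1} × W.gr i)
      (k := fun p => p.1.1) (w := fun p => p.2.1) (continuous_subtype_val.comp continuous_fst)
      (continuous_subtype_val.comp continuous_snd) fun p => north_ne p.1.2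
    convert! this using 1
    funext p
    exact congrArg Subtype.val (W.clutchEquiv_symm_north p.1.2 p.2)
  · refine W.solved.continuous_toFamily_mk i (continuous_subtype_val.comp continuous_fst) ?_
    have := W.continuous_polar_symm (-1) i (Y := {k : RepSphere ρV // k.1.1 ≤ 0} × W.gr (-i))
      (k := fun p => p.1.1) (w := fun p => p.2.1) (continuous_subtype_val.comp continuous_fst)
      (continuous_subtype_val.comp continuous_snd) fun p => south_ne p.1.2
    convert! this using 1
    funext p
    exact congrArg Subtype.val (W.clutchEquiv_symm_south p.1.2 p.2)

/-- The isomorphism `Ψ` from the solution of the Dirac Hamiltonian to the clutched bundle. -/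
def clutchIso : W.solved.toFamily.Iso W.abs where
  toEquiv := W.clutchEquiv
  cont := W.continuous_clutchEquiv
  cont_symm := W.continuous_clutchEquiv_symm
  map_J i k e := Subtype.ext (W.clutchFun_I i k e.1)
  map_act g i k e := Subtype.ext (W.clutchFun_elt g i k e.1)

theorem exists_clutchIso :
    W.abs.IsBundle ∧ W.solved.toFamily.IsBundle ∧
      ∃ Ψ : W.solved.toFamily.Iso W.abs,
        ∀ (i : ℤˣ) (k : RepSphere ρV),
          (∀ hk : 0 ≤ k.1.1,
            (∀ (v : W.W.carrier) (hv : v ∈ W.solved.fib i k), ∃ hw : v + sgn i • W.M₀ v ∈ W.gr i,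
              Ψ.toEquiv i k ⟨v, hv⟩ = W.north i k hk ⟨v + sgn i • W.M₀ v, hw⟩) ∧
            ∀ w : W.gr i, ((Ψ.toEquiv i k).symm (W.north i k hk w)).1 =
              (1 / (2 * (1 + k.1.1))) • (w.1 + sgn i • dirac (-W.M₀) W.M₀ W.Γ k w.1)) ∧
          (∀ hk : k.1.1 ≤ 0,
            (∀ (v : W.W.carrier) (hv : v ∈ W.solved.fib i k), ∃ hw : v - sgn i • W.M₀ v ∈ W.gr (-i),
              Ψ.toEquiv i k ⟨v, hv⟩ = W.south i k hk ⟨v - sgn i • W.M₀ v, hw⟩) ∧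
            ∀ w : W.gr (-i), ((Ψ.toEquiv i k).symm (W.south i k hk w)).1 =
              (1 / (2 * (1 - k.1.1))) • (w.1 + sgn i • dirac (-W.M₀) W.M₀ W.Γ k w.1)) := by
  refine ⟨W.clutchIso.isBundle W.isBundle_solved, W.isBundle_solved, W.clutchIso, fun i k =>
    ⟨fun hk => ⟨fun v hv => ⟨(W.toGr i v).2, W.clutchLin_north hk ⟨v, hv⟩⟩, fun w => ?_⟩,
      fun hk => ⟨fun v hv => ?_, fun w => ?_⟩⟩⟩
  · refine (congrArg Subtype.val (W.clutchEquiv_symm_north hk w)).trans ?_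
    rw [coe_polar_symm]
    simp only [sgn, Units.val_one, Int.cast_one, one_mul]
  · have h := W.toGr_neg_coe i v
    refine ⟨h ▸ (W.toGr (-i) v).2, (W.clutchLin_south hk ⟨v, hv⟩).trans ?_⟩
    exact congrArg (W.south i k hk) (Subtype.ext h)
  · refine (congrArg Subtype.val (W.clutchEquiv_symm_south hk w)).trans ?_
    rw [coe_polar_symm]
    simp only [sgn, Units.val_neg, Units.val_one, Int.cast_neg, Int.cast_one, neg_mul, one_mul,
      ← sub_eq_add_neg]

end GrMod

end

end FreeFermion

/-! ### Modules over `Cl^{0,1} ⊗̂ Aⱽ` and `Cl^{0,2} ⊗̂ Aⱽ`; opposites and doubles. -/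

namespace FreeFermion

noncomputable section

section DirAlg

variable {G : Type*} [Group G] {D : SymData G}
variable {V : Type*} [NormedAddCommGroup V] [InnerProductSpace ℝ V] {ρV : G →* (V ≃ₗᵢ[ℝ] V)}

/-- A subalgebra of `Aⱽ` containing the generators is everything. -/
theorem algV_induction (S : Subalgebra ℝ (AlgV D ρV)) (hI : algIncl D ρV D.I ∈ S)
    (hg : ∀ g, algIncl D ρV (D.elt g) ∈ S) (hv : ∀ v, algVec D ρV v ∈ S) (a : AlgV D ρV) :
    a ∈ S := by
  obtain ⟨x, rfl⟩ := RingQuot.mkAlgHom_surjective ℝ (VRel D ρV) a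
  change Presented.mk (VRel D ρV) x ∈ S
  induction x using FreeAlgebra.induction with
  | grade0 r => rw [AlgHom.commutes]; exact S.algebraMap_mem r
  | grade1 x =>
    rcases x with (_ | g) | v
    · rw [algIncl_I] at hI; exact hI
    · have := hg g; rw [algIncl_elt] at this; exact this
    · exact hv v
  | mul a b ha hb => rw [map_mul]; exact S.mul_mem ha hb
  | add a b ha hb => rw [map_add]; exact S.add_mem ha hb

/-- A subalgebra of `Cl^{0,1} ⊗̂ Aⱽ` containing the generators is everything. -/
theorem dirAlg_induction (S : Subalgebra ℝ (DirAlg D ρV 1)) (hm : massElt D ρV ∈ S)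
    (ha : ∀ a, fromAlgV D ρV 1 a ∈ S) (b : DirAlg D ρV 1) : b ∈ S := by
  have hc : ∀ c, fromCl D ρV 1 c ∈ S := by
    intro c
    induction c using CliffordAlgebra.induction with
    | algebraMap r => rw [AlgHom.commutes]; exact S.algebraMap_mem r
    | ι v =>
      have hv : v = v 0 • Pi.single (0 : Fin 1) (1 : ℝ) := by
        ext i; fin_cases i; simp
      rw [hv, map_smul, map_smul]
      exact S.smul_mem hm _
    | mul a b ha hb => rw [map_mul]; exact S.mul_mem ha hb
    | add a b ha hb => rw [map_add]; exact S.add_mem ha hb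
  refine TensorProduct.induction_on (motive := fun b : (Cl 1) ⊗[ℝ] (AlgV D ρV) =>
    GradedTensorProduct.of ℝ (CliffordAlgebra.evenOdd (posForm 1)) (degPart D ρV) b ∈ S) b
    ?_ ?_ ?_
  · rw [map_zero]; exact S.zero_mem
  · intro x y
    have := S.mul_mem (hc x) (ha y)
    rwa [fromCl, fromAlgV, GradedTensorProduct.includeLeft_apply,
      GradedTensorProduct.includeRight_apply, GradedTensorProduct.tmul_one_mul_one_tmul] at this
  · intro x y hx hy
    rw [map_add]; exact S.add_mem hx hy

theorem dirAlg_hom_ext {E : Type*} [Ring E] [Algebra ℝ E] {f f' : DirAlg D ρV 1 →ₐ[ℝ] E}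
    (hm : f (massElt D ρV) = f' (massElt D ρV))
    (ha : ∀ a, f (fromAlgV D ρV 1 a) = f' (fromAlgV D ρV 1 a)) : f = f' :=
  AlgHom.ext fun b => dirAlg_induction (AlgHom.equalizer f f') hm ha b

/-- A linear map between modules over `Cl^{0,1} ⊗̂ Aⱽ` which commutes with the generators is a
homomorphism of modules. -/
theorem dirAlg_map_of_gen {X Y : Type*} [AddCommGroup X] [Module ℝ X] [AddCommGroup Y] [Module ℝ Y]
    {ρ : DirAlg D ρV 1 →ₐ[ℝ] Module.End ℝ X} {ρ' : DirAlg D ρV 1 →ₐ[ℝ] Module.End ℝ Y}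
    (f : X →ₗ[ℝ] Y) (hm : ∀ x, f (ρ (massElt D ρV) x) = ρ' (massElt D ρV) (f x))
    (hI : ∀ x, f (ρ (fromAlgV D ρV 1 (algIncl D ρV D.I)) x) =
      ρ' (fromAlgV D ρV 1 (algIncl D ρV D.I)) (f x))
    (hg : ∀ g x, f (ρ (fromAlgV D ρV 1 (algIncl D ρV (D.elt g))) x) =
      ρ' (fromAlgV D ρV 1 (algIncl D ρV (D.elt g))) (f x))
    (hv : ∀ v x, f (ρ (fromAlgV D ρV 1 (algVec D ρV v)) x) =
      ρ' (fromAlgV D ρV 1 (algVec D ρV v)) (f x)) (b : DirAlg D ρV 1) (x : X) :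
    f (ρ b x) = ρ' b (f x) := by
  let S : Subalgebra ℝ (DirAlg D ρV 1) :=
    { carrier := {b | ∀ x, f (ρ b x) = ρ' b (f x)}
      mul_mem' := fun {a b} ha hb x => by
        simp only [Set.mem_ofPred_eq] at ha hb
        rw [map_mul, map_mul, Module.End.mul_apply, ha, hb, Module.End.mul_apply]
      add_mem' := fun {a b} ha hb x => by
        simp only [Set.mem_ofPred_eq] at ha hb
        rw [map_add, map_add, LinearMap.add_apply, map_add, ha, hb, LinearMap.add_apply]
      algebraMap_mem' := fun r x => by
        rw [AlgHom.commutes, AlgHom.commutes, Module.algebraMap_end_apply,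
          Module.algebraMap_end_apply, map_smul] }
  exact dirAlg_induction S hm (fun a =>
    algV_induction (S.comap (fromAlgV D ρV 1)) hI hg hv a) b x

/-- For `b` even, commuting with `g b` is stable under products in `Cl n`. For `b` odd, the relation
stable under products is `f a * g b = g b * f (involute a)`. Both follow from the generators, and
the involution is `±1` on the even and odd parts. -/
theorem graded_comm_of_gen {E : Type*} [Ring E] [Algebra ℝ E] {n : ℕ} (f : Cl n →ₐ[ℝ] E)
    (g : AlgV D ρV →ₐ[ℝ] E)
    (h : ∀ v (j : ZMod 2) (b : AlgV D ρV), b ∈ degPart D ρV j →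
      f (CliffordAlgebra.ι _ v) * g b =
        sgn ((-1 : ℤˣ) ^ j) • (g b * f (CliffordAlgebra.ι _ v)))
    {i j : ZMod 2} (a : CliffordAlgebra.evenOdd (posForm n) i) (b : degPart D ρV j) :
    f a * g b = (-1 : ℤˣ) ^ (j * i) • (g b * f a) := by
  obtain ⟨a, ha⟩ := a
  obtain ⟨b, hb⟩ := b
  rcases zmod2_cases j with rfl | rfl
  · have key : f a * g b = g b * f a := by
      clear ha
      induction a using CliffordAlgebra.induction with
      | algebraMap r => rw [AlgHom.commutes, Algebra.commutes]
      | ι v => simpa [sgn] using h v 0 b hb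
      | mul x y hx hy => rw [map_mul, mul_assoc, hy, ← mul_assoc, hx, mul_assoc]
      | add x y hx hy => rw [map_add, add_mul, mul_add, hx, hy]
    simpa using key
  · have key : f a * g b = g b * f (CliffordAlgebra.involute a) := by
      clear ha
      induction a using CliffordAlgebra.induction with
      | algebraMap r =>
        rw [AlgHom.commutes, AlgHom.commutes, AlgHom.commutes, Algebra.commutes]
      | ι v => simpa [sgn] using h v 1 b hb
      | mul x y hx hy => rw [map_mul, mul_assoc, hy, ← mul_assoc, hx, mul_assoc, map_mul, map_mul]
      | add x y hx hy => rw [map_add, add_mul, map_add, map_add, mul_add, hx, hy]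
    rcases zmod2_cases i with rfl | rfl
    · rw [CliffordAlgebra.involute_eq_of_mem_even ha] at key
      simpa using key
    · rw [CliffordAlgebra.involute_eq_of_mem_odd ha] at key
      simpa using key

/-- An action of `Aⱽ` together with an action of `Cl^{0,n}` which commutes with it in the graded
sense gives an action of `Cl^{0,n} ⊗̂ Aⱽ`. -/
def dirLift {E : Type*} [Ring E] [Algebra ℝ E] {n : ℕ} (g : AlgV D ρV →ₐ[ℝ] E)
    (c : (Fin n → ℝ) →ₗ[ℝ] E) (hc : ∀ v, c v * c v = algebraMap ℝ E (posForm n v))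
    (h : ∀ v (j : ZMod 2) (b : AlgV D ρV), b ∈ degPart D ρV j →
      c v * g b = sgn ((-1 : ℤˣ) ^ j) • (g b * c v)) : DirAlg D ρV n →ₐ[ℝ] E :=
  GradedTensorProduct.lift _ _ (CliffordAlgebra.lift (posForm n) ⟨c, hc⟩) g fun _ _ a b =>
    graded_comm_of_gen _ g (fun v j b hb => by
      rw [CliffordAlgebra.lift_ι_apply]; exact h v j b hb) a b

section dirLift

variable {E : Type*} [Ring E] [Algebra ℝ E] {n : ℕ} (g : AlgV D ρV →ₐ[ℝ] E)
    (c : (Fin n → ℝ) →ₗ[ℝ] E) (hc : ∀ v, c v * c v = algebraMap ℝ E (posForm n v))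
    (h : ∀ v (j : ZMod 2) (b : AlgV D ρV), b ∈ degPart D ρV j →
      c v * g b = sgn ((-1 : ℤˣ) ^ j) • (g b * c v))

@[simp] theorem dirLift_fromAlgV (a : AlgV D ρV) : dirLift g c hc h (fromAlgV D ρV n a) = g a := by
  rw [dirLift, fromAlgV, GradedTensorProduct.includeRight_apply, GradedTensorProduct.lift_tmul]
  simp

@[simp] theorem dirLift_clGen (i : Fin n) :
    dirLift g c hc h (fromCl D ρV n (clGen n i)) = c (Pi.single i 1) := by
  rw [dirLift, fromCl, GradedTensorProduct.includeLeft_apply, GradedTensorProduct.lift_tmul, clGen,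
    CliffordAlgebra.lift_ι_apply]
  simp

end dirLift

@[simp] theorem dirIncl_massElt : dirIncl D ρV (massElt D ρV) = fromCl D ρV 2 (clGen 2 0) := by
  refine (GradedTensorProduct.lift_tmul _ _ _ _ _ _ _).trans ?_
  rw [map_one, mul_one, AlgHom.comp_apply, clIncl_gen]

@[simp] theorem dirIncl_fromAlgV (a : AlgV D ρV) :
    dirIncl D ρV (fromAlgV D ρV 1 a) = fromAlgV D ρV 2 a := by
  refine (GradedTensorProduct.lift_tmul _ _ _ _ _ _ _).trans ?_
  rw [map_one, one_mul]

/-- An action of `Cl^{0,1} ⊗̂ Aⱽ` given by an action of `Aⱽ` and a mass operator. -/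
def dirLift₁ {E : Type*} [Ring E] [Algebra ℝ E] (g : AlgV D ρV →ₐ[ℝ] E) (e : E) (he : e * e = 1)
    (h : ∀ (j : ZMod 2) (b : AlgV D ρV), b ∈ degPart D ρV j →
      e * g b = sgn ((-1 : ℤˣ) ^ j) • (g b * e)) : DirAlg D ρV 1 →ₐ[ℝ] E :=
  dirLift g ((LinearMap.proj 0).smulRight e)
    (fun v => by
      simp [QuadraticMap.weightedSumSquares_apply, he, Algebra.algebraMap_eq_smul_one, smul_smul])
    (fun v j b hb => by
      simp only [LinearMap.smulRight_apply, smul_mul_assoc, h j b hb, mul_smul_comm]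
      rw [smul_comm])

/-- An action of `Cl^{0,2} ⊗̂ Aⱽ` given by an action of `Aⱽ` and two anticommuting mass
operators. -/
def dirLift₂ {E : Type*} [Ring E] [Algebra ℝ E] (g : AlgV D ρV →ₐ[ℝ] E) (e e' : E) (he : e * e = 1)
    (he' : e' * e' = 1) (hee : e' * e = -(e * e'))
    (h : ∀ (j : ZMod 2) (b : AlgV D ρV), b ∈ degPart D ρV j →
      e * g b = sgn ((-1 : ℤˣ) ^ j) • (g b * e))
    (h' : ∀ (j : ZMod 2) (b : AlgV D ρV), b ∈ degPart D ρV j →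
      e' * g b = sgn ((-1 : ℤˣ) ^ j) • (g b * e')) : DirAlg D ρV 2 →ₐ[ℝ] E :=
  dirLift g ((LinearMap.proj 0).smulRight e + (LinearMap.proj 1).smulRight e')
    (fun v => by
      simp only [LinearMap.add_apply, LinearMap.smulRight_apply, LinearMap.proj_apply, add_mul,
        mul_add, smul_mul_smul_comm, he, he', hee, Algebra.algebraMap_eq_smul_one,
        QuadraticMap.weightedSumSquares_apply, Fin.sum_univ_two]
      module)
    (fun v j b hb => by
      simp only [LinearMap.add_apply, LinearMap.smulRight_apply, add_mul, mul_add, smul_mul_assoc,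
        h j b hb, h' j b hb, mul_smul_comm]
      rw [smul_add, smul_comm, smul_comm (sgn _) (LinearMap.proj (R := ℝ) 1 v)])

theorem dirLift₁_massElt {E : Type*} [Ring E] [Algebra ℝ E] (g : AlgV D ρV →ₐ[ℝ] E) (e : E)
    (he : e * e = 1) (h : ∀ (j : ZMod 2) (b : AlgV D ρV), b ∈ degPart D ρV j →
      e * g b = sgn ((-1 : ℤˣ) ^ j) • (g b * e)) : dirLift₁ g e he h (massElt D ρV) = e := by
  rw [dirLift₁, massElt, dirLift_clGen]; simp

theorem dirLift₁_fromAlgV {E : Type*} [Ring E] [Algebra ℝ E] (g : AlgV D ρV →ₐ[ℝ] E) (e : E)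
    (he : e * e = 1) (h : ∀ (j : ZMod 2) (b : AlgV D ρV), b ∈ degPart D ρV j →
      e * g b = sgn ((-1 : ℤˣ) ^ j) • (g b * e)) (a : AlgV D ρV) :
    dirLift₁ g e he h (fromAlgV D ρV 1 a) = g a := by
  rw [dirLift₁, dirLift_fromAlgV]

theorem dirLift₂_clGen_zero {E : Type*} [Ring E] [Algebra ℝ E] (g : AlgV D ρV →ₐ[ℝ] E) (e e' : E)
    (he : e * e = 1) (he' : e' * e' = 1) (hee : e' * e = -(e * e'))
    (h : ∀ (j : ZMod 2) (b : AlgV D ρV), b ∈ degPart D ρV j →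
      e * g b = sgn ((-1 : ℤˣ) ^ j) • (g b * e))
    (h' : ∀ (j : ZMod 2) (b : AlgV D ρV), b ∈ degPart D ρV j →
      e' * g b = sgn ((-1 : ℤˣ) ^ j) • (g b * e')) :
    dirLift₂ g e e' he he' hee h h' (fromCl D ρV 2 (clGen 2 0)) = e := by
  rw [dirLift₂, dirLift_clGen]; simp

theorem dirLift₂_fromAlgV {E : Type*} [Ring E] [Algebra ℝ E] (g : AlgV D ρV →ₐ[ℝ] E) (e e' : E)
    (he : e * e = 1) (he' : e' * e' = 1) (hee : e' * e = -(e * e'))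
    (h : ∀ (j : ZMod 2) (b : AlgV D ρV), b ∈ degPart D ρV j →
      e * g b = sgn ((-1 : ℤˣ) ^ j) • (g b * e))
    (h' : ∀ (j : ZMod 2) (b : AlgV D ρV), b ∈ degPart D ρV j →
      e' * g b = sgn ((-1 : ℤˣ) ^ j) • (g b * e')) (a : AlgV D ρV) :
    dirLift₂ g e e' he he' hee h h' (fromAlgV D ρV 2 a) = g a := by
  rw [dirLift₂, dirLift_fromAlgV]

theorem massOp_mul_massOp (W : FDMod (DirAlg D ρV 1)) : massOp W * massOp W = 1 := by
  rw [massOp, ← map_mul, massElt_mul_massElt, map_one]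

theorem massOp_mul (W : FDMod (DirAlg D ρV 1)) {j : ZMod 2} {a : AlgV D ρV}
    (ha : a ∈ degPart D ρV j) : massOp W * W.ρ (fromAlgV D ρV 1 a) =
      sgn ((-1 : ℤˣ) ^ j) • (W.ρ (fromAlgV D ρV 1 a) * massOp W) := by
  rw [massOp, ← map_mul, massElt_mul D ρV ha, map_smul, map_mul]

/-- The action of the second Clifford generator on a module over `Cl^{0,2} ⊗̂ Aⱽ`. -/
def extraOp (Y : FDMod (DirAlg D ρV 2)) : Module.End ℝ Y.carrier :=
  Y.ρ (fromCl D ρV 2 (clGen 2 1))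

theorem extraOp_mul_extraOp (Y : FDMod (DirAlg D ρV 2)) : extraOp Y * extraOp Y = 1 := by
  have h : clGen 2 1 * clGen 2 1 = 1 := by
    rw [clGen, CliffordAlgebra.ι_sq_scalar]
    simp [QuadraticMap.weightedSumSquares_apply]
  rw [extraOp, ← map_mul, ← map_mul, h, map_one, map_one]

theorem extraOp_mul (Y : FDMod (DirAlg D ρV 2)) {j : ZMod 2} {a : AlgV D ρV}
    (ha : a ∈ degPart D ρV j) : extraOp Y * Y.ρ (fromAlgV D ρV 2 a) =
      sgn ((-1 : ℤˣ) ^ j) • (Y.ρ (fromAlgV D ρV 2 a) * extraOp Y) := by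
  have hc : clGen 2 1 ∈ CliffordAlgebra.evenOdd (posForm 2) 1 :=
    CliffordAlgebra.ι_mem_evenOdd_one _ _
  rw [extraOp, ← map_mul, fromCl_mul_fromAlgV D ρV 2 hc ha, mul_one]
  rcases zmod2_cases j with rfl | rfl <;> simp [sgn]

/-- The two basis vectors are orthogonal for `posForm 2`, so their Clifford generators anticommute.
This supplies the second axis of the rotations used later. -/
theorem extraOp_mul_massOp (Y : FDMod (DirAlg D ρV 2)) :
    extraOp Y * massOp (Y.res (dirIncl D ρV)) = -(massOp (Y.res (dirIncl D ρV)) * extraOp Y) := by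
  have h : clGen 2 1 * clGen 2 0 = -(clGen 2 0 * clGen 2 1) := by
    have := CliffordAlgebra.ι_mul_ι_add_swap (Q := posForm 2) (Pi.single 1 1) (Pi.single 0 1)
    rw [eq_neg_iff_add_eq_zero]
    refine this.trans ?_
    rw [QuadraticMap.polar]
    simp [QuadraticMap.weightedSumSquares_apply]
  change Y.ρ _ * Y.ρ (dirIncl D ρV (massElt D ρV)) = -(Y.ρ (dirIncl D ρV (massElt D ρV)) * Y.ρ _)
  rw [dirIncl_massElt, ← map_mul, ← map_mul, h, map_neg, map_neg, map_mul, map_mul]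

theorem neg_massOp_sq (W : FDMod (DirAlg D ρV 1)) : -massOp W * -massOp W = 1 := by
  rw [neg_mul_neg, massOp_mul_massOp]

theorem neg_massOp_mul (W : FDMod (DirAlg D ρV 1)) {j : ZMod 2} {a : AlgV D ρV}
    (ha : a ∈ degPart D ρV j) : -massOp W * W.ρ (fromAlgV D ρV 1 a) =
      sgn ((-1 : ℤˣ) ^ j) • (W.ρ (fromAlgV D ρV 1 a) * -massOp W) := by
  rw [neg_mul, mul_neg, smul_neg, massOp_mul W ha]

/-- The module with the opposite grading. -/
def opp (W : FDMod (DirAlg D ρV 1)) : FDMod (DirAlg D ρV 1) where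
  carrier := W.carrier
  ρ := dirLift₁ (W.ρ.comp (fromAlgV D ρV 1)) (-massOp W) (neg_massOp_sq W)
    fun _ _ hb => neg_massOp_mul W hb

theorem massOp_opp (W : FDMod (DirAlg D ρV 1)) :
    massOp (opp W) = (-massOp W : Module.End ℝ W.carrier) :=
  dirLift₁_massElt (W.ρ.comp (fromAlgV D ρV 1)) (-massOp W) (neg_massOp_sq W)
    fun _ _ hb => neg_massOp_mul W hb

theorem opp_fromAlgV (W : FDMod (DirAlg D ρV 1)) (a : AlgV D ρV) :
    (opp W).ρ (fromAlgV D ρV 1 a) = W.ρ (fromAlgV D ρV 1 a) :=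
  dirLift₁_fromAlgV (W.ρ.comp (fromAlgV D ρV 1)) (-massOp W) (neg_massOp_sq W)
    (fun _ _ hb => neg_massOp_mul W hb) a

/-- The operator exchanging the two copies of `W` in `W ⊕ W`, composed with the mass operator. -/
def swapOp (W : FDMod (DirAlg D ρV 1)) : Module.End ℝ (W.carrier × W.carrier) :=
  ((massOp W).comp (LinearMap.snd ℝ _ _)).prod ((massOp W).comp (LinearMap.fst ℝ _ _))

/-- The mass operator of the sum of `W` and its opposite. -/
def diffOp (W : FDMod (DirAlg D ρV 1)) : Module.End ℝ (W.carrier × W.carrier) :=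
  (massOp W).prodMap (-massOp W)

/-- The diagonal action of `Aⱽ` on `W ⊕ W`. -/
def diagRep (W : FDMod (DirAlg D ρV 1)) : AlgV D ρV →ₐ[ℝ] Module.End ℝ (W.carrier × W.carrier) :=
  (LinearMap.prodMapAlgHom ℝ W.carrier W.carrier).comp
    ((W.ρ.comp (fromAlgV D ρV 1)).prod (W.ρ.comp (fromAlgV D ρV 1)))

theorem swapOp_sq (W : FDMod (DirAlg D ρV 1)) : swapOp W * swapOp W = 1 :=
  LinearMap.ext fun p => Prod.ext (LinearMap.congr_fun (massOp_mul_massOp W) p.1)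
    (LinearMap.congr_fun (massOp_mul_massOp W) p.2)

theorem diffOp_sq (W : FDMod (DirAlg D ρV 1)) : diffOp W * diffOp W = 1 :=
  LinearMap.ext fun p => Prod.ext (LinearMap.congr_fun (massOp_mul_massOp W) p.1)
    (LinearMap.congr_fun (neg_massOp_sq W) p.2)

theorem swapOp_mul_diffOp (W : FDMod (DirAlg D ρV 1)) :
    swapOp W * diffOp W = -(diffOp W * swapOp W) :=
  LinearMap.ext fun p => Prod.ext (by simp [swapOp, diffOp]) (by simp [swapOp, diffOp])

theorem swapOp_mul (W : FDMod (DirAlg D ρV 1)) {j : ZMod 2} {a : AlgV D ρV}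
    (ha : a ∈ degPart D ρV j) :
    swapOp W * diagRep W a = sgn ((-1 : ℤˣ) ^ j) • (diagRep W a * swapOp W) :=
  LinearMap.ext fun p => Prod.ext (LinearMap.congr_fun (massOp_mul W ha) p.2)
    (LinearMap.congr_fun (massOp_mul W ha) p.1)

theorem diffOp_mul (W : FDMod (DirAlg D ρV 1)) {j : ZMod 2} {a : AlgV D ρV}
    (ha : a ∈ degPart D ρV j) :
    diffOp W * diagRep W a = sgn ((-1 : ℤˣ) ^ j) • (diagRep W a * diffOp W) :=
  LinearMap.ext fun p => Prod.ext (LinearMap.congr_fun (massOp_mul W ha) p.1)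
    (LinearMap.congr_fun (neg_massOp_mul W ha) p.2)

/-- A module over `Cl^{0,2} ⊗̂ Aⱽ` which extends the sum of a module and its opposite. -/
def double (W : FDMod (DirAlg D ρV 1)) : FDMod (DirAlg D ρV 2) where
  carrier := W.carrier × W.carrier
  ρ := dirLift₂ (diagRep W) (diffOp W) (swapOp W) (diffOp_sq W) (swapOp_sq W)
    (swapOp_mul_diffOp W) (fun _ _ hb => diffOp_mul W hb) fun _ _ hb => swapOp_mul W hb

theorem double_massOp (W : FDMod (DirAlg D ρV 1)) :
    (double W).ρ (fromCl D ρV 2 (clGen 2 0)) = diffOp W :=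
  dirLift₂_clGen_zero (diagRep W) (diffOp W) (swapOp W) (diffOp_sq W) (swapOp_sq W)
    (swapOp_mul_diffOp W) (fun _ _ hb => diffOp_mul W hb) fun _ _ hb => swapOp_mul W hb

theorem double_fromAlgV (W : FDMod (DirAlg D ρV 1)) (a : AlgV D ρV) :
    (double W).ρ (fromAlgV D ρV 2 a) = diagRep W a :=
  dirLift₂_fromAlgV (diagRep W) (diffOp W) (swapOp W) (diffOp_sq W) (swapOp_sq W)
    (swapOp_mul_diffOp W) (fun _ _ hb => diffOp_mul W hb) (fun _ _ hb => swapOp_mul W hb) a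

/-- Both sides have the same underlying space and the same action of the generators, since the first
Clifford generator acts on `double W` by `diffOp W`. Consequently the opposite module represents the
negative class in the cokernel. -/
theorem double_iso (W : FDMod (DirAlg D ρV 1)) :
    (W.sum (opp W)).Iso ((double W).res (dirIncl D ρV)) := by
  refine ⟨LinearEquiv.refl ℝ _, fun b w => ?_⟩
  have : (W.sum (opp W)).ρ = ((double W).res (dirIncl D ρV)).ρ := by
    apply dirAlg_hom_ext
    · change _ = (double W).ρ (dirIncl D ρV (massElt D ρV))
      rw [dirIncl_massElt, double_massOp, FDMod.sum_ρ]
      exact congrArg (LinearMap.prodMap _) (massOp_opp W)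
    · intro a
      change _ = (double W).ρ (dirIncl D ρV (fromAlgV D ρV 1 a))
      rw [dirIncl_fromAlgV, double_fromAlgV, FDMod.sum_ρ, opp_fromAlgV]
      rfl
  exact LinearMap.congr_fun (DFunLike.congr_fun this b) w

end DirAlg

end

end FreeFermion

/-! ### The cokernel as stable isomorphism classes of modules. -/

namespace FreeFermion

noncomputable section

namespace FDMod

variable {B : Type*} [Ring B] [Algebra ℝ B] {W W' W'' X X' : FDMod B}

theorem Iso.refl (W : FDMod B) : W.Iso W := ⟨LinearEquiv.refl ℝ _, fun _ _ => rfl⟩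

theorem Iso.symm (h : W.Iso W') : W'.Iso W := by
  obtain ⟨e, he⟩ := h
  refine ⟨e.symm, fun b w => ?_⟩
  rw [LinearEquiv.symm_apply_eq, he, LinearEquiv.apply_symm_apply]

theorem Iso.trans (h : W.Iso W') (h' : W'.Iso W'') : W.Iso W'' := by
  obtain ⟨e, he⟩ := h
  obtain ⟨e', he'⟩ := h'
  exact ⟨e.trans e', fun b w => by simp only [LinearEquiv.trans_apply, he, he']⟩

theorem Iso.sum (h : W.Iso W') (h' : X.Iso X') : (W.sum X).Iso (W'.sum X') := by
  obtain ⟨e, he⟩ := h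
  obtain ⟨e', he'⟩ := h'
  exact ⟨e.prodCongr e', fun b w => Prod.ext (he b w.1) (he' b w.2)⟩

theorem sum_comm_iso (W W' : FDMod B) : (W.sum W').Iso (W'.sum W) :=
  ⟨LinearEquiv.prodComm ℝ _ _, fun _ _ => rfl⟩

theorem sum_assoc_iso (W W' W'' : FDMod B) : ((W.sum W').sum W'').Iso (W.sum (W'.sum W'')) :=
  ⟨LinearEquiv.prodAssoc ℝ _ _ _, fun _ _ => rfl⟩

theorem sum_sum_comm_iso (W W' X X' : FDMod B) :
    ((W.sum W').sum (X.sum X')).Iso ((W.sum X).sum (W'.sum X')) :=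
  ⟨LinearEquiv.prodProdProdComm ℝ _ _ _ _, fun _ _ => rfl⟩

/-- The zero module. -/
def zero (B : Type*) [Ring B] [Algebra ℝ B] : FDMod B where
  carrier := PUnit
  ρ := AlgHom.ofLinearMap 0 (Subsingleton.elim _ _) fun _ _ => Subsingleton.elim _ _

theorem sum_iso_of_subsingleton (W X : FDMod B) [Subsingleton X.carrier] : (X.sum W).Iso W :=
  ⟨{ toFun := fun p => p.2
     invFun := fun w => (0, w)
     map_add' := fun _ _ => rfl
     map_smul' := fun _ _ => rfl
     left_inv := fun _ => Prod.ext (Subsingleton.elim _ _) rfl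
     right_inv := fun _ => rfl }, fun _ _ => rfl⟩

theorem zero_sum_iso (W : FDMod B) : ((zero B).sum W).Iso W :=
  haveI : Subsingleton (zero B).carrier := inferInstanceAs (Subsingleton PUnit)
  sum_iso_of_subsingleton W (zero B)

end FDMod

variable {G : Type*} [Group G] {D : SymData G}
variable {V : Type*} [NormedAddCommGroup V] [InnerProductSpace ℝ V] {ρV : G →* (V ≃ₗᵢ[ℝ] V)}

/-- Stable isomorphism: isomorphism after addition of modules which extend to
`Cl^{0,2} ⊗̂ Aⱽ`. -/
def StabIso (W W' : FDMod (DirAlg D ρV 1)) : Prop :=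
  ∃ Y Y' : FDMod (DirAlg D ρV 2),
    (W.sum (Y.res (dirIncl D ρV))).Iso (W'.sum (Y'.res (dirIncl D ρV)))

namespace StabIso

open FDMod

variable {W W' W'' X X' : FDMod (DirAlg D ρV 1)}

theorem of_iso (h : W.Iso W') : StabIso W W' := ⟨zero _, zero _, h.sum (Iso.refl _)⟩

theorem symm (h : StabIso W W') : StabIso W' W := by
  obtain ⟨Y, Y', h⟩ := h
  exact ⟨Y', Y, h.symm⟩

/-- The first isomorphism is stabilized further by `Z` and the second by `Y'`; they then meet in `W'
⊕ Y' ⊕ Z`. -/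
theorem trans (h : StabIso W W') (h' : StabIso W' W'') : StabIso W W'' := by
  obtain ⟨Y, Y', h⟩ := h
  obtain ⟨Z, Z', h'⟩ := h'
  refine ⟨Y.sum Z, Y'.sum Z', ?_⟩
  have h1 := (sum_assoc_iso W (Y.res (dirIncl D ρV)) (Z.res (dirIncl D ρV))).symm
  have h2 := h.sum (Iso.refl (Z.res (dirIncl D ρV)))
  have h3 := sum_assoc_iso W' (Y'.res (dirIncl D ρV)) (Z.res (dirIncl D ρV))
  have h4 := (Iso.refl W').sum (sum_comm_iso (Y'.res (dirIncl D ρV)) (Z.res (dirIncl D ρV)))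
  have h5 := (sum_assoc_iso W' (Z.res (dirIncl D ρV)) (Y'.res (dirIncl D ρV))).symm
  have h6 := h'.sum (Iso.refl (Y'.res (dirIncl D ρV)))
  have h7 := sum_assoc_iso W'' (Z'.res (dirIncl D ρV)) (Y'.res (dirIncl D ρV))
  have h8 := (Iso.refl W'').sum (sum_comm_iso (Z'.res (dirIncl D ρV)) (Y'.res (dirIncl D ρV)))
  exact h1.trans <| h2.trans <| h3.trans <| h4.trans <| h5.trans <| h6.trans <| h7.trans h8

theorem sum (h : StabIso W W') (h' : StabIso X X') : StabIso (W.sum X) (W'.sum X') := by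
  obtain ⟨Y, Y', h⟩ := h
  obtain ⟨Z, Z', h'⟩ := h'
  refine ⟨Y.sum Z, Y'.sum Z', ?_⟩
  exact (sum_sum_comm_iso W X (Y.res (dirIncl D ρV)) (Z.res (dirIncl D ρV))).trans
    ((h.sum h').trans
      (sum_sum_comm_iso W' (Y'.res (dirIncl D ρV)) X' (Z'.res (dirIncl D ρV))))

theorem sum_res (W : FDMod (DirAlg D ρV 1)) (Y : FDMod (DirAlg D ρV 2)) :
    StabIso (W.sum (Y.res (dirIncl D ρV))) W :=
  ⟨zero _, Y, (sum_comm_iso _ _).trans <| by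
    have : Subsingleton ((zero (DirAlg D ρV 2)).res (dirIncl D ρV)).carrier :=
      inferInstanceAs (Subsingleton PUnit)
    exact sum_iso_of_subsingleton _ _⟩

end StabIso

variable (D ρV) in
/-- Stable isomorphism as a setoid. -/
def stabSetoid : Setoid (FDMod (DirAlg D ρV 1)) where
  r := StabIso
  iseqv := ⟨fun W => .of_iso (.refl W), StabIso.symm, StabIso.trans⟩

variable (D ρV) in
/-- Stable isomorphism classes of modules over `Cl^{0,1} ⊗̂ Aⱽ`. -/
def StabClass : Type _ := Quotient (stabSetoid D ρV)

namespace StabClass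

open FDMod

/-- The class of a module. -/
def mk (W : FDMod (DirAlg D ρV 1)) : StabClass D ρV := Quotient.mk (stabSetoid D ρV) W

theorem mk_eq_iff {W W' : FDMod (DirAlg D ρV 1)} : mk W = mk W' ↔ StabIso W W' :=
  Quotient.eq (r := stabSetoid D ρV)

theorem mk_eq_of_iso {W W' : FDMod (DirAlg D ρV 1)} (h : W.Iso W') : mk W = mk W' :=
  mk_eq_iff.2 (.of_iso h)

instance : Add (StabClass D ρV) :=
  ⟨Quotient.map₂ FDMod.sum fun _ _ h _ _ h' => StabIso.sum h h'⟩

theorem mk_sum (W W' : FDMod (DirAlg D ρV 1)) : mk (W.sum W') = mk W + mk W' := rfl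

instance : Zero (StabClass D ρV) := ⟨mk (zero _)⟩

/-- Choosing a representative avoids checking that `opp` respects stable isomorphism; the group
axioms only require a left inverse. -/
instance : Neg (StabClass D ρV) := ⟨fun q => mk (opp (Quotient.out q))⟩

/-- A restricted module may be added to the zero module without changing its stable class. -/
theorem mk_res (Y : FDMod (DirAlg D ρV 2)) : mk (Y.res (dirIncl D ρV)) = 0 :=
  mk_eq_iff.2 ((StabIso.of_iso (zero_sum_iso _).symm).trans (StabIso.sum_res _ Y))

instance : AddCommGroup (StabClass D ρV) :=
  { AddGroup.ofLeftAxioms (G := StabClass D ρV)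
      (by
        rintro ⟨W⟩ ⟨W'⟩ ⟨W''⟩
        exact mk_eq_of_iso (sum_assoc_iso W W' W''))
      (by
        rintro ⟨W⟩
        exact mk_eq_of_iso (zero_sum_iso W))
      (by
        intro q
        have h : mk (opp (Quotient.out q)) + mk (Quotient.out q) = 0 := by
          rw [← mk_sum, mk_eq_of_iso (sum_comm_iso _ _), mk_eq_of_iso (double_iso _), mk_res]
        have h2 : mk (Quotient.out q) = q := Quotient.out_eq q
        rw [h2] at h
        exact h) with
    add_comm := by
      rintro ⟨W⟩ ⟨W'⟩
      exact mk_eq_of_iso (sum_comm_iso W W') }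

/-- The homomorphism from the Grothendieck group to the group of stable isomorphism classes. -/
def ofGroth : Groth (DirAlg D ρV 1) →+ StabClass D ρV :=
  QuotientAddGroup.lift _ (FreeAbelianGroup.lift mk) <| by
    rw [grothRel, AddSubgroup.closure_le]
    rintro x (⟨W, W', rfl⟩ | ⟨W, W', h, rfl⟩)
    · change FreeAbelianGroup.lift mk _ = 0
      simp [mk_sum]
    · change FreeAbelianGroup.lift mk _ = 0
      simp [mk_eq_of_iso h]

theorem ofGroth_res (x : Groth (DirAlg D ρV 2)) : ofGroth (Groth.res (dirIncl D ρV) x) = 0 := by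
  obtain ⟨y, rfl⟩ := QuotientAddGroup.mk_surjective x
  change FreeAbelianGroup.lift mk (FreeAbelianGroup.map (FDMod.res (dirIncl D ρV)) y) = 0
  induction y using FreeAbelianGroup.induction_on with
  | zero => simp
  | of Y => simp [mk_res]
  | neg Y h => rw [map_neg, map_neg, h, neg_zero]
  | add y z hy hz => rw [map_add, map_add, hy, hz, add_zero]

end StabClass

namespace AlgClass

open FDMod

/-- Taking stable classes is additive and kills restrictions, so it descends to the cokernel and can
be applied to the given equality. -/
theorem stabIso_of_mk_eq {W W' : FDMod (DirAlg D ρV 1)}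
    (h : AlgClass.mk D ρV W = AlgClass.mk D ρV W') : StabIso W W' := by
  let f : AlgClass D ρV →+ StabClass D ρV := QuotientAddGroup.lift _ StabClass.ofGroth <| by
    rintro _ ⟨x, rfl⟩
    exact StabClass.ofGroth_res x
  have hf : ∀ W, f (AlgClass.mk D ρV W) = StabClass.mk W := fun W =>
    (FreeAbelianGroup.lift_apply_of (StabClass.mk : _ → StabClass D ρV) W :)
  have := congrArg f h
  rw [hf, hf] at this
  exact StabClass.mk_eq_iff.1 this

theorem mk_sum (W W' : FDMod (DirAlg D ρV 1)) :
    AlgClass.mk D ρV (W.sum W') = AlgClass.mk D ρV W + AlgClass.mk D ρV W' := by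
  rw [← sub_eq_zero]
  have : (QuotientAddGroup.mk (FreeAbelianGroup.of (W.sum W') -
      (FreeAbelianGroup.of W + FreeAbelianGroup.of W')) : Groth (DirAlg D ρV 1)) = 0 :=
    (QuotientAddGroup.eq_zero_iff _).2 (AddSubgroup.subset_closure (Or.inl ⟨W, W', rfl⟩))
  exact congrArg (QuotientAddGroup.mk : Groth (DirAlg D ρV 1) → AlgClass D ρV) this

theorem mk_eq_of_iso {W W' : FDMod (DirAlg D ρV 1)} (h : W.Iso W') :
    AlgClass.mk D ρV W = AlgClass.mk D ρV W' := by
  rw [← sub_eq_zero]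
  have : (QuotientAddGroup.mk (FreeAbelianGroup.of W - FreeAbelianGroup.of W') :
      Groth (DirAlg D ρV 1)) = 0 :=
    (QuotientAddGroup.eq_zero_iff _).2 (AddSubgroup.subset_closure (Or.inr ⟨W, W', h, rfl⟩))
  exact congrArg (QuotientAddGroup.mk : Groth (DirAlg D ρV 1) → AlgClass D ρV) this

theorem mk_res (Y : FDMod (DirAlg D ρV 2)) :
    AlgClass.mk D ρV (Y.res (dirIncl D ρV)) = 0 :=
  (QuotientAddGroup.eq_zero_iff _).2 ⟨QuotientAddGroup.mk (FreeAbelianGroup.of Y),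
    congrArg QuotientAddGroup.mk (FreeAbelianGroup.map_of_apply _)⟩

theorem mk_zero : AlgClass.mk D ρV (zero _) = 0 := by
  have h := mk_eq_of_iso (zero_sum_iso (zero (DirAlg D ρV 1)))
  rwa [mk_sum, add_eq_left] at h

theorem mk_opp (W : FDMod (DirAlg D ρV 1)) :
    AlgClass.mk D ρV (opp W) = -AlgClass.mk D ρV W := by
  rw [eq_neg_iff_add_eq_zero, add_comm, ← mk_sum, mk_eq_of_iso (double_iso W), mk_res]

/-- Formal negatives are realized by opposite modules and sums by direct sums, so no formal
differences are needed. Uniqueness of `L` and `Φ` rests on this. -/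
theorem mk_surjective : Function.Surjective (AlgClass.mk D ρV) := by
  intro x
  obtain ⟨y, rfl⟩ := QuotientAddGroup.mk_surjective x
  obtain ⟨z, rfl⟩ := QuotientAddGroup.mk_surjective y
  induction z using FreeAbelianGroup.induction_on with
  | zero => exact ⟨_, mk_zero⟩
  | of W => exact ⟨W, rfl⟩
  | neg W _ => exact ⟨opp W, mk_opp W⟩
  | add y z hy hz =>
    obtain ⟨W, hW⟩ := hy
    obtain ⟨W', hW'⟩ := hz
    refine ⟨W.sum W', ?_⟩
    rw [mk_sum, hW, hW']
    rfl

/-- An isomorphism invariant of modules which does not change on addition of a module that extends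
to `Cl^{0,2} ⊗̂ Aⱽ` depends only on the class in the algebraic classification. -/
theorem eq_of_mk_eq {α : Sort*} (f : FDMod (DirAlg D ρV 1) → α)
    (h₁ : ∀ W W', W.Iso W' → f W = f W')
    (h₂ : ∀ W (Y : FDMod (DirAlg D ρV 2)), f (W.sum (Y.res (dirIncl D ρV))) = f W)
    {W W' : FDMod (DirAlg D ρV 1)} (h : AlgClass.mk D ρV W = AlgClass.mk D ρV W') :
    f W = f W' := by
  obtain ⟨Y, Y', h⟩ := stabIso_of_mk_eq h
  rw [← h₂ W Y, h₁ _ _ h, h₂]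

end AlgClass

end

end FreeFermion

/-! ### Maschke's theorem by successive averaging. -/

namespace FreeFermion

noncomputable section

section Averaging

variable {B X Y : Type*} [Ring B] [Algebra ℝ B] [AddCommGroup X] [Module ℝ X] [AddCommGroup Y]
  [Module ℝ Y] (ρ : B →ₐ[ℝ] Module.End ℝ X) (ρ' : B →ₐ[ℝ] Module.End ℝ Y)

/-- The linear map `f` commutes with the action of `b`. -/
def Intertwines (f : X →ₗ[ℝ] Y) (b : B) : Prop := ∀ x, f (ρ b x) = ρ' b (f x)

variable {ρ ρ'} {j : Y →ₗ[ℝ] X}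

/-- The elements with which a linear map commutes, as a subalgebra. -/
def intertwined (ρ : B →ₐ[ℝ] Module.End ℝ X) (ρ' : B →ₐ[ℝ] Module.End ℝ Y) (f : X →ₗ[ℝ] Y) :
    Subalgebra ℝ B where
  carrier := {b | Intertwines ρ ρ' f b}
  mul_mem' {a b} ha hb x := by
    rw [map_mul, map_mul, Module.End.mul_apply, ha, hb, Module.End.mul_apply]
  add_mem' {a b} ha hb x := by
    rw [map_add, map_add, LinearMap.add_apply, map_add, ha, hb, LinearMap.add_apply]
  algebraMap_mem' r x := by
    rw [AlgHom.commutes, AlgHom.commutes, Module.algebraMap_end_apply,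
      Module.algebraMap_end_apply, map_smul]

/-- Averaging a retraction over an element of square `±1`. -/
theorem exists_average_involution (hj : ∀ b y, j (ρ' b y) = ρ b (j y)) {b : B} {ε : ℝ}
    (hε : ε * ε = 1) (hb : b * b = algebraMap ℝ B ε) {f : X →ₗ[ℝ] Y} (hf : ∀ y, f (j y) = y)
    (S : Set B) (hS : ∀ s ∈ S, Intertwines ρ ρ' f s)
    (hc : ∀ s ∈ S, ∃ δ : ℝ, δ * δ = 1 ∧ b * s = δ • (s * b)) :
    ∃ f' : X →ₗ[ℝ] Y, (∀ y, f' (j y) = y) ∧ Intertwines ρ ρ' f' b ∧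
      ∀ s ∈ S, Intertwines ρ ρ' f' s := by
  have hb1 : ∀ x, ρ b (ρ b x) = ε • x := fun x => by
    rw [← Module.End.mul_apply, ← map_mul, hb, AlgHom.commutes, Module.algebraMap_end_apply]
  have hb2 : ∀ x, ρ' b (ρ' b x) = ε • x := fun x => by
    rw [← Module.End.mul_apply, ← map_mul, hb, AlgHom.commutes, Module.algebraMap_end_apply]
  -- Since `b⁻¹ = ε b`, this is the mean of `f` and `b⁻¹ f b`. The element `s` commutes with `b` up
  -- to `δ`, and conjugation produces `δ` twice, so earlier equivariance survives.
  refine ⟨(1 / 2 : ℝ) • (f + ε • (ρ' b ∘ₗ f ∘ₗ ρ b)), fun y => ?_, fun x => ?_, fun s hs x => ?_⟩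
  · simp only [LinearMap.smul_apply, LinearMap.add_apply, LinearMap.comp_apply, hf, ← hj, hb2,
      smul_smul, hε, one_smul]
    module
  · simp only [LinearMap.smul_apply, LinearMap.add_apply, LinearMap.comp_apply, hb1, map_smul,
      map_add, hb2, smul_smul, hε, one_smul]
    rw [add_comm]
  · obtain ⟨δ, hδ, h⟩ := hc s hs
    have h1 : ρ b (ρ s x) = δ • ρ s (ρ b x) := by
      rw [← Module.End.mul_apply, ← map_mul, h, map_smul, map_mul]; rfl
    have h2 : ∀ y, ρ' b (ρ' s y) = δ • ρ' s (ρ' b y) := fun y => by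
      rw [← Module.End.mul_apply, ← map_mul, h, map_smul, map_mul]; rfl
    simp only [LinearMap.smul_apply, LinearMap.add_apply, LinearMap.comp_apply, h1, map_smul,
      map_add, hS s hs _, h2, smul_smul, hδ, mul_one]

/-- Averaging a retraction over a finite group of units of the algebra, up to scalars which commute
with the retraction. -/
theorem exists_average_group {G : Type*} [Group G] [Fintype G] (u : G → Bˣ) (c : G → G → B)
    (hu : ∀ g h, (u g * u h : B) = c g h * u (g * h))
    (hj : ∀ b y, j (ρ' b y) = ρ b (j y)) {f : X →ₗ[ℝ] Y} (hf : ∀ y, f (j y) = y)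
    (hfc : ∀ g h, Intertwines ρ ρ' f (c g h)) :
    ∃ f' : X →ₗ[ℝ] Y, (∀ y, f' (j y) = y) ∧ (∀ g, Intertwines ρ ρ' f' (u g)) ∧
      ∀ s, (∀ g, ∃ s', (u g * s : B) = s' * u g ∧ Intertwines ρ ρ' f s') →
        Intertwines ρ ρ' f' s := by
  have key : ∀ (b b' : B) x, ρ' b (ρ' b' x) = ρ' (b * b') x := fun b b' x => by
    rw [map_mul, Module.End.mul_apply]
  have key' : ∀ (b b' : B) x, ρ b (ρ b' x) = ρ (b * b') x := fun b b' x => by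
    rw [map_mul, Module.End.mul_apply]
  -- The mean of the conjugates `u(g)⁻¹ f u(g)`.
  refine ⟨(Fintype.card G : ℝ)⁻¹ • ∑ g, ρ' ((u g)⁻¹ : Bˣ) ∘ₗ f ∘ₗ ρ (u g), fun y => ?_,
    fun h x => ?_, fun s hs x => ?_⟩
  · simp only [LinearMap.smul_apply, LinearMap.sum_apply, LinearMap.comp_apply, ← hj, hf, key,
      Units.inv_mul, map_one, Module.End.one_apply, Finset.sum_const, Finset.card_univ]
    rw [← Nat.cast_smul_eq_nsmul ℝ, smul_smul, inv_mul_cancel₀, one_smul]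
    exact Nat.cast_ne_zero.2 Fintype.card_ne_zero
  · simp only [LinearMap.smul_apply, LinearMap.sum_apply, LinearMap.comp_apply, map_smul, map_sum]
    congr 1
    -- Reindexing by `g ↦ g h` replaces `u(g) u(h)` by `c(g,h) u(g h)`; the cocycle factor passes
    -- through `f` and cancels.
    refine Fintype.sum_equiv (Equiv.mulRight h) _ _ fun g => ?_
    rw [Equiv.coe_mulRight, key', hu, ← key', hfc, key, key]
    congr 2
    rw [Units.inv_mul_eq_iff_eq_mul, ← mul_assoc, Units.eq_mul_inv_iff_mul_eq, hu]
  · simp only [LinearMap.smul_apply, LinearMap.sum_apply, LinearMap.comp_apply, map_smul, map_sum]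
    congr 1
    refine Finset.sum_congr rfl fun g _ => ?_
    obtain ⟨s', h1, h2⟩ := hs g
    rw [key', h1, ← key', h2, key, key]
    congr 2
    rw [Units.inv_mul_eq_iff_eq_mul, ← mul_assoc, Units.eq_mul_inv_iff_mul_eq, h1]

end Averaging

section Units

variable {G : Type*} [Group G] (D : SymData G)

theorem SymData.scalar_mul (z w : ℂ) : D.scalar z * D.scalar w = D.scalar (z * w) := by
  simp only [SymData.scalar, mul_add, add_mul, Algebra.algebraMap_eq_smul_one, smul_mul_smul_comm,
    D.I_mul_I, mul_one, one_mul, Complex.mul_re, Complex.mul_im]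
  module

theorem SymData.scalar_one : D.scalar 1 = 1 := by simp [SymData.scalar]

theorem SymData.isUnit_scalar {z : ℂ} (hz : z ≠ 0) : IsUnit (D.scalar z) :=
  isUnit_iff_exists.2 ⟨D.scalar z⁻¹,
    (by rw [D.scalar_mul, mul_inv_cancel₀ hz, D.scalar_one]),
    (by rw [D.scalar_mul, inv_mul_cancel₀ hz, D.scalar_one])⟩

/-- The product of the elements of `g` and `g⁻¹`, in either order, is a product of two phases `ω`,
hence a unit. This gives a right and a left inverse, which then coincide; no normalization of the
cocycle is needed. -/
theorem SymData.isUnit_elt (g : G) : IsUnit (D.elt g) := by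
  have h : ∀ g, IsUnit (D.elt g * D.elt g⁻¹) := fun g => by
    rw [D.elt_mul, mul_inv_cancel, D.elt_one]
    exact (D.isUnit_scalar (Circle.coe_ne_zero _)).mul (D.isUnit_scalar (Circle.coe_ne_zero _))
  obtain ⟨a, ha⟩ := h g
  have h' := h g⁻¹
  rw [inv_inv] at h'
  obtain ⟨b, hb⟩ := h'
  have h1 : D.elt g * (D.elt g⁻¹ * ↑a⁻¹) = 1 := by
    rw [← mul_assoc, ← ha, Units.mul_inv]
  have h2 : (↑b⁻¹ * D.elt g⁻¹) * D.elt g = 1 := by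
    rw [mul_assoc, ← hb, Units.inv_mul]
  refine isUnit_iff_exists.2 ⟨_, h1, ?_⟩
  rwa [← left_inv_eq_right_inv h2 h1]

end Units

section Maschke

variable {G : Type*} [Group G] {D : SymData G}
variable {V : Type*} [NormedAddCommGroup V] [InnerProductSpace ℝ V] {ρV : G →* (V ≃ₗᵢ[ℝ] V)}

/-- Polarization of the Clifford relation for `v + w`. -/
theorem algVec_mul_algVec_of_inner_eq_zero {v w : V} (h : inner ℝ v w = 0) :
    algVec D ρV v * algVec D ρV w = (-1 : ℝ) • (algVec D ρV w * algVec D ρV v) := by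
  have h1 := algVec_sq D ρV (v + w)
  rw [algVec_add, add_mul, mul_add, mul_add, algVec_sq, algVec_sq, norm_add_sq_real, h, mul_zero,
    add_zero, map_add] at h1
  rw [neg_smul, one_smul, eq_neg_iff_add_eq_zero]
  have h2 := sub_eq_zero.2 h1
  rw [← h2]; abel

/-- Maschke's theorem for `Cl^{0,1} ⊗̂ Aⱽ`: equivariant embeddings have equivariant retractions. -/
theorem exists_retraction [Finite G] [FiniteDimensional ℝ V] {X Y : Type*} [AddCommGroup X]
    [Module ℝ X] [AddCommGroup Y] [Module ℝ Y] {ρ : DirAlg D ρV 1 →ₐ[ℝ] Module.End ℝ X}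
    {ρ' : DirAlg D ρV 1 →ₐ[ℝ] Module.End ℝ Y} (j : Y →ₗ[ℝ] X) (hinj : Function.Injective j)
    (hj : ∀ b y, j (ρ' b y) = ρ b (j y)) :
    ∃ r : X →ₗ[ℝ] Y, (∀ y, r (j y) = y) ∧ ∀ b x, r (ρ b x) = ρ' b (r x) := by
  have := Fintype.ofFinite G
  let φ := fromAlgV D ρV 1
  let e := massElt D ρV
  let I := φ (algIncl D ρV D.I)
  let E : G → DirAlg D ρV 1 := fun g => φ (algIncl D ρV (D.elt g))
  let v : V → DirAlg D ρV 1 := fun w => φ (algVec D ρV w)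
  have hII : I * I = algebraMap ℝ _ (-1) := by
    simp only [I, ← map_mul, D.I_mul_I, map_neg, map_one]
  have hee : e * e = algebraMap ℝ _ 1 := by rw [map_one]; exact massElt_mul_massElt D ρV
  have heI : e * I = (1 : ℝ) • (I * e) := by
    have := massElt_mul D ρV (GrMod.I_mem (D := D) (ρV := ρV))
    rw [uzpow_zero] at this
    simpa [sgn] using this
  have hev : ∀ w, e * v w = (-1 : ℝ) • (v w * e) := fun w => by
    have := massElt_mul D ρV (GrMod.algVec_mem (D := D) (ρV := ρV) w)
    simpa [sgn] using this
  have heE : ∀ g, e * E g = sgn (D.h g) • (E g * e) := fun g => by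
    obtain ⟨k, hk⟩ := GrMod.exists_deg (D.h g)
    rw [← hk]
    exact massElt_mul D ρV (GrMod.elt_mem g hk)
  have hIv : ∀ w, v w * I = (1 : ℝ) • (I * v w) := fun w => by
    simp only [v, I, ← map_mul, I_algVec, one_smul]
  -- A merely linear retraction is averaged over `I`, then `e`, then an orthonormal basis of `V`,
  -- and finally `G`. Each new element commutes up to sign with the earlier ones, or permutes their
  -- span by conjugation, so nothing gained is lost.
  obtain ⟨f₀, hf₀⟩ := LinearMap.exists_leftInverse_of_injective j (LinearMap.ker_eq_bot.2 hinj)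
  obtain ⟨f₁, hf₁, hf₁I, -⟩ := exists_average_involution hj (b := I) (ε := -1) (by norm_num) hII
    (LinearMap.congr_fun hf₀) ∅ (by simp) (by simp)
  obtain ⟨f₂, hf₂, hf₂e, hf₂I⟩ := exists_average_involution hj (b := e) (ε := 1) (by norm_num) hee
    hf₁ {I} (by simpa using hf₁I) (by
      rintro _ rfl
      exact ⟨1, by norm_num, heI⟩)
  let o := stdOrthonormalBasis ℝ V
  -- Orthonormality is used twice: the basis vectors square to `1` and anticommute with each other,
  -- as averaging over involutions requires.
  have hV : ∀ s : Finset (Fin (Module.finrank ℝ V)), ∃ f : X →ₗ[ℝ] Y, (∀ y, f (j y) = y) ∧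
      ∀ b ∈ ({I, e} : Set (DirAlg D ρV 1)) ∪ (fun i => v (o i)) '' s, Intertwines ρ ρ' f b := by
    intro s
    induction s using Finset.induction_on with
    | empty =>
      refine ⟨f₂, hf₂, ?_⟩
      rintro b ((rfl | rfl) | h)
      · exact hf₂I _ rfl
      · exact hf₂e
      · simp at h
    | insert i s hi ih =>
      obtain ⟨f, hf, hfs⟩ := ih
      obtain ⟨f', h1, h2, h3⟩ := exists_average_involution hj (b := v (o i)) (ε := 1) (by norm_num)
        (by
          simp only [v, ← map_mul, algVec_sq, AlgHom.commutes]
          simp) hf _ hfs (by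
          rintro b ((rfl | rfl) | ⟨k, hk, rfl⟩)
          · exact ⟨1, by norm_num, hIv _⟩
          · refine ⟨-1, by norm_num, ?_⟩
            rw [hev, smul_smul]; norm_num
          · refine ⟨-1, by norm_num, ?_⟩
            have hik : i ≠ k := fun h => hi (by rw [h]; exact hk)
            simp only [v, ← map_mul]
            rw [algVec_mul_algVec_of_inner_eq_zero (o.inner_eq_zero hik), map_smul])
      refine ⟨f', h1, ?_⟩
      rintro b (h | ⟨k, hk, rfl⟩)
      · exact h3 b (Or.inl h)
      · rcases Finset.mem_insert.1 hk with rfl | hk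
        · exact h2
        · exact h3 _ (Or.inr ⟨k, hk, rfl⟩)
  obtain ⟨f, hf, hfs⟩ := hV Finset.univ
  have hfI : Intertwines ρ ρ' f I := hfs _ (Or.inl (Or.inl rfl))
  have hfe : Intertwines ρ ρ' f e := hfs _ (Or.inl (Or.inr rfl))
  have hfv : ∀ w, v w ∈ intertwined ρ ρ' f := fun w => by
    have hw : v w = ∑ i, inner ℝ (o i) w • v (o i) := by
      conv_lhs => rw [← o.sum_repr' w]
      let L : V →ₗ[ℝ] DirAlg D ρV 1 :=
        { toFun := v
          map_add' := fun a b => by simp only [v, algVec_add, map_add]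
          map_smul' := fun c a => by simp only [v, algVec_smul, map_smul, RingHom.id_apply] }
      change L _ = ∑ i, _ • L (o i)
      rw [map_sum]
      simp only [map_smul]
    rw [hw]
    refine Subalgebra.sum_mem _ fun i _ => Subalgebra.smul_mem _ ?_ _
    exact hfs _ (Or.inr ⟨i, Finset.mem_coe.2 (Finset.mem_univ i), rfl⟩)
  have hfz : ∀ z, φ (algIncl D ρV (D.scalar z)) ∈ intertwined ρ ρ' f := fun z => by
    simp only [SymData.scalar, map_add, map_smul, AlgHom.commutes]
    exact add_mem (Subalgebra.algebraMap_mem _ _) (Subalgebra.smul_mem _ hfI _)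
  let u : G → (DirAlg D ρV 1)ˣ := fun g =>
    Units.map ((φ.comp (algIncl D ρV) : D.Alg →ₐ[ℝ] _) : D.Alg →* _) (D.isUnit_elt g).unit
  have hu : ∀ g, (u g : DirAlg D ρV 1) = E g := fun g => rfl
  obtain ⟨r, hr, hru, hrs⟩ := exists_average_group u
    (fun g h => φ (algIncl D ρV (D.scalar (D.ω g h))))
    (fun g h => by simp only [hu, E, ← map_mul, D.elt_mul]) hj hf fun g h => hfz _
  -- Conjugation by `g` sends `e` and `I` to themselves up to sign and the vector `w` to `± ρV g w`;
  -- all of these already commute with `f`.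
  refine ⟨r, hr, dirAlg_map_of_gen r (hrs _ fun g => ?_) (hrs _ fun g => ?_) (fun g => hru g)
    (fun w => hrs _ fun g => ?_)⟩
  · refine ⟨sgn (D.h g) • e, ?_, Subalgebra.smul_mem (intertwined ρ ρ' f) hfe _⟩
    rw [hu, smul_mul_assoc, show massElt D ρV = e from rfl, heE, smul_smul, sgn_mul_self, one_smul]
  · refine ⟨sgn (D.s g) • I, ?_, Subalgebra.smul_mem (intertwined ρ ρ' f) hfI _⟩
    simp only [hu, E, smul_mul_assoc, I, φ, ← map_mul, D.elt_mul_I, map_smul]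
  · refine ⟨sgn (D.h g) • v (ρV g w), ?_, Subalgebra.smul_mem (intertwined ρ ρ' f) (hfv _) _⟩
    simp only [hu, E, v, φ, smul_mul_assoc, ← map_mul, ← elt_algVec, map_smul, smul_smul,
      sgn_mul_self, one_smul]

end Maschke

end

end FreeFermion

/-! ### Embedding modules as direct summands of the universe. -/

namespace FreeFermion

noncomputable section

/-- The submodule of a module on an invariant subspace. -/
def subRep {B X : Type*} [Ring B] [Algebra ℝ B] [AddCommGroup X] [Module ℝ X]
    (ρ : B →ₐ[ℝ] Module.End ℝ X) (N : Submodule ℝ X) (h : ∀ b, ∀ x ∈ N, ρ b x ∈ N) :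
    B →ₐ[ℝ] Module.End ℝ N where
  toFun b := (ρ b).restrict (h b)
  map_one' := LinearMap.ext fun x => Subtype.ext (by simp)
  map_mul' a b := LinearMap.ext fun x => Subtype.ext (by simp)
  map_zero' := LinearMap.ext fun x => Subtype.ext (by simp)
  map_add' a b := LinearMap.ext fun x => Subtype.ext (by simp)
  commutes' r := LinearMap.ext fun x => Subtype.ext (by simp)

namespace ModUniverse

section Stages

variable {B : Type*} [Ring B] [Algebra ℝ B] (𝒰 : ModUniverse B)

theorem P_mul_of_le {n m : ℕ} (h : n ≤ m) : 𝒰.P n * 𝒰.P m = 𝒰.P n := by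
  rw [𝒰.P_mul, min_eq_left h]

theorem P_mul_of_ge {n m : ℕ} (h : n ≤ m) : 𝒰.P m * 𝒰.P n = 𝒰.P n := by
  rw [𝒰.P_mul, min_eq_right h]

theorem P_P (n : ℕ) (u : 𝒰.carrier) : 𝒰.P n (𝒰.P n u) = 𝒰.P n u :=
  LinearMap.congr_fun (𝒰.P_mul_of_le le_rfl) u

theorem P_P_of_le {n m : ℕ} (h : n ≤ m) (u : 𝒰.carrier) : 𝒰.P n (𝒰.P m u) = 𝒰.P n u :=
  LinearMap.congr_fun (𝒰.P_mul_of_le h) u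

theorem P_P_of_ge {n m : ℕ} (h : n ≤ m) (u : 𝒰.carrier) : 𝒰.P m (𝒰.P n u) = 𝒰.P n u :=
  LinearMap.congr_fun (𝒰.P_mul_of_ge h) u

theorem P_ρ (n : ℕ) (b : B) (u : 𝒰.carrier) : 𝒰.P n (𝒰.ρ b u) = 𝒰.ρ b (𝒰.P n u) :=
  LinearMap.congr_fun (𝒰.P_comm n b) u

/-- A linear map from a finite-dimensional space takes its values in a stage. -/
theorem exists_stage {W : Type*} [AddCommGroup W] [Module ℝ W] [FiniteDimensional ℝ W]
    (j : W →ₗ[ℝ] 𝒰.carrier) (n : ℕ) : ∃ m, n ≤ m ∧ ∀ w, 𝒰.P m (j w) = j w := by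
  let b := Module.finBasis ℝ W
  choose f hf using fun i => 𝒰.exhaust (j (b i))
  refine ⟨max n (Finset.univ.sup f), le_max_left _ _, fun w => ?_⟩
  have : 𝒰.P (max n (Finset.univ.sup f)) ∘ₗ j = j := by
    refine b.ext fun i => ?_
    have hi : f i ≤ max n (Finset.univ.sup f) :=
      (Finset.le_sup (Finset.mem_univ i)).trans (le_max_right _ _)
    rw [LinearMap.comp_apply, ← hf i, 𝒰.P_P_of_ge hi]
  exact LinearMap.congr_fun this w

theorem stage_mono {n m : ℕ} (h : n ≤ m) : stage 𝒰.P n ≤ stage 𝒰.P m := by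
  rintro T ⟨h1, h2⟩
  constructor
  · rw [← h1, mul_assoc, 𝒰.P_mul_of_le h]
  · rw [← h2, ← mul_assoc, 𝒰.P_mul_of_ge h]

/-- An embedding of a module as a direct summand of the universe. -/
structure Emb (W : FDMod B) where
  j : W.carrier →ₗ[ℝ] 𝒰.carrier
  r : 𝒰.carrier →ₗ[ℝ] W.carrier
  r_j : ∀ w, r (j w) = w
  j_ρ : ∀ b w, j (W.ρ b w) = 𝒰.ρ b (j w)
  r_ρ : ∀ b u, r (𝒰.ρ b u) = W.ρ b (r u)

namespace Emb

variable {𝒰} {W W' : FDMod B}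

/-- The embedding lies in the `n`-th stage. -/
def InStage (E : 𝒰.Emb W) (n : ℕ) : Prop :=
  (∀ w, 𝒰.P n (E.j w) = E.j w) ∧ ∀ u, E.r (𝒰.P n u) = E.r u

/-- The embedding lies in the complement of the `n`-th stage. -/
def Past (E : 𝒰.Emb W) (n : ℕ) : Prop :=
  (∀ w, 𝒰.P n (E.j w) = 0) ∧ ∀ u, E.r (𝒰.P n u) = 0

theorem InStage.mono {E : 𝒰.Emb W} {n m : ℕ} (hE : E.InStage n) (h : n ≤ m) : E.InStage m :=
  ⟨fun w => by rw [← hE.1, 𝒰.P_P_of_ge h], fun u => by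
    rw [← hE.2 (𝒰.P m u), 𝒰.P_P_of_le h, hE.2]⟩

theorem Past.mono {E : 𝒰.Emb W} {n m : ℕ} (hE : E.Past m) (h : n ≤ m) : E.Past n :=
  ⟨fun w => by rw [← 𝒰.P_P_of_le h, hE.1, map_zero], fun u => by
    rw [← 𝒰.P_P_of_ge h, hE.2]⟩

theorem r_j_of_past {E : 𝒰.Emb W} {E' : 𝒰.Emb W'} {n : ℕ} (hE : E.InStage n) (hE' : E'.Past n)
    (w : W'.carrier) : E.r (E'.j w) = 0 := by
  rw [← hE.2, hE'.1, map_zero]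

theorem r_j_of_past' {E : 𝒰.Emb W} {E' : 𝒰.Emb W'} {n : ℕ} (hE : E.InStage n) (hE' : E'.Past n)
    (w : W.carrier) : E'.r (E.j w) = 0 := by
  rw [← hE.1, hE'.2]

/-- The sum of two embeddings with independent images. -/
def sum (E : 𝒰.Emb W) (E' : 𝒰.Emb W') (h : ∀ w, E.r (E'.j w) = 0) (h' : ∀ w, E'.r (E.j w) = 0) :
    𝒰.Emb (W.sum W') where
  j := E.j.coprod E'.j
  r := E.r.prod E'.r
  r_j w := Prod.ext
    (by
      change E.r (E.j w.1 + E'.j w.2) = w.1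
      rw [map_add, E.r_j, h, add_zero])
    (by
      change E'.r (E.j w.1 + E'.j w.2) = w.2
      rw [map_add, E'.r_j, h', zero_add])
  j_ρ b w := by
    change E.j (W.ρ b w.1) + E'.j (W'.ρ b w.2) = 𝒰.ρ b (E.j w.1 + E'.j w.2)
    rw [E.j_ρ, E'.j_ρ, map_add]
  r_ρ b u := Prod.ext (E.r_ρ b u) (E'.r_ρ b u)

theorem InStage.sum {E : 𝒰.Emb W} {E' : 𝒰.Emb W'} {h : ∀ w, E.r (E'.j w) = 0}
    {h' : ∀ w, E'.r (E.j w) = 0} {n : ℕ} (hE : E.InStage n) (hE' : E'.InStage n) :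
    (E.sum E' h h').InStage n :=
  ⟨fun w => by
    change 𝒰.P n (E.j w.1 + E'.j w.2) = E.j w.1 + E'.j w.2
    rw [map_add, hE.1, hE'.1], fun u => Prod.ext (hE.2 u) (hE'.2 u)⟩

theorem Past.sum {E : 𝒰.Emb W} {E' : 𝒰.Emb W'} {h : ∀ w, E.r (E'.j w) = 0}
    {h' : ∀ w, E'.r (E.j w) = 0} {n : ℕ} (hE : E.Past n) (hE' : E'.Past n) :
    (E.sum E' h h').Past n :=
  ⟨fun w => by
    change 𝒰.P n (E.j w.1 + E'.j w.2) = 0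
    rw [map_add, hE.1, hE'.1, add_zero], fun u => Prod.ext (hE.2 u) (hE'.2 u)⟩

/-- The restriction of an embedding to the first summand. -/
def fst (E : 𝒰.Emb (W.sum W')) : 𝒰.Emb W where
  j := E.j ∘ₗ LinearMap.inl ℝ _ _
  r := LinearMap.fst ℝ _ _ ∘ₗ E.r
  r_j w := congrArg Prod.fst (E.r_j (w, 0))
  j_ρ b w := by
    refine Eq.trans ?_ (E.j_ρ b ((w, 0) : W.carrier × W'.carrier))
    exact congrArg E.j (Prod.ext rfl (map_zero (W'.ρ b)).symm)
  r_ρ b u := congrArg Prod.fst (E.r_ρ b u)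

theorem InStage.fst {E : 𝒰.Emb (W.sum W')} {n : ℕ} (hE : E.InStage n) : E.fst.InStage n :=
  ⟨fun _ => hE.1 _, fun u => congrArg Prod.fst (hE.2 u)⟩

/-- The embedding of an isomorphic module. -/
def ofIso (E : 𝒰.Emb W) (e : W'.carrier ≃ₗ[ℝ] W.carrier)
    (he : ∀ b w, e (W'.ρ b w) = W.ρ b (e w)) : 𝒰.Emb W' where
  j := E.j ∘ₗ e.toLinearMap
  r := e.symm.toLinearMap ∘ₗ E.r
  r_j w := by
    change e.symm (E.r (E.j (e w))) = w
    rw [E.r_j, LinearEquiv.symm_apply_apply]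
  j_ρ b w := by
    change E.j (e (W'.ρ b w)) = 𝒰.ρ b (E.j (e w))
    rw [he, E.j_ρ]
  r_ρ b u := by
    change e.symm (E.r (𝒰.ρ b u)) = W'.ρ b (e.symm (E.r u))
    rw [E.r_ρ, LinearEquiv.symm_apply_eq, he, LinearEquiv.apply_symm_apply]

end Emb

end Stages

variable {G : Type*} [Group G] {D : SymData G}
variable {V : Type*} [NormedAddCommGroup V] [InnerProductSpace ℝ V] {ρV : G →* (V ≃ₗᵢ[ℝ] V)}
variable (𝒰 : ModUniverse (DirAlg D ρV 1))

/-- A retraction `r` from Maschke's theorem need not respect stages, but `r (P m - P n)` does. It is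
still a retraction because `P m - P n` is the identity on the image of `j`, once `m` is large enough
to contain this image. -/
theorem exists_emb_of_injective [Finite G] [FiniteDimensional ℝ V] (W : FDMod (DirAlg D ρV 1))
    (j : W.carrier →ₗ[ℝ] 𝒰.carrier) (hinj : Function.Injective j)
    (hj : ∀ b w, j (W.ρ b w) = 𝒰.ρ b (j w)) (n : ℕ) (hn : ∀ w, 𝒰.P n (j w) = 0) :
    ∃ (E : 𝒰.Emb W) (m : ℕ), n ≤ m ∧ E.Past n ∧ E.InStage m := by
  obtain ⟨r, hr, hrρ⟩ := exists_retraction j hinj hj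
  obtain ⟨m, hnm, hm⟩ := 𝒰.exists_stage j n
  refine ⟨⟨j, r ∘ₗ (𝒰.P m - 𝒰.P n), fun w => ?_, hj, fun b u => ?_⟩, m, hnm, ⟨hn, fun u => ?_⟩,
    hm, fun u => ?_⟩
  · rw [LinearMap.comp_apply, LinearMap.sub_apply, hm, hn, sub_zero, hr]
  · rw [LinearMap.comp_apply, LinearMap.comp_apply, LinearMap.sub_apply, LinearMap.sub_apply,
      𝒰.P_ρ, 𝒰.P_ρ, ← map_sub, hrρ]
  · change r (𝒰.P m (𝒰.P n u) - 𝒰.P n (𝒰.P n u)) = 0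
    rw [𝒰.P_P_of_ge hnm, 𝒰.P_P, sub_self, map_zero]
  · change r (𝒰.P m (𝒰.P m u) - 𝒰.P n (𝒰.P m u)) = r (𝒰.P m u - 𝒰.P n u)
    rw [𝒰.P_P_of_le hnm, 𝒰.P_P]

/-- Every finite-dimensional module embeds into the universe, in the complement of any stage. -/
theorem exists_emb [Finite G] [FiniteDimensional ℝ V] (W : FDMod (DirAlg D ρV 1)) (n : ℕ) :
    ∃ (E : 𝒰.Emb W) (m : ℕ), n ≤ m ∧ E.Past n ∧ E.InStage m := by
  -- Irreducible modules embed by richness of the universe. Any other nonzero module is the sum of a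
  -- proper nonzero submodule and the kernel of an equivariant retraction to it. The stage `n` must
  -- be generalized, because the second summand is embedded past the stage `m` that contains the
  -- first.
  induction hd : Module.finrank ℝ W.carrier using Nat.strong_induction_on generalizing W n with
  | _ d ih =>
    rcases subsingleton_or_nontrivial W.carrier with hW | hW
    · exact 𝒰.exists_emb_of_injective W 0 (Function.injective_of_subsingleton _)
        (fun b w => (map_zero (𝒰.ρ b)).symm) n fun w => map_zero (𝒰.P n)
    by_cases hirr : W.Irred
    · obtain ⟨j, h1, h2, h3⟩ := 𝒰.rich n W hirr
      exact 𝒰.exists_emb_of_injective W j h1 h2 n h3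
    have hN : ∃ N : Submodule ℝ W.carrier, (∀ b, ∀ w ∈ N, W.ρ b w ∈ N) ∧ N ≠ ⊥ ∧ N ≠ ⊤ := by
      by_contra hcon
      refine hirr ⟨hW, fun N hN => ?_⟩
      by_contra h
      rw [not_or] at h
      exact hcon ⟨N, hN, h.1, h.2⟩
    obtain ⟨N, hNρ, hN0, hN1⟩ := hN
    let X : FDMod (DirAlg D ρV 1) := ⟨N, subRep W.ρ N hNρ⟩
    obtain ⟨r, hr, hrρ⟩ := exists_retraction (ρ' := subRep W.ρ N hNρ) (ρ := W.ρ) N.subtype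
      N.injective_subtype (fun _ _ => rfl)
    have hKρ : ∀ b, ∀ w ∈ LinearMap.ker r, W.ρ b w ∈ LinearMap.ker r := fun b w hw => by
      rw [LinearMap.mem_ker] at hw ⊢
      rw [hrρ, hw, map_zero]
    let Y : FDMod (DirAlg D ρV 1) := ⟨LinearMap.ker r, subRep W.ρ _ hKρ⟩
    have hX : Module.finrank ℝ X.carrier < d := hd ▸ Submodule.finrank_lt hN1
    have hY : Module.finrank ℝ Y.carrier < d := by
      have h1 := LinearMap.finrank_range_add_finrank_ker r
      have h2 : 0 < Module.finrank ℝ N := by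
        rw [Module.finrank_pos_iff]
        exact Submodule.nontrivial_iff_ne_bot.2 hN0
      rw [LinearMap.range_eq_top (f := r).2 fun x => ⟨x, hr x⟩, finrank_top] at h1
      change Module.finrank ℝ (LinearMap.ker r) < d
      omega
    obtain ⟨E, m, hnm, hE1, hE2⟩ := ih _ hX X n rfl
    obtain ⟨E', m', hmm, hE1', hE2'⟩ := ih _ hY Y m rfl
    have h := Emb.r_j_of_past hE2 hE1'
    have h' := Emb.r_j_of_past' hE2 hE1'
    have hker : ∀ w, w - (r w : W.carrier) ∈ LinearMap.ker r := fun w => by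
      rw [LinearMap.mem_ker, map_sub, sub_eq_zero]
      exact (hr (r w)).symm
    let e : W.carrier ≃ₗ[ℝ] (X.sum Y).carrier :=
      { toFun := fun w => (r w, ⟨w - (r w : W.carrier), hker w⟩)
        map_add' := fun a b => Prod.ext (map_add r a b) (Subtype.ext (by
          change a + b - (r (a + b) : W.carrier) = (a - (r a : W.carrier)) + (b - (r b : W.carrier))
          rw [map_add, Submodule.coe_add]; abel))
        map_smul' := fun c a => Prod.ext (map_smul r c a) (Subtype.ext (by
          change c • a - (r (c • a) : W.carrier) = c • (a - (r a : W.carrier))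
          rw [map_smul, Submodule.coe_smul, smul_sub]))
        invFun := fun p => (p.1 : N).1 + (p.2 : LinearMap.ker r).1
        left_inv := fun w => by simp
        right_inv := fun p => by
          have h1 : r ((p.1 : N).1 + (p.2 : LinearMap.ker r).1) = p.1 := by
            rw [map_add, LinearMap.mem_ker.1 (p.2 : LinearMap.ker r).2, add_zero]
            exact hr _
          refine Prod.ext h1 (Subtype.ext ?_)
          simp only [h1, add_sub_cancel_left] }
    refine ⟨(E.sum E' h h').ofIso e fun b w => ?_, m', hnm.trans hmm, ?_, ?_⟩
    · refine Prod.ext (hrρ b w) (Subtype.ext ?_)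
      change W.ρ b w - (r (W.ρ b w)).1 = W.ρ b (w - (r w).1)
      rw [hrρ, map_sub]
      rfl
    · have := hE1.sum (h := h) (h' := h') (hE1'.mono hnm)
      exact ⟨fun w => this.1 _, fun u => by
        change e.symm _ = 0
        rw [this.2, map_zero]⟩
    · have := (hE2.mono hmm).sum (h := h) (h' := h') hE2'
      exact ⟨fun w => this.1 _, fun u => congrArg e.symm (this.2 u)⟩

end ModUniverse

end

end FreeFermion

/-! ### Mass terms, rotations between them, and the sign map. -/

namespace FreeFermion

noncomputable section

section Stage

variable {U : Type} [AddCommGroup U] [Module ℝ U] (P : ℕ → Module.End ℝ U)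

instance stage.isModuleTopology (n : ℕ) : IsModuleTopology ℝ (stage P n) := ⟨rfl⟩

instance stage.topologicalAddGroup (n : ℕ) : IsTopologicalAddGroup (stage P n) :=
  IsModuleTopology.topologicalAddGroup ℝ _

variable {P}

theorem ClsSpace.continuous_incl (H₀ : Module.End ℝ U) (p : Module.End ℝ U → Prop) (n : ℕ) :
    Continuous (ClsSpace.incl P H₀ p n) :=
  continuous_iff_coinduced_le.2
    (le_iSup (fun n => TopologicalSpace.coinduced (ClsSpace.incl P H₀ p n) inferInstance) n)

/-- A family of operators which varies continuously on a stage is continuous. -/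
theorem ClsSpace.continuous_of_stage {H₀ : Module.End ℝ U} {p : Module.End ℝ U → Prop} {n : ℕ}
    {X : Type*} [TopologicalSpace X] {f : X → ClsSpace P H₀ p} {T : X → stage P n}
    (hT : Continuous T) (h : ∀ x, (f x).1 = H₀ + T x) : Continuous f := by
  have h1 : Continuous fun x => ClsSpace.incl P H₀ p n ⟨T x, h x ▸ (f x).2.2⟩ :=
    (ClsSpace.continuous_incl H₀ p n).comp (hT.subtype_mk _)
  convert! h1 using 1
  funext x
  exact Subtype.ext (h x)

end Stage

variable {G : Type*} [Group G] {D : SymData G}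
variable {V : Type*} [NormedAddCommGroup V] [InnerProductSpace ℝ V] {ρV : G →* (V ≃ₗᵢ[ℝ] V)}

/-- The operators which may replace the mass operator in the action on a module. -/
def IsMassOn (W : FDMod (DirAlg D ρV 1)) (T : Module.End ℝ W.carrier) : Prop :=
  T * T = 1 ∧ ∀ (j : ZMod 2) (a : AlgV D ρV), a ∈ degPart D ρV j →
    T * W.ρ (fromAlgV D ρV 1 a) = sgn ((-1 : ℤˣ) ^ j) • (W.ρ (fromAlgV D ρV 1 a) * T)

namespace IsMassOn

variable {W W' : FDMod (DirAlg D ρV 1)}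

theorem massOp (W : FDMod (DirAlg D ρV 1)) : IsMassOn W (massOp W) :=
  ⟨massOp_mul_massOp W, fun _ _ ha => massOp_mul W ha⟩

/-- In the square the mixed terms cancel by anticommutation, and `cos² + sin² = 1`. The resulting
circle joins `T` to `-T`, which is the source of all homotopies of mass terms below. -/
theorem cos_sin {T T' : Module.End ℝ W.carrier} (h : IsMassOn W T) (h' : IsMassOn W T')
    (hT : T' * T = -(T * T')) (θ : ℝ) :
    IsMassOn W (Real.cos θ • T + Real.sin θ • T') := by
  refine ⟨?_, fun j a ha => ?_⟩
  · rw [add_mul, mul_add, mul_add, smul_mul_smul_comm, smul_mul_smul_comm, smul_mul_smul_comm,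
      smul_mul_smul_comm, h.1, h'.1, hT]
    have : (Real.cos θ * Real.cos θ) • (1 : Module.End ℝ W.carrier) +
        (Real.cos θ * Real.sin θ) • (T * T') + ((Real.sin θ * Real.cos θ) • -(T * T') +
          (Real.sin θ * Real.sin θ) • 1) = (Real.sin θ ^ 2 + Real.cos θ ^ 2) • 1 := by module
    rw [this, Real.sin_sq_add_cos_sq, one_smul]
  · rw [add_mul, mul_add, smul_mul_assoc, smul_mul_assoc, h.2 j a ha, h'.2 j a ha, mul_smul_comm,
      mul_smul_comm]
    module

theorem neg {T : Module.End ℝ W.carrier} (h : IsMassOn W T) : IsMassOn W (-T) :=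
  ⟨by rw [neg_mul_neg, h.1], fun j a ha => by rw [neg_mul, mul_neg, smul_neg, h.2 j a ha]⟩

theorem prodMap {T : Module.End ℝ W.carrier} {T' : Module.End ℝ W'.carrier} (h : IsMassOn W T)
    (h' : IsMassOn W' T') : IsMassOn (W.sum W') (LinearMap.prodMap T T') :=
  ⟨LinearMap.ext fun p => Prod.ext (LinearMap.congr_fun h.1 p.1) (LinearMap.congr_fun h'.1 p.2),
    fun j a ha => LinearMap.ext fun p => Prod.ext (LinearMap.congr_fun (h.2 j a ha) p.1)
      (LinearMap.congr_fun (h'.2 j a ha) p.2)⟩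

theorem diffOp (W : FDMod (DirAlg D ρV 1)) : IsMassOn (W.sum W) (diffOp W) :=
  ⟨diffOp_sq W, fun _ _ ha => diffOp_mul W ha⟩

theorem swapOp (W : FDMod (DirAlg D ρV 1)) : IsMassOn (W.sum W) (swapOp W) :=
  ⟨swapOp_sq W, fun _ _ ha => swapOp_mul W ha⟩

theorem extraOp (Y : FDMod (DirAlg D ρV 2)) : IsMassOn (Y.res (dirIncl D ρV)) (extraOp Y) :=
  ⟨extraOp_mul_extraOp Y, fun j a ha => by
    change _ * Y.ρ (dirIncl D ρV (fromAlgV D ρV 1 a)) =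
      _ • (Y.ρ (dirIncl D ρV (fromAlgV D ρV 1 a)) * _)
    rw [dirIncl_fromAlgV, extraOp_mul Y ha]⟩

end IsMassOn

namespace ModUniverse

variable {𝒰 : ModUniverse (DirAlg D ρV 1)}

theorem M₀_mul_M₀ : 𝒰.M₀ * 𝒰.M₀ = 1 := by
  rw [M₀, ← map_mul, massElt_mul_massElt, map_one]

theorem M₀_mul {j : ZMod 2} {a : AlgV D ρV} (ha : a ∈ degPart D ρV j) :
    𝒰.M₀ * 𝒰.ρ (fromAlgV D ρV 1 a) =
      sgn ((-1 : ℤˣ) ^ j) • (𝒰.ρ (fromAlgV D ρV 1 a) * 𝒰.M₀) := by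
  rw [M₀, ← map_mul, massElt_mul D ρV ha, map_smul, map_mul]

namespace Emb

variable {W W' : FDMod (DirAlg D ρV 1)}

/-- The extension by zero of an operator on an embedded module. -/
def conj (E : 𝒰.Emb W) : Module.End ℝ W.carrier →ₗ[ℝ] Module.End ℝ 𝒰.carrier where
  toFun T := E.j ∘ₗ T ∘ₗ E.r
  map_add' S T := by ext; simp
  map_smul' c T := by ext; simp

theorem conj_apply (E : 𝒰.Emb W) (T : Module.End ℝ W.carrier) (u : 𝒰.carrier) :
    E.conj T u = E.j (T (E.r u)) := rfl

theorem conj_mul (E : 𝒰.Emb W) (S T : Module.End ℝ W.carrier) :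
    E.conj S * E.conj T = E.conj (S * T) :=
  LinearMap.ext fun u => by simp only [Module.End.mul_apply, conj_apply, E.r_j]

theorem ρ_mul_conj (E : 𝒰.Emb W) (b : DirAlg D ρV 1) (T : Module.End ℝ W.carrier) :
    𝒰.ρ b * E.conj T = E.conj (W.ρ b * T) :=
  LinearMap.ext fun u => by simp only [Module.End.mul_apply, conj_apply, E.j_ρ]

theorem conj_mul_ρ (E : 𝒰.Emb W) (b : DirAlg D ρV 1) (T : Module.End ℝ W.carrier) :
    E.conj T * 𝒰.ρ b = E.conj (T * W.ρ b) :=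
  LinearMap.ext fun u => by simp only [Module.End.mul_apply, conj_apply, E.r_ρ]

theorem conj_mem_stage {E : 𝒰.Emb W} {n : ℕ} (hE : E.InStage n) (T : Module.End ℝ W.carrier) :
    E.conj T ∈ stage 𝒰.P n :=
  ⟨LinearMap.ext fun u => by simp only [Module.End.mul_apply, conj_apply, hE.2],
    LinearMap.ext fun u => by simp only [Module.End.mul_apply, conj_apply, hE.1]⟩

/-- The operator which is `T` on the embedded module and `M₀` on the complement. -/
def massTerm (E : 𝒰.Emb W) (T : Module.End ℝ W.carrier) : Module.End ℝ 𝒰.carrier :=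
  𝒰.M₀ + E.conj (T - massOp W)

/-- Moving `M₀` through the equivariant `j` and `r` turns the correction to the square into the
extension by zero of `T² - m²`, where `m = massOp W`; this vanishes. -/
theorem isMass_massTerm (E : 𝒰.Emb W) {T : Module.End ℝ W.carrier} (hT : IsMassOn W T) :
    𝒰.IsMass (E.massTerm T) := by
  constructor
  · have h1 : 𝒰.M₀ * E.conj (T - massOp W) = E.conj (massOp W * (T - massOp W)) :=
      E.ρ_mul_conj _ _
    have h2 : E.conj (T - massOp W) * 𝒰.M₀ = E.conj ((T - massOp W) * massOp W) :=
      E.conj_mul_ρ _ _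
    rw [massTerm, add_mul, mul_add, mul_add, M₀_mul_M₀, h1, h2, E.conj_mul, add_assoc, ← map_add,
      ← map_add]
    have : massOp W * (T - massOp W) + ((T - massOp W) * massOp W +
        (T - massOp W) * (T - massOp W)) = T * T - massOp W * massOp W := by noncomm_ring
    rw [this, hT.1, massOp_mul_massOp, sub_self, map_zero, add_zero]
  · intro j a ha
    rw [massTerm, add_mul, mul_add, M₀_mul ha, E.conj_mul_ρ, E.ρ_mul_conj, sub_mul, mul_sub,
      hT.2 j a ha, massOp_mul W ha, smul_add, ← map_smul, smul_sub]

/-- The mass term which is `T` on the embedded module and `M₀` on the complement. -/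
def massPoint (E : 𝒰.Emb W) {n : ℕ} (hE : E.InStage n) {T : Module.End ℝ W.carrier}
    (hT : IsMassOn W T) : 𝒰.MassSpace :=
  ⟨E.massTerm T, ⟨n, by rw [massTerm, add_sub_cancel_left]; exact conj_mem_stage hE _⟩,
    E.isMass_massTerm hT⟩

/-- A path of mass operators on an embedded module gives a path of mass terms. -/
theorem massPoint_joined (E : 𝒰.Emb W) {n : ℕ} (hE : E.InStage n)
    {γ : ℝ → Module.End ℝ W.carrier} (hγ : Continuous γ) (h : ∀ t, IsMassOn W (γ t)) (a b : ℝ) :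
    ZerothHomotopy.mk (E.massPoint hE (h a)) = ZerothHomotopy.mk (E.massPoint hE (h b)) := by
  have hc : Continuous fun t => E.massPoint hE (h t) := by
    let L : Module.End ℝ W.carrier →ₗ[ℝ] stage 𝒰.P n :=
      E.conj.codRestrict _ (conj_mem_stage hE)
    have hL : Continuous L := IsModuleTopology.continuous_of_linearMap L
    exact ClsSpace.continuous_of_stage (hL.comp (hγ.sub continuous_const)) fun _ => rfl
  have hp : Joined a b := PathConnectedSpace.joined a b
  exact ZerothHomotopy.sound (hp.somePath.map hc)

/-- The half circle from angle `0` to angle `π`. -/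
theorem massPoint_cos_sin (E : 𝒰.Emb W) {n : ℕ} (hE : E.InStage n)
    {T T' : Module.End ℝ W.carrier} (h : IsMassOn W T) (h' : IsMassOn W T')
    (hT : T' * T = -(T * T')) :
    ZerothHomotopy.mk (E.massPoint hE h) = ZerothHomotopy.mk (E.massPoint hE h.neg) := by
  have := E.massPoint_joined hE (γ := fun θ => Real.cos θ • T + Real.sin θ • T')
    ((Real.continuous_cos.smul continuous_const).add (Real.continuous_sin.smul continuous_const))
    (h.cos_sin h' hT) 0 Real.pi
  convert this using 2
  · exact Subtype.ext (by simp [massPoint])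
  · exact Subtype.ext (by simp [massPoint])

/-- The mass term with changed sign on the embedded module. -/
def signPoint (E : 𝒰.Emb W) {n : ℕ} (hE : E.InStage n) : 𝒰.MassSpace :=
  E.massPoint hE (IsMassOn.massOp W).neg

/-- The two copies of `W` are independent, and on their sum `W ⊕ W` the two mass terms are `-diffOp
W` and `diffOp W`. The anticommuting operator `swapOp W` rotates one into the other. -/
theorem signPoint_eq_of_past {E E' : 𝒰.Emb W} {n m : ℕ} (hE : E.InStage n) (hP : E'.Past n)
    (hE' : E'.InStage m) (hnm : n ≤ m) :
    ZerothHomotopy.mk (E.signPoint hE) = ZerothHomotopy.mk (E'.signPoint hE') := by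
  have h := r_j_of_past hE hP
  have h' := r_j_of_past' hE hP
  have h1 := (E.sum E' h h').massPoint_cos_sin ((hE.mono hnm).sum hE') (IsMassOn.diffOp W)
    (IsMassOn.swapOp W) (swapOp_mul_diffOp W)
  have e1 : E.signPoint hE = (E.sum E' h h').massPoint ((hE.mono hnm).sum hE')
      (IsMassOn.diffOp W).neg := by
    apply Subtype.ext
    refine congrArg (𝒰.M₀ + ·) (LinearMap.ext fun u => ?_)
    change E.j (-massOp W (E.r u) - massOp W (E.r u)) =
      E.j (-massOp W (E.r u) - massOp W (E.r u)) +
        E'.j (-(-massOp W (E'.r u)) - massOp W (E'.r u))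
    rw [neg_neg, sub_self, map_zero, add_zero]
  have e2 : E'.signPoint hE' = (E.sum E' h h').massPoint ((hE.mono hnm).sum hE')
      (IsMassOn.diffOp W) := by
    apply Subtype.ext
    refine congrArg (𝒰.M₀ + ·) (LinearMap.ext fun u => ?_)
    change E'.j (-massOp W (E'.r u) - massOp W (E'.r u)) =
      E.j (massOp W (E.r u) - massOp W (E.r u)) +
        E'.j (-massOp W (E'.r u) - massOp W (E'.r u))
    rw [sub_self, map_zero, zero_add]
  rw [e1, e2, h1]

/-- The component of a mass term with changed sign on an embedded module does not depend on the
embedding. -/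
theorem signPoint_eq [Finite G] [FiniteDimensional ℝ V] {E E' : 𝒰.Emb W} {n m : ℕ}
    (hE : E.InStage n) (hE' : E'.InStage m) :
    ZerothHomotopy.mk (E.signPoint hE) = ZerothHomotopy.mk (E'.signPoint hE') := by
  obtain ⟨F, k, hk, hF, hF'⟩ := 𝒰.exists_emb W (max n m)
  rw [signPoint_eq_of_past hE (hF.mono (le_max_left n m)) hF' ((le_max_left n m).trans hk),
    signPoint_eq_of_past hE' (hF.mono (le_max_right n m)) hF' ((le_max_right n m).trans hk)]

/-- The summand `W` keeps its changed sign while, on the restricted summand, the second Clifford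
generator is used to rotate the mass operator from its negative at angle `π` back to itself at angle
`0`. -/
theorem signPoint_sum_res {Y : FDMod (DirAlg D ρV 2)} {E : 𝒰.Emb (W.sum (Y.res (dirIncl D ρV)))}
    {n : ℕ} (hE : E.InStage n) :
    ZerothHomotopy.mk (E.signPoint hE) = ZerothHomotopy.mk (E.fst.signPoint hE.fst) := by
  have hm : massOp (W.sum (Y.res (dirIncl D ρV))) =
    LinearMap.prodMap (massOp W) (massOp (Y.res (dirIncl D ρV))) := rfl
  have hY := IsMassOn.cos_sin (IsMassOn.massOp (Y.res (dirIncl D ρV))) (IsMassOn.extraOp Y)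
    (extraOp_mul_massOp Y)
  let γ : ℝ → Module.End ℝ (W.sum (Y.res (dirIncl D ρV))).carrier := fun θ =>
    LinearMap.prodMap (-massOp W)
      (Real.cos θ • massOp (Y.res (dirIncl D ρV)) + Real.sin θ • extraOp Y)
  have hc : Continuous γ := by
    let A : Module.End ℝ (W.sum (Y.res (dirIncl D ρV))).carrier :=
      LinearMap.prodMap (-massOp W) 0
    let B : Module.End ℝ (W.sum (Y.res (dirIncl D ρV))).carrier :=
      LinearMap.prodMap 0 (massOp (Y.res (dirIncl D ρV)))
    let C : Module.End ℝ (W.sum (Y.res (dirIncl D ρV))).carrier :=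
      LinearMap.prodMap 0 (extraOp Y)
    have : γ = fun θ => A + (Real.cos θ • B + Real.sin θ • C) := by
      funext θ
      refine LinearMap.ext fun p => Prod.ext ?_ ?_
      · change -massOp W p.1 = -massOp W p.1 + (Real.cos θ • 0 + Real.sin θ • 0)
        rw [smul_zero, smul_zero, add_zero, add_zero]
      · exact (zero_add _).symm
    rw [this]
    exact continuous_const.add ((Real.continuous_cos.smul continuous_const).add
      (Real.continuous_sin.smul continuous_const))
  have h1 := E.massPoint_joined hE hc (fun θ => (IsMassOn.massOp W).neg.prodMap (hY θ)) Real.pi 0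
  have e1 : E.signPoint hE = E.massPoint hE ((IsMassOn.massOp W).neg.prodMap (hY Real.pi)) := by
    apply Subtype.ext
    change E.massTerm _ = E.massTerm _
    congr 1
    rw [hm, Real.cos_pi, Real.sin_pi, zero_smul, add_zero, neg_one_smul]
    rfl
  have e2 : E.fst.signPoint hE.fst =
      E.massPoint hE ((IsMassOn.massOp W).neg.prodMap (hY 0)) := by
    apply Subtype.ext
    refine congrArg (𝒰.M₀ + ·) (LinearMap.ext fun u => ?_)
    have h0 : ∀ y : Y.carrier, (Real.cos 0 • massOp (Y.res (dirIncl D ρV)) +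
        Real.sin 0 • extraOp Y) y - massOp (Y.res (dirIncl D ρV)) y = 0 := fun y => by
      rw [Real.cos_zero, Real.sin_zero, zero_smul, add_zero, one_smul, sub_self]
    change E.j (-massOp W (E.r u).1 - massOp W (E.r u).1, 0) =
      E.j (-massOp W (E.r u).1 - massOp W (E.r u).1,
        (Real.cos 0 • massOp (Y.res (dirIncl D ρV)) + Real.sin 0 • extraOp Y) (E.r u).2 -
          massOp (Y.res (dirIncl D ρV)) (E.r u).2)
    rw [h0]
  rw [e1, e2, h1]

theorem signChange_signPoint (E : 𝒰.Emb W) {n : ℕ} (hE : E.InStage n) :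
    𝒰.SignChange W (E.signPoint hE).1 := by
  refine ⟨E.j, LinearMap.ker E.r, fun w w' h => ?_, E.j_ρ, ?_, fun b c hc => ?_, fun w => ?_,
    fun c hc => ?_⟩
  · rw [← E.r_j w, h, E.r_j]
  · constructor
    · rw [Submodule.disjoint_def]
      rintro _ ⟨w, rfl⟩ h
      rw [LinearMap.mem_ker, E.r_j] at h
      rw [h, map_zero]
    · rw [codisjoint_iff, eq_top_iff]
      intro u _
      rw [← add_sub_cancel (E.j (E.r u)) u]
      refine Submodule.add_mem_sup ⟨_, rfl⟩ ?_
      rw [LinearMap.mem_ker, map_sub, E.r_j, sub_self]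
  · rw [LinearMap.mem_ker] at hc ⊢
    rw [E.r_ρ, hc, map_zero]
  · change 𝒰.M₀ (E.j w) + E.j ((-massOp W - massOp W) (E.r (E.j w))) = _
    have : E.j (massOp W w) = 𝒰.M₀ (E.j w) := E.j_ρ _ _
    rw [E.r_j, LinearMap.sub_apply, LinearMap.neg_apply, map_sub, map_neg, this]
    abel
  · change 𝒰.M₀ c + E.j ((-massOp W - massOp W) (E.r c)) = _
    rw [LinearMap.mem_ker.1 hc, map_zero, map_zero, add_zero]

/-- The invariant complement `C` provides an equivariant retraction `r`. The difference `M - M₀` is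
the extension by zero of `-2 massOp W`, which is invertible on `W`; so `j` and `r` are determined by
`M - M₀` and lie in every stage in which it lies. -/
theorem exists_of_signChange (M : 𝒰.MassSpace) (h : 𝒰.SignChange W M.1) :
    ∃ E : 𝒰.Emb W, ∀ n, M.1 - 𝒰.M₀ ∈ stage 𝒰.P n →
      ∃ hE : E.InStage n, M = E.signPoint hE := by
  obtain ⟨j, C, hinj, hj, hC, hCρ, hM, hMC⟩ := h
  let r : 𝒰.carrier →ₗ[ℝ] W.carrier :=
    (LinearEquiv.ofInjective j hinj).symm.toLinearMap ∘ₗ (LinearMap.range j).projectionOnto C hC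
  have hrj : ∀ w, r (j w) = w := fun w => by
    change (LinearEquiv.ofInjective j hinj).symm _ = w
    rw [Submodule.projectionOnto_apply_of_mem_left hC ⟨w, rfl⟩, LinearEquiv.symm_apply_eq]
    rfl
  have hrC : ∀ c ∈ C, r c = 0 := fun c hc => by
    change (LinearEquiv.ofInjective j hinj).symm _ = 0
    rw [(Submodule.projectionOnto_apply_eq_zero_iff hC).2 hc, map_zero]
  have hdec : ∀ u, ∃ w, ∃ c ∈ C, j w + c = u := fun u => by
    have : u ∈ LinearMap.range j ⊔ C := by rw [hC.sup_eq_top]; trivial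
    obtain ⟨_, ⟨w, rfl⟩, c, hc, h⟩ := Submodule.mem_sup.1 this
    exact ⟨w, c, hc, h⟩
  let E : 𝒰.Emb W := ⟨j, r, hrj, hj, fun b u => by
    obtain ⟨w, c, hc, rfl⟩ := hdec u
    rw [map_add, ← hj, map_add, hrj, hrC _ (hCρ b c hc), map_add, hrj, hrC c hc, add_zero,
      add_zero]⟩
  have hm : ∀ w, 𝒰.M₀ (j w) = j (massOp W w) := fun w => (hj _ _).symm
  have hX : M.1 - 𝒰.M₀ = E.conj (-massOp W - massOp W) := by
    refine LinearMap.ext fun u => ?_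
    obtain ⟨w, c, hc, rfl⟩ := hdec u
    change M.1 (j w + c) - 𝒰.M₀ (j w + c) = j ((-massOp W - massOp W) (r (j w + c)))
    rw [map_add, map_add, hM, hMC c hc, map_add, hrj, hrC c hc, add_zero, LinearMap.sub_apply,
      LinearMap.neg_apply, map_sub, map_neg, hm]
    abel
  have hmm : ∀ w, massOp W (massOp W w) = w := LinearMap.congr_fun (massOp_mul_massOp W)
  refine ⟨E, fun n hn => ?_⟩
  rw [hX] at hn
  -- The inverse of `-2 massOp W` is `-(1/2) massOp W`, because `massOp W` is an involution.
  have hjX : ∀ w, j w = (-(1 / 2) : ℝ) • E.conj (-massOp W - massOp W) (j (massOp W w)) :=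
    fun w => by
      change j w = (-(1 / 2) : ℝ) • j ((-massOp W - massOp W) (r (j (massOp W w))))
      rw [hrj, LinearMap.sub_apply, LinearMap.neg_apply, hmm, map_sub, map_neg]
      module
  have hrX : ∀ u, r u = (-(1 / 2) : ℝ) • massOp W (r (E.conj (-massOp W - massOp W) u)) :=
    fun u => by
      change r u = (-(1 / 2) : ℝ) • massOp W (r (j ((-massOp W - massOp W) (r u))))
      rw [hrj, LinearMap.sub_apply, LinearMap.neg_apply, map_sub, map_neg, hmm]
      module
  have hE : E.InStage n := by
    constructor
    · intro w
      change 𝒰.P n (j w) = j w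
      rw [hjX, map_smul]
      congr 1
      exact LinearMap.congr_fun hn.2 _
    · intro u
      change r (𝒰.P n u) = r u
      rw [hrX, hrX u]
      congr 3
      exact LinearMap.congr_fun hn.1 _
  refine ⟨hE, Subtype.ext ?_⟩
  change M.1 = 𝒰.M₀ + _
  rw [← hX, add_sub_cancel]

end Emb

variable (𝒰) [Finite G] [FiniteDimensional ℝ V]

/-- The component of the mass terms with changed sign on a copy of a module. -/
def signClass (W : FDMod (DirAlg D ρV 1)) : ZerothHomotopy 𝒰.MassSpace :=
  .mk ((𝒰.exists_emb W 0).choose.signPoint (𝒰.exists_emb W 0).choose_spec.choose_spec.2.2)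

theorem signClass_eq {W : FDMod (DirAlg D ρV 1)} (E : 𝒰.Emb W) {n : ℕ} (hE : E.InStage n) :
    𝒰.signClass W = .mk (E.signPoint hE) :=
  Emb.signPoint_eq _ _

/-- Precomposing an embedding with the isomorphism does not change the operator on the universe. -/
theorem signClass_of_iso {W W' : FDMod (DirAlg D ρV 1)} (h : W.Iso W') :
    𝒰.signClass W = 𝒰.signClass W' := by
  obtain ⟨e, he⟩ := h
  obtain ⟨E, n, -, -, hE⟩ := 𝒰.exists_emb W' 0
  have hE' : (E.ofIso e he).InStage n := ⟨fun w => hE.1 _, fun u => congrArg e.symm (hE.2 u)⟩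
  rw [𝒰.signClass_eq E hE, 𝒰.signClass_eq (E.ofIso e he) hE']
  congr 1
  apply Subtype.ext
  refine congrArg (𝒰.M₀ + ·) (LinearMap.ext fun u => ?_)
  change E.j (e (-massOp W (e.symm (E.r u)) - massOp W (e.symm (E.r u)))) =
    E.j (-massOp W' (E.r u) - massOp W' (E.r u))
  have : ∀ w, e (massOp W w) = massOp W' (e w) := he _
  rw [map_sub, map_neg, this, LinearEquiv.apply_symm_apply]

/-- `signClass` is invariant under isomorphism and under adding a restricted module, so by
`AlgClass.eq_of_mk_eq` it depends only on the class. Uniqueness holds since every class is that of a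
module and every module admits a sign change. -/
theorem existsUnique_signMap :
    ∃! L : AlgClass D ρV → ZerothHomotopy 𝒰.MassSpace, 𝒰.IsSignMap L := by
  have hW : ∀ (W : FDMod (DirAlg D ρV 1)) (M : 𝒰.MassSpace), 𝒰.SignChange W M.1 →
      𝒰.signClass W = .mk M := fun W M h => by
    obtain ⟨E, hE⟩ := Emb.exists_of_signChange M h
    obtain ⟨n, hn⟩ := M.2.1
    obtain ⟨hE', rfl⟩ := hE n hn
    exact 𝒰.signClass_eq E hE'
  have hex : ∀ W : FDMod (DirAlg D ρV 1), ∃ M : 𝒰.MassSpace, 𝒰.SignChange W M.1 := fun W => by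
    obtain ⟨E, n, -, -, hE⟩ := 𝒰.exists_emb W 0
    exact ⟨E.signPoint hE, E.signChange_signPoint hE⟩
  refine ⟨fun x => 𝒰.signClass (AlgClass.mk_surjective x).choose, fun W => ⟨hex W, fun M hM => ?_⟩,
    fun L hL => funext fun x => ?_⟩
  · rw [← hW W M hM]
    refine AlgClass.eq_of_mk_eq 𝒰.signClass (fun _ _ => 𝒰.signClass_of_iso) (fun W Y => ?_)
      (AlgClass.mk_surjective _).choose_spec
    obtain ⟨E, n, -, -, hE⟩ := 𝒰.exists_emb (W.sum (Y.res (dirIncl D ρV))) 0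
    rw [𝒰.signClass_eq E hE, 𝒰.signClass_eq E.fst hE.fst, Emb.signPoint_sum_res]
  · obtain ⟨M, hM⟩ := hex (AlgClass.mk_surjective x).choose
    have := (hL (AlgClass.mk_surjective x).choose).2 M hM
    rw [(AlgClass.mk_surjective x).choose_spec] at this
    rw [this, hW _ M hM]

end ModUniverse

end

end FreeFermion

/-! ### Compact families in the direct limit topology. -/

namespace FreeFermion

noncomputable section

/-- The module topology of a finite-dimensional real vector space is Hausdorff. -/
theorem t2Space_of_isModuleTopology (E : Type*) [AddCommGroup E] [Module ℝ E]
    [FiniteDimensional ℝ E] [TopologicalSpace E] [IsModuleTopology ℝ E] : T2Space E := by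
  have : ContinuousAdd E := IsModuleTopology.toContinuousAdd ℝ _
  have h := IsModuleTopology.continuous_of_linearMap (R := ℝ)
    (Module.finBasis ℝ E).equivFun.toLinearMap
  exact T2Space.of_injective_continuous (Module.finBasis ℝ E).equivFun.injective h

namespace ModUniverse

section Compact

variable {B : Type*} [Ring B] [Algebra ℝ B] {𝒰 : ModUniverse B}

/-- An operator with `T P = T = P T` is determined by its compression to the finite-dimensional
range of `P`. -/
instance finiteDimensional_stage (n : ℕ) : FiniteDimensional ℝ (stage 𝒰.P n) := by
  have := 𝒰.P_fin n
  let f : stage 𝒰.P n →ₗ[ℝ] Module.End ℝ (LinearMap.range (𝒰.P n)) :=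
    { toFun := fun T => (𝒰.P n).rangeRestrict ∘ₗ T.1 ∘ₗ (LinearMap.range (𝒰.P n)).subtype
      map_add' := fun S T => by ext; simp
      map_smul' := fun c T => by ext; simp }
  refine FiniteDimensional.of_injective f fun S T h => Subtype.ext (LinearMap.ext fun u => ?_)
  have hST := congrArg Subtype.val (LinearMap.congr_fun h ⟨𝒰.P n u, ⟨u, rfl⟩⟩)
  change (𝒰.P n * S.1 * 𝒰.P n) u = (𝒰.P n * T.1 * 𝒰.P n) u at hST
  rwa [S.2.2, T.2.2, S.2.1, T.2.1] at hST

instance t2Space_stage (n : ℕ) : T2Space (stage 𝒰.P n) := t2Space_of_isModuleTopology _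

variable {H₀ : Module.End ℝ 𝒰.carrier} {p : Module.End ℝ 𝒰.carrier → Prop}

/-- A compact family of operators of a classifying space lies in one stage. -/
theorem exists_stage_of_compact {X : Type*} [TopologicalSpace X] [CompactSpace X]
    {f : X → ClsSpace 𝒰.P H₀ p} (hf : Continuous f) : ∃ n, ∀ x, (f x).1 - H₀ ∈ stage 𝒰.P n := by
  by_contra hcon
  push Not at hcon
  choose x hx using hcon
  -- The point `f (x k)` lies outside stage `k`, so stage `n` contains only points with index `k <
  -- n`, finitely many. Hence each subset of the sequence is closed in the direct limit. The
  -- sequence is then a closed discrete subset of a compact set, so it is finite and lies in one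
  -- stage, a contradiction.
  have hcl : ∀ A ⊆ Set.range (fun n => f (x n)), IsClosed A := by
    intro A hA
    refine isClosed_iSup_iff.2 fun n => isClosed_coinduced.2 (Set.Finite.isClosed ?_)
    have hfin : (A ∩ {H | H.1 - H₀ ∈ stage 𝒰.P n}).Finite := by
      refine ((Set.finite_lt_nat n).image fun k => f (x k)).subset ?_
      rintro H ⟨hHA, hH⟩
      obtain ⟨k, rfl⟩ := hA hHA
      refine ⟨k, ?_, rfl⟩
      by_contra hk
      exact hx k (𝒰.stage_mono (not_lt.1 hk) hH)
    refine (hfin.preimage (f := ClsSpace.incl 𝒰.P H₀ p n) ?_).subset ?_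
    · intro S _ T _ h
      apply Subtype.ext
      apply Subtype.ext
      exact add_left_cancel (congrArg Subtype.val h)
    · intro T hT
      refine ⟨hT, ?_⟩
      change H₀ + T.1.1 - H₀ ∈ stage 𝒰.P n
      rw [add_sub_cancel_left]
      exact T.1.2
  have hfin : (Set.range fun n => f (x n)).Finite := by
    have hd : DiscreteTopology (Set.range fun n => f (x n)) := by
      rw [discreteTopology_iff_forall_isClosed]
      intro A
      have := (hcl (Subtype.val '' A) (by rintro _ ⟨a, _, rfl⟩; exact a.2)).preimage
        (continuous_subtype_val (p := fun y => y ∈ Set.range fun n => f (x n)))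
      rwa [Set.preimage_image_eq _ Subtype.val_injective] at this
    have hc : IsCompact (Set.range fun n => f (x n)) :=
      (isCompact_range hf).of_isClosed_subset (hcl _ subset_rfl)
        (by rintro _ ⟨n, rfl⟩; exact ⟨_, rfl⟩)
    exact hc.finite ⟨hd⟩
  have hN : ∃ N, ∀ H ∈ Set.range (fun n => f (x n)), H.1 - H₀ ∈ stage 𝒰.P N := by
    choose s hs using fun H : ClsSpace 𝒰.P H₀ p => H.2.1
    obtain ⟨N, hN⟩ := (hfin.image s).bddAbove
    exact ⟨N, fun H hH => 𝒰.stage_mono (hN ⟨H, hH, rfl⟩) (hs H)⟩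
  obtain ⟨N, hN⟩ := hN
  exact hx N (hN _ ⟨N, rfl⟩)

/-- The compression to the `n`-th stage of the difference from the base point. -/
def compress (n : ℕ) : Module.End ℝ 𝒰.carrier →ₗ[ℝ] stage 𝒰.P n where
  toFun T := ⟨𝒰.P n * T * 𝒰.P n, by rw [mul_assoc, 𝒰.P_mul_of_le le_rfl],
    by rw [← mul_assoc, ← mul_assoc, 𝒰.P_mul_of_le le_rfl]⟩
  map_add' S T := Subtype.ext (by simp [mul_add, add_mul])
  map_smul' c T := Subtype.ext (by simp)

/-- Maps out of a direct limit are tested on each stage, and there the compression is linear up to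
the fixed base point. -/
theorem continuous_compress (n : ℕ) :
    Continuous fun H : ClsSpace 𝒰.P H₀ p => compress n (H.1 - H₀) := by
  refine continuous_iSup_dom.2 fun m => continuous_coinduced_dom.2 ?_
  have h := IsModuleTopology.continuous_of_linearMap (R := ℝ)
    ((compress (𝒰 := 𝒰) n).comp (stage 𝒰.P m).subtype)
  convert! h.comp continuous_subtype_val using 1
  funext T
  change compress n (H₀ + T.1.1 - H₀) = _
  rw [add_sub_cancel_left]
  rfl

/-- A continuous family of operators which lies in a stage is continuous in the topology of the
stage. -/
theorem continuous_stage {X : Type*} [TopologicalSpace X] {f : X → ClsSpace 𝒰.P H₀ p}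
    (hf : Continuous f) {n : ℕ} (hn : ∀ x, (f x).1 - H₀ ∈ stage 𝒰.P n) :
    Continuous fun x => (⟨(f x).1 - H₀, hn x⟩ : stage 𝒰.P n) := by
  convert! (continuous_compress n).comp hf using 1
  funext x
  apply Subtype.ext
  change (f x).1 - H₀ = 𝒰.P n * ((f x).1 - H₀) * 𝒰.P n
  rw [(hn x).2, (hn x).1]

end Compact

end ModUniverse

instance {G : Type*} [Group G] {V : Type*} [NormedAddCommGroup V] [InnerProductSpace ℝ V]
    [FiniteDimensional ℝ V] (ρV : G →* (V ≃ₗᵢ[ℝ] V)) : CompactSpace (RepSphere ρV) := by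
  refine (isCompact_iff_compactSpace (s := {k : ℝ × V | k.1 ^ 2 + ‖k.2‖ ^ 2 = 1})).1 ?_
  have : ProperSpace V := FiniteDimensional.proper_real V
  refine Metric.isCompact_of_isClosed_isBounded (isClosed_eq (by fun_prop) continuous_const) ?_
  refine Metric.isBounded_closedBall (x := (0 : ℝ × V)) (r := 1) |>.subset fun k hk => ?_
  have hk : k.1 ^ 2 + ‖k.2‖ ^ 2 = 1 := hk
  rw [mem_closedBall_zero_iff, Prod.norm_def, max_le_iff, Real.norm_eq_abs]
  constructor
  · rw [← sq_le_one_iff_abs_le_one]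
    nlinarith [sq_nonneg ‖k.2‖]
  · nlinarith [sq_nonneg k.1, norm_nonneg k.2]

theorem RepSphere.continuous_snd {G : Type*} [Group G] {V : Type*} [NormedAddCommGroup V]
    [InnerProductSpace ℝ V] {ρV : G →* (V ≃ₗᵢ[ℝ] V)} :
    Continuous fun k : RepSphere ρV => k.1.2 :=
  _root_.continuous_snd.comp (continuous_subtype_val (p := fun k : ℝ × V =>
    k.1 ^ 2 + ‖k.2‖ ^ 2 = 1))

end

end FreeFermion

/-! ### Loops of Dirac Hamiltonians and the map from mass terms to Hamiltonians. -/

namespace FreeFermion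

noncomputable section

variable {G : Type*} [Group G] {D : SymData G}
variable {V : Type*} [NormedAddCommGroup V] [InnerProductSpace ℝ V] {ρV : G →* (V ≃ₗᵢ[ℝ] V)}

namespace ModUniverse

variable {𝒰 : ModUniverse (DirAlg D ρV 1)}

theorem isMass_M₀ : 𝒰.IsMass 𝒰.M₀ := ⟨M₀_mul_M₀, fun _ _ => M₀_mul⟩

theorem Γ_sq (v : V) : 𝒰.Γ v * 𝒰.Γ v = ‖v‖ ^ 2 • 1 := by
  rw [Γ, ← map_mul, ← map_mul, algVec_sq, AlgHom.commutes, AlgHom.commutes,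
    Algebra.algebraMap_eq_smul_one]

theorem Γ_mul_I (v : V) : 𝒰.Γ v * 𝒰.ρA D.I = 𝒰.ρA D.I * 𝒰.Γ v := by
  rw [Γ, ρA, ← map_mul, ← map_mul, ← I_algVec, map_mul, map_mul]

theorem Γ_mul_elt (g : G) (v : V) :
    𝒰.Γ (ρV g v) * 𝒰.ρA (D.elt g) = sgn (D.h g) • (𝒰.ρA (D.elt g) * 𝒰.Γ v) := by
  have := congrArg (fun a => 𝒰.ρ (fromAlgV D ρV 1 a)) (elt_algVec D ρV g v)
  simp only [map_smul, map_mul] at this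
  exact this.symm

variable (𝒰) in
/-- Clifford multiplication as a linear map. -/
def Γₗ : V →ₗ[ℝ] Module.End ℝ 𝒰.carrier where
  toFun := 𝒰.Γ
  map_add' v w := by simp [Γ, algVec_add]
  map_smul' c v := by simp [Γ, algVec_smul]

theorem Γ_smul (c : ℝ) (v : V) : 𝒰.Γ (c • v) = c • 𝒰.Γ v := 𝒰.Γₗ.map_smul c v

theorem Γ_zero : 𝒰.Γ 0 = 0 := 𝒰.Γₗ.map_zero

theorem commute_P_Γ (n : ℕ) (v : V) : Commute (𝒰.P n) (𝒰.Γ v) := 𝒰.P_comm n _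

theorem commute_P_ρA (n : ℕ) (a : D.Alg) : Commute (𝒰.P n) (𝒰.ρA a) := 𝒰.P_comm n _

theorem commute_P_M₀ (n : ℕ) : Commute (𝒰.P n) 𝒰.M₀ := 𝒰.P_comm n _

theorem commute_P_of_sub_mem {A B : Module.End ℝ 𝒰.carrier} {n m : ℕ} (hnm : n ≤ m)
    (hB : Commute (𝒰.P m) B) (h : A - B ∈ stage 𝒰.P n) : Commute (𝒰.P m) A := by
  have h := 𝒰.stage_mono hnm h
  have h1 : Commute (𝒰.P m) (A - B) := by rw [commute_iff_eq, h.1, h.2]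
  simpa using h1.add_right hB

namespace IsMass

variable {M : Module.End ℝ 𝒰.carrier}

theorem mul_Γ (hM : 𝒰.IsMass M) (v : V) : M * 𝒰.Γ v = -(𝒰.Γ v * M) := by
  have := hM.2 1 _ (GrMod.algVec_mem (D := D) (ρV := ρV) v)
  simpa [sgn, Γ] using this

theorem mul_I (hM : 𝒰.IsMass M) : M * 𝒰.ρA D.I = 𝒰.ρA D.I * M := by
  have := hM.2 0 _ (GrMod.I_mem (D := D) (ρV := ρV))
  rw [uzpow_zero] at this
  simpa [sgn, ρA] using this

theorem mul_elt (hM : 𝒰.IsMass M) (g : G) :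
    M * 𝒰.ρA (D.elt g) = sgn (D.h g) • (𝒰.ρA (D.elt g) * M) := by
  obtain ⟨j, hj⟩ := GrMod.exists_deg (D.h g)
  rw [← hj]
  exact hM.2 j _ (GrMod.elt_mem g hj)

end IsMass

variable (𝒰) in
/-- Families of gapped Hamiltonians over the representation sphere which are compatible with the
symmetries. -/
structure IsSymHam (A : RepSphere ρV → Module.End ℝ 𝒰.carrier) : Prop where
  sq : ∀ k, A k * A k = 1
  comm_I : ∀ k, A k * 𝒰.ρA D.I = 𝒰.ρA D.I * A k
  equivariant : ∀ g k, A (g • k) * 𝒰.ρA (D.elt g) = sgn (D.h g) • (𝒰.ρA (D.elt g) * A k)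

theorem mass_add_Γ_sq {M : Module.End ℝ 𝒰.carrier} (hM : 𝒰.IsMass M) {a : ℝ} {v : V}
    (h : a ^ 2 + ‖v‖ ^ 2 = 1) : (a • M + 𝒰.Γ v) * (a • M + 𝒰.Γ v) = 1 := by
  rw [add_mul, mul_add, mul_add, Γ_sq, smul_mul_smul_comm, hM.1, smul_mul_assoc, hM.mul_Γ,
    mul_smul_comm, smul_neg, ← pow_two, add_assoc, neg_add_cancel_left, ← add_smul, h, one_smul]

/-- Hamiltonians with a mass term which is locally one of several invariant ones. -/
theorem isSymHam_mass_add_Γ {M : RepSphere ρV → Module.End ℝ 𝒰.carrier} (hM : ∀ k, 𝒰.IsMass (M k))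
    (hMg : ∀ (g : G) k, M (g • k) = M k) {a b : RepSphere ρV → ℝ} (hag : ∀ (g : G) k, a (g • k) = a k)
    (hbg : ∀ (g : G) k, b (g • k) = b k) (h : ∀ k, a k ^ 2 + b k ^ 2 * ‖k.1.2‖ ^ 2 = 1) :
    𝒰.IsSymHam fun k => a k • M k + 𝒰.Γ (b k • k.1.2) where
  sq k := mass_add_Γ_sq (hM k) (by rw [norm_smul, mul_pow, Real.norm_eq_abs, sq_abs, h])
  comm_I k := by
    rw [add_mul, mul_add, smul_mul_assoc, (hM k).mul_I, Γ_mul_I, mul_smul_comm]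
  equivariant g k := by
    rw [hMg, hag, hbg, smul_snd, ← map_smul, add_mul, mul_add, smul_mul_assoc, (hM k).mul_elt,
      Γ_mul_elt, mul_smul_comm, smul_add, smul_comm]

/-- On both hemispheres the mass coefficient is `-|k₀|`, with mass operator `M` in the north and
`M₀` in the south. The choice of operator is invariant because `G` fixes `k₀`. -/
theorem isSymHam_dirac {M : Module.End ℝ 𝒰.carrier} (hM : 𝒰.IsMass M) :
    𝒰.IsSymHam (dirac M 𝒰.M₀ 𝒰.Γ) := by
  classical
  have := isSymHam_mass_add_Γ (𝒰 := 𝒰) (M := fun k => if 0 ≤ k.1.1 then M else 𝒰.M₀)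
    (a := fun k => -|k.1.1|) (b := fun _ => 1) (fun k => by
      by_cases hk : 0 ≤ k.1.1
      · exact (if_pos hk).symm ▸ hM
      · exact (if_neg hk).symm ▸ isMass_M₀) (fun g k => rfl) (fun g k => rfl) (fun g k => rfl) (fun k => by
        rw [neg_sq, sq_abs, one_pow, one_mul]; exact k.2)
  convert! this using 1
  funext k
  unfold dirac
  split_ifs with hk
  · rw [abs_of_nonneg hk, one_smul, neg_smul]
  · rw [abs_of_neg (not_le.1 hk), one_smul, neg_neg]

theorem isSymHam_H₀ : 𝒰.IsSymHam fun _ => 𝒰.H₀ where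
  sq _ := by rw [H₀, neg_mul_neg, M₀_mul_M₀]
  comm_I _ := by rw [H₀, neg_mul, mul_neg, isMass_M₀.mul_I]
  equivariant g _ := by rw [H₀, neg_mul, mul_neg, isMass_M₀.mul_elt, smul_neg]

/-- A family on a stage together with a family on its complement. -/
theorem IsSymHam.splice {A B : RepSphere ρV → Module.End ℝ 𝒰.carrier} (hA : 𝒰.IsSymHam A)
    (hB : 𝒰.IsSymHam B) (n : ℕ) (hPA : ∀ k, Commute (𝒰.P n) (A k))
    (hPB : ∀ k, Commute (𝒰.P n) (B k)) :
    𝒰.IsSymHam fun k => A k * 𝒰.P n + B k * (1 - 𝒰.P n) where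
  sq k := by
    have hP : 𝒰.P n * 𝒰.P n = 𝒰.P n := 𝒰.P_mul_of_le le_rfl
    have h1 : (A k * 𝒰.P n) * (A k * 𝒰.P n) = 𝒰.P n := by
      rw [mul_assoc, ← mul_assoc (𝒰.P n), (hPA k).eq, mul_assoc, hP, ← mul_assoc, hA.sq, one_mul]
    have h2 : (A k * 𝒰.P n) * (B k * (1 - 𝒰.P n)) = 0 := by
      rw [mul_assoc, ← mul_assoc (𝒰.P n), (hPB k).eq, mul_assoc (B k), mul_sub, mul_one, hP,
        sub_self, mul_zero, mul_zero]
    have hPB' : Commute (1 - 𝒰.P n) (B k) := (Commute.one_left _).sub_left (hPB k)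
    have hPA' : Commute (1 - 𝒰.P n) (A k) := (Commute.one_left _).sub_left (hPA k)
    have h3 : (B k * (1 - 𝒰.P n)) * (A k * 𝒰.P n) = 0 := by
      rw [mul_assoc, ← mul_assoc (1 - 𝒰.P n), hPA'.eq, mul_assoc (A k), sub_mul, one_mul, hP,
        sub_self, mul_zero, mul_zero]
    have h4 : (B k * (1 - 𝒰.P n)) * (B k * (1 - 𝒰.P n)) = 1 - 𝒰.P n := by
      rw [mul_assoc, ← mul_assoc (1 - 𝒰.P n), hPB'.eq, mul_assoc, ← mul_assoc, hB.sq, one_mul,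
        sub_mul, one_mul, mul_sub, mul_one, hP, sub_self, sub_zero]
    rw [add_mul, mul_add, mul_add, h1, h2, h3, h4, add_zero, zero_add, add_sub_cancel]
  comm_I k := by
    have h1 := commute_P_ρA (𝒰 := 𝒰) n D.I
    have h2 : Commute (1 - 𝒰.P n) (𝒰.ρA D.I) := (Commute.one_left _).sub_left h1
    rw [add_mul, mul_add, mul_assoc, h1.eq, mul_assoc, h2.eq, ← mul_assoc, ← mul_assoc, hA.comm_I,
      hB.comm_I, mul_assoc, mul_assoc]
  equivariant g k := by
    have h1 := commute_P_ρA (𝒰 := 𝒰) n (D.elt g)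
    have h2 : Commute (1 - 𝒰.P n) (𝒰.ρA (D.elt g)) := (Commute.one_left _).sub_left h1
    rw [add_mul, mul_add, mul_assoc, h1.eq, mul_assoc, h2.eq, ← mul_assoc, ← mul_assoc,
      hA.equivariant, hB.equivariant, smul_mul_assoc, smul_mul_assoc, mul_assoc, mul_assoc,
      smul_add]

theorem commute_P_splice {A B : Module.End ℝ 𝒰.carrier} (n : ℕ) {m : ℕ}
    (hA : Commute (𝒰.P m) A) (hB : Commute (𝒰.P m) B) :
    Commute (𝒰.P m) (A * 𝒰.P n + B * (1 - 𝒰.P n)) := by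
  have h : Commute (𝒰.P m) (𝒰.P n) := by
    rw [commute_iff_eq, 𝒰.P_mul, 𝒰.P_mul, min_comm]
  exact (hA.mul_right h).add_right (hB.mul_right ((Commute.one_right _).sub_right h))

theorem commute_P_H₀ (n : ℕ) : Commute (𝒰.P n) 𝒰.H₀ := (commute_P_M₀ n).neg_right

theorem coe_compress_of_commute {A : Module.End ℝ 𝒰.carrier} {n : ℕ} (h : Commute (𝒰.P n) A) :
    (compress n A : Module.End ℝ 𝒰.carrier) = A * 𝒰.P n := by
  change 𝒰.P n * A * 𝒰.P n = _
  rw [h.eq, mul_assoc, 𝒰.P_mul_of_le le_rfl]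

/-- Rewrites extension by `H₀` from a stage as base point plus an operator of the stage, the form in
which continuity in the classifying space is checked. -/
theorem H₀_add_compress {A : Module.End ℝ 𝒰.carrier} {n : ℕ} (h : Commute (𝒰.P n) A) :
    𝒰.H₀ + (compress n (A - 𝒰.H₀) : Module.End ℝ 𝒰.carrier) =
      A * 𝒰.P n + 𝒰.H₀ * (1 - 𝒰.P n) := by
  rw [coe_compress_of_commute (h.sub_right (commute_P_H₀ n)), sub_mul, mul_sub, mul_one]
  abel

/-- The loop of Hamiltonians given by a symmetric family on a stage, extended by `H₀` to the
complement. -/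
def loop (n : ℕ) (A : RepSphere ρV → Module.End ℝ 𝒰.carrier) (hA : 𝒰.IsSymHam A)
    (hP : ∀ k, Commute (𝒰.P n) (A k)) (hi : A (infty ρV) = 𝒰.H₀)
    (hc : Continuous fun k => compress n (A k - 𝒰.H₀)) : 𝒰.HamLoops :=
  have hs := hA.splice isSymHam_H₀ n hP fun _ => commute_P_H₀ n
  ⟨⟨fun k => ⟨A k * 𝒰.P n + 𝒰.H₀ * (1 - 𝒰.P n),
      ⟨n, by rw [← H₀_add_compress (hP k), add_sub_cancel_left]; exact (compress n _).2⟩,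
      hs.sq k, hs.comm_I k⟩,
    ClsSpace.continuous_of_stage hc fun k => (H₀_add_compress (hP k)).symm⟩,
    by
      change A (infty ρV) * 𝒰.P n + 𝒰.H₀ * (1 - 𝒰.P n) = _
      rw [hi, ← mul_add, add_sub_cancel, mul_one],
    hs.equivariant⟩

theorem loop_eq {n m : ℕ} {A B : RepSphere ρV → Module.End ℝ 𝒰.carrier} {hA : 𝒰.IsSymHam A}
    {hB : 𝒰.IsSymHam B} {hP hP' hi hi' hc hc'}
    (h : ∀ k, A k * 𝒰.P n + 𝒰.H₀ * (1 - 𝒰.P n) = B k * 𝒰.P m + 𝒰.H₀ * (1 - 𝒰.P m)) :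
    loop n A hA hP hi hc = loop m B hB hP' hi' hc' :=
  Subtype.ext (ContinuousMap.ext fun k => Subtype.ext (h k))

/-- Joint continuity on `Y × S^V` gives a continuous map from `Y` to the loops with the compact-open
topology, which carries paths to paths. -/
theorem loop_joined {Y : Type*} [TopologicalSpace Y] (n : ℕ)
    {A : Y → RepSphere ρV → Module.End ℝ 𝒰.carrier} (hA : ∀ y, 𝒰.IsSymHam (A y))
    (hP : ∀ y k, Commute (𝒰.P n) (A y k)) (hi : ∀ y, A y (infty ρV) = 𝒰.H₀)
    (hc : Continuous fun p : Y × RepSphere ρV => compress n (A p.1 p.2 - 𝒰.H₀))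
    {a b : Y} (hab : Joined a b) :
    ZerothHomotopy.mk
        (loop n (A a) (hA a) (hP a) (hi a) (hc.comp (Continuous.prodMk_right a))) =
      ZerothHomotopy.mk
        (loop n (A b) (hA b) (hP b) (hi b) (hc.comp (Continuous.prodMk_right b))) := by
  have h : Continuous fun y =>
      loop n (A y) (hA y) (hP y) (hi y) (hc.comp (Continuous.prodMk_right y)) := by
    refine Continuous.subtype_mk (ContinuousMap.continuous_of_continuous_uncurry _ ?_) _
    exact ClsSpace.continuous_of_stage hc fun p => (H₀_add_compress (hP p.1 p.2)).symm
  exact ZerothHomotopy.sound (hab.somePath.map h)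

/-- The form with `max` and `min` has no case distinction, so continuity across the equator is
visible. -/
theorem dirac_eq {U : Type*} [AddCommGroup U] [Module ℝ U] (M M₀ : Module.End ℝ U)
    (Γ : V → Module.End ℝ U) (k : RepSphere ρV) :
    dirac M M₀ Γ k = -(max k.1.1 0 • M) + min k.1.1 0 • M₀ + Γ k.1.2 := by
  unfold dirac
  split_ifs with hk
  · rw [max_eq_left hk, min_eq_right hk, zero_smul, add_zero]
  · rw [max_eq_right (not_le.1 hk).le, min_eq_left (not_le.1 hk).le, zero_smul, neg_zero, zero_add]

theorem commute_P_dirac {M : Module.End ℝ 𝒰.carrier} {n : ℕ} (hM : Commute (𝒰.P n) M)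
    (k : RepSphere ρV) : Commute (𝒰.P n) (dirac M 𝒰.M₀ 𝒰.Γ k) := by
  rw [dirac_eq]
  exact ((hM.smul_right _).neg_right.add_right ((commute_P_M₀ n).smul_right _)).add_right
    (commute_P_Γ n _)

theorem dirac_infty (M : Module.End ℝ 𝒰.carrier) :
    dirac M 𝒰.M₀ 𝒰.Γ (infty ρV) = 𝒰.H₀ := by
  rw [dirac_eq]
  simp [infty, Γ_zero, H₀]

variable (𝒰) in
/-- The Hamiltonian with mass term `M₀` and momentum `s • v`, with the mass of the sign of `H₀`. -/
def shrunk (s : ℝ) (k : RepSphere ρV) : Module.End ℝ 𝒰.carrier :=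
  (-√(1 - s ^ 2 * ‖k.1.2‖ ^ 2)) • 𝒰.M₀ + 𝒰.Γ (s • k.1.2)

theorem isSymHam_shrunk (s : unitInterval) : 𝒰.IsSymHam (𝒰.shrunk s) :=
  isSymHam_mass_add_Γ (fun _ => isMass_M₀) (fun _ _ => rfl)
    (fun g k => by rw [smul_snd, LinearIsometryEquiv.norm_map]) (fun _ _ => rfl) fun k => by
      have h1 : ‖k.1.2‖ ^ 2 ≤ 1 := by nlinarith [k.2, sq_nonneg k.1.1]
      have h2 : (s : ℝ) ^ 2 ≤ 1 := by nlinarith [s.2.1, s.2.2]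
      -- The radicand is nonnegative because both `s` and `‖v‖` are at most `1`.
      rw [neg_sq, Real.sq_sqrt (by nlinarith [sq_nonneg ‖k.1.2‖, sq_nonneg (s : ℝ)]),
        sub_add_cancel]

theorem commute_P_shrunk (n : ℕ) (s : ℝ) (k : RepSphere ρV) : Commute (𝒰.P n) (𝒰.shrunk s k) :=
  ((commute_P_M₀ n).smul_right _).add_right (commute_P_Γ n _)

theorem shrunk_infty (s : ℝ) : 𝒰.shrunk s (infty ρV) = 𝒰.H₀ := by
  simp [shrunk, infty, Γ_zero, H₀]

theorem shrunk_zero (k : RepSphere ρV) : 𝒰.shrunk 0 k = 𝒰.H₀ := by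
  simp [shrunk, Γ_zero, H₀]

/-- On the sphere `1 - ‖v‖² = k₀²`, so the mass coefficient becomes `-|k₀|`. Together with
`shrunk_zero` and `shrunk_infty`, this makes `shrunk` a based contraction of the Dirac Hamiltonian
of `M₀` with itself to the constant `H₀`. -/
theorem shrunk_one (k : RepSphere ρV) : 𝒰.shrunk 1 k = dirac 𝒰.M₀ 𝒰.M₀ 𝒰.Γ k := by
  have hs : √(1 - (1 : ℝ) ^ 2 * ‖k.1.2‖ ^ 2) = |k.1.1| := by
    rw [← Real.sqrt_sq_eq_abs]
    congr 1
    have := k.2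
    linarith
  rw [shrunk, hs, one_smul, dirac]
  split_ifs with hk
  · rw [abs_of_nonneg hk, neg_smul]
  · rw [abs_of_neg (not_le.1 hk), neg_neg]

section Dirac

variable [FiniteDimensional ℝ V]

/-- The linear map `L` is arbitrary because it is needed both for a compression and for a
compression after multiplication by `P n`. -/
theorem continuous_compress_dirac {n : ℕ} {E : Type*} [AddCommGroup E] [Module ℝ E]
    [TopologicalSpace E] [IsModuleTopology ℝ E] (L : Module.End ℝ 𝒰.carrier →ₗ[ℝ] E) :
    Continuous fun p : {M : 𝒰.MassSpace // M.1 - 𝒰.M₀ ∈ stage 𝒰.P n} × RepSphere ρV =>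
      L (dirac p.1.1.1 𝒰.M₀ 𝒰.Γ p.2) := by
  have : IsTopologicalAddGroup E := IsModuleTopology.topologicalAddGroup ℝ _
  have : ContinuousSMul ℝ E := IsModuleTopology.toContinuousSMul ℝ _
  have h0 : Continuous fun M : {M : 𝒰.MassSpace // M.1 - 𝒰.M₀ ∈ stage 𝒰.P n} =>
      (⟨M.1.1 - 𝒰.M₀, M.2⟩ : stage 𝒰.P n) := continuous_stage continuous_subtype_val _
  have h1 := ((IsModuleTopology.continuous_of_linearMap (R := ℝ)
    (L.comp (stage 𝒰.P n).subtype)).comp h0).add (continuous_const (y := L 𝒰.M₀))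
  have h2 : Continuous fun k : RepSphere ρV => L (𝒰.Γ k.1.2) :=
    (LinearMap.continuous_of_finiteDimensional (L.comp 𝒰.Γₗ)).comp RepSphere.continuous_snd
  have h3 : Continuous fun p : {M : 𝒰.MassSpace // M.1 - 𝒰.M₀ ∈ stage 𝒰.P n} × RepSphere ρV =>
      p.2.1.1 := RepSphere.continuous_fst.comp continuous_snd
  convert! (((h3.max continuous_const).smul (h1.comp continuous_fst)).neg.add
    ((h3.min continuous_const).smul (continuous_const (y := L 𝒰.M₀)))).add
      (h2.comp continuous_snd) using 1
  funext p
  have e : L p.1.1.1 = L (p.1.1.1 - 𝒰.M₀) + L 𝒰.M₀ := by rw [L.map_sub, sub_add_cancel]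
  simp only [dirac_eq, map_add, map_neg, map_smul, e]
  rfl

theorem continuous_compress_dirac_sub (n : ℕ) :
    Continuous fun p : {M : 𝒰.MassSpace // M.1 - 𝒰.M₀ ∈ stage 𝒰.P n} × RepSphere ρV =>
      compress n (dirac p.1.1.1 𝒰.M₀ 𝒰.Γ p.2 - 𝒰.H₀) := by
  convert! (continuous_compress_dirac (compress n)).sub
    (continuous_const (y := compress n 𝒰.H₀)) using 1
  funext p
  exact map_sub _ _ _

/-- The loop of Hamiltonians given by the Dirac Hamiltonian of a mass term. -/
def diracLoop (n : ℕ) (M : {M : 𝒰.MassSpace // M.1 - 𝒰.M₀ ∈ stage 𝒰.P n}) : 𝒰.HamLoops :=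
  loop n (dirac M.1.1 𝒰.M₀ 𝒰.Γ) (isSymHam_dirac M.1.2.2)
    (commute_P_dirac (commute_P_of_sub_mem le_rfl (commute_P_M₀ n) M.2)) (dirac_infty _)
    ((continuous_compress_dirac_sub n).comp (Continuous.prodMk_right M))

theorem diracLoop_joined {n : ℕ} {M M' : {M : 𝒰.MassSpace // M.1 - 𝒰.M₀ ∈ stage 𝒰.P n}}
    (h : Joined M M') :
    ZerothHomotopy.mk (diracLoop n M) = ZerothHomotopy.mk (diracLoop n M') :=
  loop_joined n (A := fun M : {M : 𝒰.MassSpace // M.1 - 𝒰.M₀ ∈ stage 𝒰.P n} =>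
    dirac M.1.1 𝒰.M₀ 𝒰.Γ) _ _ _ (continuous_compress_dirac_sub n) h

theorem continuous_compress_shrunk {E : Type*} [AddCommGroup E] [Module ℝ E]
    [TopologicalSpace E] [IsModuleTopology ℝ E] (L : Module.End ℝ 𝒰.carrier →ₗ[ℝ] E) :
    Continuous fun p : unitInterval × RepSphere ρV => L (𝒰.shrunk p.1 p.2) := by
  have : IsTopologicalAddGroup E := IsModuleTopology.topologicalAddGroup ℝ _
  have : ContinuousSMul ℝ E := IsModuleTopology.toContinuousSMul ℝ _
  have h2 : Continuous fun k : RepSphere ρV => L (𝒰.Γ k.1.2) :=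
    (LinearMap.continuous_of_finiteDimensional (L.comp 𝒰.Γₗ)).comp RepSphere.continuous_snd
  have h3 : Continuous fun p : unitInterval × RepSphere ρV => (p.1 : ℝ) :=
    continuous_subtype_val.comp continuous_fst
  have h4 : Continuous fun p : unitInterval × RepSphere ρV => ‖p.2.1.2‖ :=
    (RepSphere.continuous_snd.comp continuous_snd).norm
  have h5 : Continuous fun p : unitInterval × RepSphere ρV =>
      -√(1 - (p.1 : ℝ) ^ 2 * ‖p.2.1.2‖ ^ 2) :=
    (continuous_const.sub ((h3.pow 2).mul (h4.pow 2))).sqrt.neg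
  convert! (h5.smul (continuous_const (y := L 𝒰.M₀))).add (h3.smul (h2.comp continuous_snd))
    using 1
  funext p
  rw [shrunk, Γ_smul, map_add, map_smul, map_smul]
  rfl

theorem continuous_compress_splice {n : ℕ} (M : 𝒰.MassSpace) (hn : M.1 - 𝒰.M₀ ∈ stage 𝒰.P n)
    (m : ℕ) : Continuous fun p : unitInterval × RepSphere ρV =>
      compress m (dirac M.1 𝒰.M₀ 𝒰.Γ p.2 * 𝒰.P n + 𝒰.shrunk p.1 p.2 * (1 - 𝒰.P n) - 𝒰.H₀) := by
  have h1 := (continuous_compress_dirac (n := n) ((compress m).comp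
    (LinearMap.mulRight ℝ (𝒰.P n)))).comp (Continuous.prodMk_right ⟨M, hn⟩)
  have h2 := continuous_compress_shrunk ((compress (𝒰 := 𝒰) m).comp
    (LinearMap.mulRight ℝ (1 - 𝒰.P n)))
  convert! ((h1.comp continuous_snd).add h2).sub (continuous_const (y := compress m 𝒰.H₀)) using 1
  funext p
  rw [map_sub, map_add]
  rfl

/-- The Dirac Hamiltonian does not depend on the stage, up to homotopy. -/
theorem diracLoop_stage {n m : ℕ} (hnm : n ≤ m) (M : 𝒰.MassSpace)
    (hn : M.1 - 𝒰.M₀ ∈ stage 𝒰.P n) (hm : M.1 - 𝒰.M₀ ∈ stage 𝒰.P m) :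
    ZerothHomotopy.mk (diracLoop n ⟨M, hn⟩) = ZerothHomotopy.mk (diracLoop m ⟨M, hm⟩) := by
  have hPD : ∀ l, n ≤ l → ∀ k, Commute (𝒰.P l) (dirac M.1 𝒰.M₀ 𝒰.Γ k) := fun l hl =>
    commute_P_dirac (commute_P_of_sub_mem hl (commute_P_M₀ l) hn)
  have hc := continuous_compress_splice M hn m
  -- The homotopy keeps the Dirac Hamiltonian on stage `n` and runs `shrunk s` on its complement. At
  -- `s = 0` this is the loop formed at stage `n`; at `s = 1` it is the loop formed at stage `m`,
  -- because `M = M₀` outside stage `n`.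
  have hA : ∀ s : unitInterval, 𝒰.IsSymHam fun k =>
      dirac M.1 𝒰.M₀ 𝒰.Γ k * 𝒰.P n + 𝒰.shrunk s k * (1 - 𝒰.P n) := fun s =>
    (isSymHam_dirac M.2.2).splice (isSymHam_shrunk s) n (hPD n le_rfl) (commute_P_shrunk n s)
  have hPA : ∀ (s : unitInterval) k, Commute (𝒰.P m)
      (dirac M.1 𝒰.M₀ 𝒰.Γ k * 𝒰.P n + 𝒰.shrunk s k * (1 - 𝒰.P n)) := fun s k =>
    commute_P_splice n (hPD m hnm k) (commute_P_shrunk m s k)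
  have hi : ∀ s : unitInterval, dirac M.1 𝒰.M₀ 𝒰.Γ (infty ρV) * 𝒰.P n +
      𝒰.shrunk s (infty ρV) * (1 - 𝒰.P n) = 𝒰.H₀ := fun s => by
    rw [dirac_infty, shrunk_infty, ← mul_add, add_sub_cancel, mul_one]
  have hj : Joined (0 : unitInterval) 1 := ⟨⟨ContinuousMap.id _, rfl, rfl⟩⟩
  have key := loop_joined m hA hPA hi hc hj
  have hmul : 𝒰.P n * 𝒰.P m = 𝒰.P n := 𝒰.P_mul_of_le hnm
  refine (congrArg ZerothHomotopy.mk (loop_eq fun k => ?_)).trans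
    (key.trans (congrArg ZerothHomotopy.mk (loop_eq fun k => ?_)))
  · rw [Set.Icc.coe_zero, shrunk_zero, add_mul, mul_assoc, hmul, mul_assoc 𝒰.H₀, sub_mul, hmul,
      one_mul, add_assoc, ← mul_add, sub_add_sub_cancel']
  · rw [Set.Icc.coe_one]
    have hX : M.1 * (1 - 𝒰.P n) = 𝒰.M₀ * (1 - 𝒰.P n) := by
      rw [← sub_eq_zero, ← sub_mul, mul_sub, mul_one, hn.1, sub_self]
    have h1 : 𝒰.shrunk 1 k * (1 - 𝒰.P n) = dirac M.1 𝒰.M₀ 𝒰.Γ k * (1 - 𝒰.P n) := by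
      rw [shrunk_one, dirac_eq, dirac_eq]
      simp only [add_mul, neg_mul, smul_mul_assoc, hX]
    rw [h1, ← mul_add, add_sub_cancel, mul_one]

/-- The component of the Dirac Hamiltonian of a mass term. -/
def diracClass (M : 𝒰.MassSpace) : ZerothHomotopy 𝒰.HamLoops :=
  .mk (diracLoop M.2.1.choose ⟨M, M.2.1.choose_spec⟩)

theorem diracClass_eq (M : 𝒰.MassSpace) {n : ℕ} (hn : M.1 - 𝒰.M₀ ∈ stage 𝒰.P n) :
    diracClass M = .mk (diracLoop n ⟨M, hn⟩) := by
  rcases le_total M.2.1.choose n with h | h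
  · exact diracLoop_stage h M _ hn
  · exact (diracLoop_stage h M hn _).symm

theorem IsDiracMap.eq_diracClass {F : ZerothHomotopy 𝒰.MassSpace → ZerothHomotopy 𝒰.HamLoops}
    (hF : 𝒰.IsDiracMap F) (M : 𝒰.MassSpace) : F (.mk M) = diracClass M := by
  obtain ⟨n, hn⟩ := M.2.1
  obtain ⟨H, hH, hF⟩ := hF M n hn
  have e : H = diracLoop n ⟨M, hn⟩ :=
    Subtype.ext (ContinuousMap.ext fun k => Subtype.ext (hH k))
  rw [hF, diracClass_eq M hn, e]

theorem existsUnique_diracMap (𝒰 : ModUniverse (DirAlg D ρV 1)) :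
    ∃! F : ZerothHomotopy 𝒰.MassSpace → ZerothHomotopy 𝒰.HamLoops, 𝒰.IsDiracMap F := by
  refine ⟨ZerothHomotopy.lift diracClass fun M M' γ => ?_, fun M n hn =>
    ⟨diracLoop n ⟨M, hn⟩, fun k => rfl, diracClass_eq M hn⟩, fun F hF => funext fun x => ?_⟩
  -- A path of mass terms stays in a single stage, and Dirac loops formed at a fixed stage vary
  -- continuously with the mass term.
  · obtain ⟨n, hn⟩ := exists_stage_of_compact γ.continuous
    have h0 : M.1 - 𝒰.M₀ ∈ stage 𝒰.P n := by
      have := hn 0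
      rwa [γ.source] at this
    have h1 : M'.1 - 𝒰.M₀ ∈ stage 𝒰.P n := by
      have := hn 1
      rwa [γ.target] at this
    have h : Joined (⟨M, h0⟩ : {M : 𝒰.MassSpace // M.1 - 𝒰.M₀ ∈ stage 𝒰.P n})
        ⟨M', h1⟩ :=
      ⟨⟨⟨fun t => ⟨γ t, hn t⟩, γ.continuous.subtype_mk _⟩, Subtype.ext γ.source,
        Subtype.ext γ.target⟩⟩
    rw [diracClass_eq M h0, diracClass_eq M' h1, diracLoop_joined h]
  · induction x with
    | mk M =>
      exact hF.eq_diracClass M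

end Dirac

end ModUniverse

end

end FreeFermion

/-! ### Homotopy invariance and trivialization in the bundle-theoretic classification. -/

namespace FreeFermion

noncomputable section

section Units

variable {B : Type*} [Ring B] [Algebra ℝ B] (U : FDMod B) {X : Type*} [TopologicalSpace X]

theorem FDMod.continuous_toMatrix {F : X → Module.End ℝ U.carrier} (hF : Continuous F) :
    Continuous fun x => LinearMap.toMatrix (Module.finBasis ℝ U.carrier)
      (Module.finBasis ℝ U.carrier) (F x) :=
  (IsModuleTopology.continuous_of_linearMap (R := ℝ) (LinearMap.toMatrix
    (Module.finBasis ℝ U.carrier) (Module.finBasis ℝ U.carrier)).toLinearMap).comp hF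

/-- Invertibility is an open condition. -/
theorem FDMod.isOpen_isUnit {F : X → Module.End ℝ U.carrier} (hF : Continuous F) :
    IsOpen {x | IsUnit (F x)} := by
  have h : {x | IsUnit (F x)} = {x | (LinearMap.toMatrix (Module.finBasis ℝ U.carrier)
      (Module.finBasis ℝ U.carrier) (F x)).det ≠ 0} := by
    ext x
    rw [Set.mem_ofPred_eq, Set.mem_ofPred_eq, LinearMap.isUnit_iff_isUnit_det, isUnit_iff_ne_zero,
      LinearMap.det_toMatrix]
  rw [h]
  exact isOpen_ne_fun (U.continuous_toMatrix hF).matrix_det continuous_const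

/-- The inverses of a continuous family of invertible endomorphisms form a continuous family. -/
theorem FDMod.exists_continuous_inverse {F : X → Module.End ℝ U.carrier} (hF : Continuous F)
    (h : ∀ x, IsUnit (F x)) : ∃ F' : X → Module.End ℝ U.carrier, Continuous F' ∧
      ∀ x, F x * F' x = 1 ∧ F' x * F x = 1 := by
  let b := Module.finBasis ℝ U.carrier
  have hd : ∀ x, IsUnit (LinearMap.toMatrix b b (F x)).det := fun x => by
    rw [LinearMap.det_toMatrix]
    exact (LinearMap.isUnit_iff_isUnit_det _).1 (h x)
  have hM : ∀ x, LinearMap.toMatrixAlgEquiv b (F x) = LinearMap.toMatrix b b (F x) := fun _ => rfl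
  refine ⟨fun x => (LinearMap.toMatrixAlgEquiv b).symm (LinearMap.toMatrix b b (F x))⁻¹, ?_,
    fun x => ⟨?_, ?_⟩⟩
  · have : ContinuousSMul ℝ (Module.End ℝ U.carrier) := IsModuleTopology.toContinuousSMul ℝ _
    refine (LinearMap.continuous_of_finiteDimensional
      (LinearMap.toMatrixAlgEquiv b).symm.toLinearMap).comp ?_
    -- Cramer's rule: the inverse is the adjugate divided by the determinant, and both are
    -- continuous.
    simp only [Matrix.inv_def, Ring.inverse_eq_inv']
    have hc := U.continuous_toMatrix hF
    exact (hc.matrix_det.inv₀ fun x => (hd x).ne_zero).smul hc.matrix_adjugate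
  · apply (LinearMap.toMatrixAlgEquiv b).injective
    rw [map_mul, AlgEquiv.apply_symm_apply, hM, Matrix.mul_nonsing_inv _ (hd x), map_one]
  · apply (LinearMap.toMatrixAlgEquiv b).injective
    rw [map_mul, AlgEquiv.apply_symm_apply, hM, Matrix.nonsing_inv_mul _ (hd x), map_one]

/-- The sum module carries its module topology, which is not the product topology by definition; the
pair is therefore written as a sum of two linear inclusions. -/
theorem FDMod.continuous_pair {B : Type*} [Ring B] [Algebra ℝ B] (U U' : FDMod B) {X : Type*}
    [TopologicalSpace X] {f : X → U.carrier} {f' : X → U'.carrier} (hf : Continuous f)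
    (hf' : Continuous f') : Continuous fun x => (show (U.sum U').carrier from (f x, f' x)) := by
  let l : U.carrier →ₗ[ℝ] (U.sum U').carrier := LinearMap.inl ℝ U.carrier U'.carrier
  let r : U'.carrier →ₗ[ℝ] (U.sum U').carrier := LinearMap.inr ℝ U.carrier U'.carrier
  have h : (fun x => (show (U.sum U').carrier from (f x, f' x))) = fun x => l (f x) + r (f' x) :=
    funext fun x => Prod.ext (add_zero _).symm (zero_add _).symm
  rw [h]
  have : ContinuousSMul ℝ (U.sum U').carrier := IsModuleTopology.toContinuousSMul ℝ _
  exact ((U.continuous_linearMap l).comp hf).add ((U'.continuous_linearMap r).comp hf')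

end Units

namespace VectObj

variable {G : Type*} [Group G] {D : SymData G} {X : Type*} [TopologicalSpace X] [MulAction G X]

/-- A continuous family of mutually inverse linear maps which is compatible with the gradings and
with the action of `A` gives an isomorphism of bundles. -/
def isoOfInverse {E E' : VectObj D X} (f : X → E.U.carrier →ₗ[ℝ] E'.U.carrier)
    (f' : X → E'.U.carrier →ₗ[ℝ] E.U.carrier)
    (h : ∀ x u, f' x (f x u) = u) (h' : ∀ x u, f x (f' x u) = u)
    (hf : Continuous fun p : X × E.U.carrier => f p.1 p.2)
    (hf' : Continuous fun p : X × E'.U.carrier => f' p.1 p.2)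
    (hε : ∀ x u, f x (E.ε x u) = E'.ε x (f x u))
    (hI : ∀ x u, f x (E.U.ρ D.I u) = E'.U.ρ D.I (f x u))
    (hg : ∀ g x u, f (g • x) (E.U.ρ (D.elt g) u) = E'.U.ρ (D.elt g) (f x u)) :
    E.toFamily.Iso E'.toFamily :=
  isoOf (fun x => LinearEquiv.ofLinearMap (f x) (f' x) (LinearMap.ext (h' x)) (LinearMap.ext (h x)))
    hf hf' hε hI hg

/-- An isomorphism of modules compatible with the gradings gives an isomorphism of bundles. -/
def isoOfConst {E E' : VectObj D X} (f : E.U.carrier ≃ₗ[ℝ] E'.U.carrier)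
    (hε : ∀ x u, f (E.ε x u) = E'.ε x (f u)) (ha : ∀ a u, f (E.U.ρ a u) = E'.U.ρ a (f u)) :
    E.toFamily.Iso E'.toFamily :=
  isoOf (fun _ => f) ((E.U.continuous_linearMap f.toLinearMap).comp continuous_snd)
    ((E'.U.continuous_linearMap f.symm.toLinearMap).comp continuous_snd) hε (fun _ => ha _)
    (fun _ _ => ha _)

theorem mk_eq_of_iso {E E' : VectObj D X} (e : E.toFamily.Iso E'.toFamily) :
    KTilde.mk E = KTilde.mk E' := Quot.sound (.iso e)

theorem mk_sum {E F : VectObj D X} (hF : F.IsTrivial) : KTilde.mk (E.sum F) = KTilde.mk E :=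
  (Quot.sound (.add E hF)).symm

section Homotopy

variable {U : FDMod D.Alg} {ε : unitInterval → X → Module.End ℝ U.carrier}

/-- The objects of a homotopy of gradings. -/
@[reducible] def slice (hc : Continuous fun p : unitInterval × X => ε p.1 p.2)
    (sq : ∀ t x, ε t x * ε t x = 1) (comm_I : ∀ t x, ε t x * U.ρ D.I = U.ρ D.I * ε t x)
    (equivariant : ∀ t g x, ε t (g • x) * U.ρ (D.elt g) =
      sgn (D.h g) • (U.ρ (D.elt g) * ε t x)) (t : unitInterval) : VectObj D X where
  U := U
  ε := ε t
  cont := hc.comp (Continuous.prodMk_right t)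
  sq := sq t
  comm_I := comm_I t
  equivariant := equivariant t

/-- Homotopic gradings define the same class. -/
theorem mk_slice [CompactSpace X] (hc : Continuous fun p : unitInterval × X => ε p.1 p.2)
    (sq : ∀ t x, ε t x * ε t x = 1) (comm_I : ∀ t x, ε t x * U.ρ D.I = U.ρ D.I * ε t x)
    (equivariant : ∀ t g x, ε t (g • x) * U.ρ (D.elt g) =
      sgn (D.h g) • (U.ρ (D.elt g) * ε t x)) (t t' : unitInterval) :
    KTilde.mk (slice hc sq comm_I equivariant t) =
      KTilde.mk (slice hc sq comm_I equivariant t') := by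
  refine IsLocallyConstant.apply_eq_of_preconnectedSpace
    ((IsLocallyConstant.iff_eventually_eq fun t => KTilde.mk
      (slice hc sq comm_I equivariant t)).2 fun t₀ => ?_) t t'
  -- The operator `1 + ε(t₀) ε(t)` intertwines `ε(t)` with `ε(t₀)` and equals `2` at `t = t₀`. By
  -- compactness of `X` it is invertible over all of `X` for `t` near `t₀`, so the class is locally
  -- constant on the connected interval.
  have hF : Continuous fun p : unitInterval × X => 1 + ε t₀ p.2 * ε p.1 p.2 :=
    continuous_const.add ((hc.comp (continuous_const.prodMk continuous_snd)).mul hc)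
  have hnhds : ∀ᶠ t in nhds t₀, ∀ x ∈ (Set.univ : Set X), IsUnit (1 + ε t₀ x * ε t x) := by
    refine isCompact_univ.eventually_forall_of_forall_eventually fun x _ => ?_
    refine (U.isOpen_isUnit hF).mem_nhds ?_
    change IsUnit (1 + ε t₀ x * ε t₀ x)
    rw [sq, one_add_one_eq_two]
    have : (2 : Module.End ℝ U.carrier) = algebraMap ℝ _ 2 := (map_ofNat _ 2).symm
    rw [this]
    exact (isUnit_iff_ne_zero.2 two_ne_zero).map _
  filter_upwards [hnhds] with t ht
  have hFt : Continuous fun x => 1 + ε t₀ x * ε t x := hF.comp (Continuous.prodMk_right t)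
  obtain ⟨F', hF', h⟩ := U.exists_continuous_inverse hFt fun x => ht x trivial
  refine mk_eq_of_iso (isoOfInverse (fun x => 1 + ε t₀ x * ε t x) F'
    (fun x => LinearMap.congr_fun (h x).2) (fun x => LinearMap.congr_fun (h x).1)
    (U.continuous_apply (hFt.comp continuous_fst) continuous_snd)
    (U.continuous_apply (hF'.comp continuous_fst) continuous_snd) (fun x u => ?_) (fun x u => ?_)
    (fun g x u => ?_))
  · have key : (1 + ε t₀ x * ε t x) * ε t x = ε t₀ x * (1 + ε t₀ x * ε t x) := by
      rw [add_mul, mul_add, mul_assoc, sq, ← mul_assoc, sq, one_mul, mul_one, add_comm]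
    exact LinearMap.congr_fun key u
  · have key : (1 + ε t₀ x * ε t x) * U.ρ D.I = U.ρ D.I * (1 + ε t₀ x * ε t x) := by
      rw [add_mul, mul_add, mul_assoc, comm_I, ← mul_assoc, comm_I, one_mul, mul_one, mul_assoc]
    exact LinearMap.congr_fun key u
  -- A product of two gradings picks up `(-1)^{h(g)}` twice, so the intertwiner commutes with `g`
  -- without sign.
  · have key : (1 + ε t₀ (g • x) * ε t (g • x)) * U.ρ (D.elt g) =
        U.ρ (D.elt g) * (1 + ε t₀ x * ε t x) := by
      rw [add_mul, mul_add, mul_assoc, equivariant, mul_smul_comm, ← mul_assoc, equivariant,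
        smul_mul_assoc, smul_smul, sgn_mul_self, one_smul, one_mul, mul_one, mul_assoc]
    exact LinearMap.congr_fun key u

end Homotopy

section Trivialize

variable (E F : VectObj D X) {T : Module.End ℝ F.U.carrier}

/-- Adding an object does not change the class if the grading of the summand has a nonnegative
anticommutator with a constant grading. -/
theorem mk_sum_of_anticommutator (sq : T * T = 1) (comm_I : T * F.U.ρ D.I = F.U.ρ D.I * T)
    (equivariant : ∀ g, T * F.U.ρ (D.elt g) = sgn (D.h g) • (F.U.ρ (D.elt g) * T))
    {c : X → ℝ} (hc : Continuous c) (hc0 : ∀ x, 0 ≤ c x)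
    (h : ∀ x, F.ε x * T + T * F.ε x = c x • 1) : KTilde.mk (E.sum F) = KTilde.mk E := by
  let F' : VectObj D X := ⟨F.U, fun _ => T, continuous_const, fun _ => sq, fun _ => comm_I,
    fun g _ => equivariant g⟩
  have hF' : F'.IsTrivial := fun _ _ => rfl
  refine Eq.trans ?_ (mk_sum (E := E) hF')
  have hn : ∀ x, 2 + c x ≠ 0 := fun x => by have := hc0 x; positivity
  -- Since `ε` and `T` are involutions, the product is `2` plus their anticommutator, a positive
  -- scalar. So `1 + T ε` is invertible at every point, with explicit inverse, and it intertwines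
  -- `ε` with the constant grading `T`.
  have e1 : ∀ x, (1 + F.ε x * T) * (1 + T * F.ε x) = (2 + c x) • 1 := fun x => by
    have : (1 + F.ε x * T) * (1 + T * F.ε x) =
        1 + (F.ε x * T + T * F.ε x) + F.ε x * (T * T) * F.ε x := by noncomm_ring
    rw [this, h, sq, mul_one, F.sq]
    module
  have e2 : ∀ x, (1 + T * F.ε x) * (1 + F.ε x * T) = (2 + c x) • 1 := fun x => by
    have : (1 + T * F.ε x) * (1 + F.ε x * T) =
        1 + (F.ε x * T + T * F.ε x) + T * (F.ε x * F.ε x) * T := by noncomm_ring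
    rw [this, h, F.sq, mul_one, sq]
    module
  have h1 : ∀ x u, (2 + c x)⁻¹ • (1 + F.ε x * T) ((1 + T * F.ε x) u) = u := fun x u => by
    have := LinearMap.congr_fun (e1 x) u
    rw [Module.End.mul_apply] at this
    rw [this, LinearMap.smul_apply, smul_smul, inv_mul_cancel₀ (hn x), one_smul]
    rfl
  have h2 : ∀ x u, (1 + T * F.ε x) ((2 + c x)⁻¹ • (1 + F.ε x * T) u) = u := fun x u => by
    have := LinearMap.congr_fun (e2 x) u
    rw [Module.End.mul_apply] at this
    rw [map_smul, this, LinearMap.smul_apply, smul_smul, inv_mul_cancel₀ (hn x), one_smul]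
    rfl
  have hfst : Continuous fun p : X × (E.sum F).U.carrier => p.2.1 :=
    ((E.U.sum F.U).continuous_linearMap (LinearMap.fst ℝ E.U.carrier F.U.carrier)).comp
      continuous_snd
  have hsnd : Continuous fun p : X × (E.sum F).U.carrier => p.2.2 :=
    ((E.U.sum F.U).continuous_linearMap (LinearMap.snd ℝ E.U.carrier F.U.carrier)).comp
      continuous_snd
  have hε : Continuous fun p : X × (E.sum F).U.carrier => F.ε p.1 := F.cont.comp continuous_fst
  have hT : Continuous fun _ : X × (E.sum F).U.carrier => T := continuous_const
  have hcp : Continuous fun p : X × (E.sum F).U.carrier => (2 + c p.1)⁻¹ :=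
    (continuous_const.add (hc.comp continuous_fst)).inv₀ fun p => hn p.1
  have k1 : Continuous fun p : X × (E.sum F).U.carrier => (1 + T * F.ε p.1) p.2.2 :=
    F.U.continuous_apply (continuous_const.add (hT.mul hε)) hsnd
  have k2 : Continuous fun p : X × (E.sum F).U.carrier =>
      ((2 + c p.1)⁻¹ • (1 + F.ε p.1 * T)) p.2.2 :=
    hcp.smul (F.U.continuous_apply (continuous_const.add (hε.mul hT)) hsnd)
  have kε : ∀ x u, (1 + T * F.ε x) (F.ε x u) = T ((1 + T * F.ε x) u) := fun x u => by
    have : (1 + T * F.ε x) * F.ε x = T * (1 + T * F.ε x) := by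
      rw [add_mul, mul_add, mul_assoc, F.sq, ← mul_assoc, sq, one_mul, mul_one, add_comm]
    exact LinearMap.congr_fun this u
  have kI : ∀ x u, (1 + T * F.ε x) (F.U.ρ D.I u) = F.U.ρ D.I ((1 + T * F.ε x) u) := fun x u => by
    have : (1 + T * F.ε x) * F.U.ρ D.I = F.U.ρ D.I * (1 + T * F.ε x) := by
      rw [add_mul, mul_add, mul_assoc, F.comm_I, ← mul_assoc, comm_I, one_mul, mul_one, mul_assoc]
    exact LinearMap.congr_fun this u
  have kg : ∀ g x u, (1 + T * F.ε (g • x)) (F.U.ρ (D.elt g) u) =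
      F.U.ρ (D.elt g) ((1 + T * F.ε x) u) := fun g x u => by
    have : (1 + T * F.ε (g • x)) * F.U.ρ (D.elt g) = F.U.ρ (D.elt g) * (1 + T * F.ε x) := by
      rw [add_mul, mul_add, mul_assoc, F.equivariant, mul_smul_comm, ← mul_assoc, equivariant,
        smul_mul_assoc, smul_smul, sgn_mul_self, one_smul, one_mul, mul_one, mul_assoc]
    exact LinearMap.congr_fun this u
  exact mk_eq_of_iso (isoOfInverse (E := E.sum F) (E' := E.sum F')
    (fun x => LinearMap.prodMap LinearMap.id (1 + T * F.ε x))
    (fun x => LinearMap.prodMap LinearMap.id ((2 + c x)⁻¹ • (1 + F.ε x * T)))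
    (fun x u => Prod.ext rfl (h1 x u.2)) (fun x u => Prod.ext rfl (h2 x u.2))
    (E.U.continuous_pair F.U hfst k1) (E.U.continuous_pair F.U hfst k2)
    (fun x u => Prod.ext rfl (kε x u.2)) (fun x u => Prod.ext rfl (kI x u.2))
    (fun g x u => Prod.ext rfl (kg g x u.2)))

end Trivialize

end VectObj

end

end FreeFermion

/-! ### Solving Hamiltonians on invariant summands of the universe. -/

namespace FreeFermion

noncomputable section

variable {G : Type*} [Group G] {D : SymData G}
variable {V : Type*} [NormedAddCommGroup V] [InnerProductSpace ℝ V] {ρV : G →* (V ≃ₗᵢ[ℝ] V)}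

instance : T2Space (RepSphere ρV) :=
  inferInstanceAs (T2Space {k : ℝ × V // k.1 ^ 2 + ‖k.2‖ ^ 2 = 1})

namespace ModUniverse

variable {𝒰 : ModUniverse (DirAlg D ρV 1)}

theorem HamLoops.isSymHam (H : 𝒰.HamLoops) : 𝒰.IsSymHam fun k => (H.1 k).1 where
  sq k := (H.1 k).2.2.1
  comm_I k := (H.1 k).2.2.2
  equivariant := H.2.2

variable (𝒰) in
/-- The action of `A` on the universe. -/
def repA : D.Alg →ₐ[ℝ] Module.End ℝ 𝒰.carrier :=
  𝒰.ρ.comp ((fromAlgV D ρV 1).comp (algIncl D ρV))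

variable (𝒰) in
/-- Invariant finite-dimensional direct summands of the universe. -/
structure Summand where
  Q : Module.End ℝ 𝒰.carrier
  idem : Q * Q = Q
  comm : ∀ a, Commute Q (𝒰.ρA a)
  fin : FiniteDimensional ℝ (LinearMap.range Q)

namespace Summand

theorem Q_of_mem (S : 𝒰.Summand) {u : 𝒰.carrier} (hu : u ∈ LinearMap.range S.Q) : S.Q u = u := by
  obtain ⟨u, rfl⟩ := hu
  exact LinearMap.congr_fun S.idem u

/-- The summand as an `A`-module. -/
def mod (S : 𝒰.Summand) : FDMod D.Alg where
  carrier := LinearMap.range S.Q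
  fin := S.fin
  ρ := subRep 𝒰.repA _ fun a u hu => ⟨𝒰.ρA a u, by
    rw [← Module.End.mul_apply, S.comm a, Module.End.mul_apply, S.Q_of_mem hu]; rfl⟩

/-- The inclusion of the summand. -/
def incl (S : 𝒰.Summand) : S.mod.carrier →ₗ[ℝ] 𝒰.carrier := (LinearMap.range S.Q).subtype

theorem incl_injective (S : 𝒰.Summand) : Function.Injective S.incl := Subtype.val_injective

theorem range_incl (S : 𝒰.Summand) : LinearMap.range S.incl = LinearMap.range S.Q :=
  Submodule.range_subtype _

theorem incl_ρ (S : 𝒰.Summand) (a : D.Alg) (u : S.mod.carrier) :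
    S.incl (S.mod.ρ a u) = 𝒰.ρA a (S.incl u) := rfl

theorem Q_incl (S : 𝒰.Summand) (u : S.mod.carrier) : S.Q (S.incl u) = S.incl u := S.Q_of_mem u.2

/-- The compression of an operator to the summand. -/
def compress (S : 𝒰.Summand) : Module.End ℝ 𝒰.carrier →ₗ[ℝ] Module.End ℝ S.mod.carrier where
  toFun T := S.Q.rangeRestrict ∘ₗ T ∘ₗ S.incl
  map_add' _ _ := LinearMap.ext fun _ => S.Q.rangeRestrict.map_add _ _
  map_smul' c _ := LinearMap.ext fun _ => S.Q.rangeRestrict.map_smul c _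

theorem incl_compress (S : 𝒰.Summand) {T : Module.End ℝ 𝒰.carrier} (hT : Commute S.Q T)
    (u : S.mod.carrier) : S.incl (S.compress T u) = T (S.incl u) := by
  change S.Q (T (S.incl u)) = _
  rw [← Module.End.mul_apply, hT.eq, Module.End.mul_apply, S.Q_incl]

theorem compress_mul (S : 𝒰.Summand) {A B : Module.End ℝ 𝒰.carrier} (hA : Commute S.Q A)
    (hB : Commute S.Q B) : S.compress A * S.compress B = S.compress (A * B) :=
  LinearMap.ext fun u => S.incl_injective <| by
    rw [Module.End.mul_apply, S.incl_compress hA, S.incl_compress hB,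
      S.incl_compress (hA.mul_right hB), Module.End.mul_apply]

theorem compress_one (S : 𝒰.Summand) : S.compress 1 = 1 :=
  LinearMap.ext fun u => S.incl_injective (S.incl_compress (Commute.one_right _) u)

/-- The object given by a family of Hamiltonians on a summand. -/
def obj (S : 𝒰.Summand) (A : RepSphere ρV → Module.End ℝ 𝒰.carrier) (hA : 𝒰.IsSymHam A)
    (hS : ∀ k, Commute S.Q (A k)) (hc : Continuous fun k => S.compress (A k)) :
    VectObj D (RepSphere ρV) where
  U := S.mod
  ε k := S.compress (A k)
  cont := hc
  sq k := LinearMap.ext fun u => S.incl_injective <| by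
    rw [Module.End.mul_apply, S.incl_compress (hS k), S.incl_compress (hS k)]
    exact LinearMap.congr_fun (hA.sq k) _
  comm_I k := LinearMap.ext fun u => S.incl_injective <| by
    rw [Module.End.mul_apply, Module.End.mul_apply, S.incl_compress (hS k), S.incl_ρ, S.incl_ρ,
      S.incl_compress (hS k)]
    exact LinearMap.congr_fun (hA.comm_I k) _
  equivariant g k := LinearMap.ext fun u => S.incl_injective <| by
    rw [LinearMap.smul_apply, map_smul, Module.End.mul_apply, Module.End.mul_apply,
      S.incl_compress (hS _), S.incl_ρ, S.incl_ρ, S.incl_compress (hS k)]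
    exact LinearMap.congr_fun (hA.equivariant g k) _

variable (𝒰) in
/-- A stage as a summand. -/
def ofStage (n : ℕ) : 𝒰.Summand where
  Q := 𝒰.P n
  idem := 𝒰.P_mul_of_le le_rfl
  comm := commute_P_ρA n
  fin := 𝒰.P_fin n

/-- The complement of a summand in a stage. -/
def compl (S : 𝒰.Summand) {n : ℕ} (h : 𝒰.P n * S.Q = S.Q) (h' : S.Q * 𝒰.P n = S.Q) :
    𝒰.Summand where
  Q := 𝒰.P n - S.Q
  idem := by
    rw [mul_sub, sub_mul, sub_mul, h, h', S.idem, 𝒰.P_mul_of_le le_rfl, sub_self, sub_zero]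
  comm a := (commute_P_ρA n a).sub_left (S.comm a)
  fin := by
    have := 𝒰.P_fin n
    refine Submodule.finiteDimensional_of_le (S₂ := LinearMap.range (𝒰.P n)) ?_
    rintro _ ⟨u, rfl⟩
    refine ⟨(𝒰.P n - S.Q) u, ?_⟩
    rw [← Module.End.mul_apply, mul_sub, h, 𝒰.P_mul_of_le le_rfl]

section Compl

variable {S : 𝒰.Summand} {n : ℕ} (h : 𝒰.P n * S.Q = S.Q) (h' : S.Q * 𝒰.P n = S.Q)
  {W : Type*} [AddCommGroup W] [Module ℝ W] {j : W →ₗ[ℝ] 𝒰.carrier}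

theorem Q_incl_compl (u : (S.compl h h').mod.carrier) : S.Q ((S.compl h h').incl u) = 0 := by
  rw [← (S.compl h h').Q_incl]
  change (S.Q * (𝒰.P n - S.Q)) _ = 0
  rw [mul_sub, h', S.idem, sub_self, LinearMap.zero_apply]

theorem P_incl_compl (u : (S.compl h h').mod.carrier) :
    𝒰.P n ((S.compl h h').incl u) = (S.compl h h').incl u := by
  rw [← (S.compl h h').Q_incl]
  change (𝒰.P n * (𝒰.P n - S.Q)) _ = (𝒰.P n - S.Q) _
  rw [mul_sub, h, 𝒰.P_mul_of_le le_rfl]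

/-- Applying `S.Q` to a relation kills the part in the complement and fixes the image of `j`, so
both parts vanish separately. -/
theorem injective_coprod_compl (hj : Function.Injective j)
    (hr : LinearMap.range j = LinearMap.range S.Q) :
    Function.Injective (j.coprod (S.compl h h').incl) := by
  rw [← LinearMap.ker_eq_bot, LinearMap.ker_eq_bot']
  rintro ⟨w, u⟩ hwu
  rw [LinearMap.coprod_apply] at hwu
  have hw := congrArg S.Q hwu
  rw [map_add, Q_incl_compl, S.Q_of_mem (hr ▸ LinearMap.mem_range_self j w), add_zero,
    map_zero] at hw
  dsimp only at hw hwu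
  rw [hw, zero_add] at hwu
  exact Prod.ext (hj (hw.trans (map_zero j).symm))
    ((S.compl h h').incl_injective (hwu.trans (map_zero _).symm))

/-- Every element of the stage splits as `P n u = Q u + (P n - Q) u`. -/
theorem range_coprod_compl (hr : LinearMap.range j = LinearMap.range S.Q) :
    LinearMap.range (j.coprod (S.compl h h').incl) = LinearMap.range (𝒰.P n) := by
  rw [LinearMap.range_coprod, hr, range_incl]
  apply le_antisymm
  · refine sup_le ?_ ?_
    · rintro _ ⟨u, rfl⟩
      exact ⟨S.Q u, LinearMap.congr_fun h u⟩
    · rintro _ ⟨u, rfl⟩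
      refine ⟨(𝒰.P n - S.Q) u, ?_⟩
      change (𝒰.P n * (𝒰.P n - S.Q)) u = (𝒰.P n - S.Q) u
      rw [mul_sub, h, 𝒰.P_mul_of_le le_rfl]
  · rintro _ ⟨u, rfl⟩
    rw [← add_sub_cancel (S.Q u) (𝒰.P n u)]
    exact Submodule.add_mem_sup ⟨u, rfl⟩ ⟨u, rfl⟩

end Compl

end Summand

section Solve

variable {H : 𝒰.HamLoops} {n : ℕ}

theorem commute_P_loop (hn : ∀ k, (H.1 k).1 - 𝒰.H₀ ∈ stage 𝒰.P n) (k : RepSphere ρV) :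
    Commute (𝒰.P n) (H.1 k).1 :=
  commute_P_of_sub_mem le_rfl (commute_P_H₀ n) (hn k)

theorem continuous_summand_compress (S : 𝒰.Summand) {X : Type*} [TopologicalSpace X]
    {f : X → 𝒰.HamSpace} (hf : Continuous f) (hn : ∀ x, (f x).1 - 𝒰.H₀ ∈ stage 𝒰.P n) :
    Continuous fun x => S.compress (f x).1 := by
  have h := (IsModuleTopology.continuous_of_linearMap (R := ℝ)
    (S.compress.comp (stage 𝒰.P n).subtype)).comp (continuous_stage hf hn)
  convert! h.add (continuous_const (y := S.compress 𝒰.H₀)) using 1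
  funext x
  change _ = S.compress ((f x).1 - 𝒰.H₀) + _
  rw [S.compress.map_sub, sub_add_cancel]

/-- The object obtained by solving a Hamiltonian on a stage. -/
def solution (hn : ∀ k, (H.1 k).1 - 𝒰.H₀ ∈ stage 𝒰.P n) : VectObj D (RepSphere ρV) :=
  (Summand.ofStage 𝒰 n).obj (fun k => (H.1 k).1) (HamLoops.isSymHam H) (commute_P_loop hn)
    (continuous_summand_compress _ H.1.continuous hn)

theorem isSolution_solution (hn : ∀ k, (H.1 k).1 - 𝒰.H₀ ∈ stage 𝒰.P n) :
    𝒰.IsSolution H n (solution hn) :=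
  ⟨hn, (Summand.ofStage 𝒰 n).incl, Summand.incl_injective _, Summand.range_incl _,
    Summand.incl_ρ _, fun k => Summand.incl_compress _ (commute_P_loop hn k)⟩

/-- Both objects embed onto the same stage, so one embedding followed by the inverse of the other is
an isomorphism; all structure is transported from the universe. -/
theorem IsSolution.mk_eq {T T' : VectObj D (RepSphere ρV)} (h : 𝒰.IsSolution H n T)
    (h' : 𝒰.IsSolution H n T') : KTilde.mk T = KTilde.mk T' := by
  obtain ⟨-, j, hj, hr, ha, hε⟩ := h
  obtain ⟨-, j', hj', hr', ha', hε'⟩ := h'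
  let e : T.U.carrier ≃ₗ[ℝ] T'.U.carrier := (LinearEquiv.ofInjective j hj).trans
    ((LinearEquiv.ofEq _ _ (hr.trans hr'.symm)).trans (LinearEquiv.ofInjective j' hj').symm)
  have he : ∀ u, j' (e u) = j u := fun u =>
    congrArg Subtype.val ((LinearEquiv.ofInjective j' hj').apply_symm_apply _)
  refine VectObj.mk_eq_of_iso (VectObj.isoOfConst e (fun k u => hj' ?_) fun a u => hj' ?_)
  · rw [he, hε, hε', he]
  · rw [he, ha, ha', he]

/-- On the complement of stage `n` in stage `m` the Hamiltonian is the constant `H₀`. The larger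
solution is thus the smaller one plus a trivial object. -/
theorem mk_solution_of_le {m : ℕ} (hnm : n ≤ m) (hn : ∀ k, (H.1 k).1 - 𝒰.H₀ ∈ stage 𝒰.P n)
    (hm : ∀ k, (H.1 k).1 - 𝒰.H₀ ∈ stage 𝒰.P m) :
    KTilde.mk (solution hm) = KTilde.mk (solution hn) := by
  let S := (Summand.ofStage 𝒰 n).compl (𝒰.P_mul_of_ge hnm) (𝒰.P_mul_of_le hnm)
  have hS : Commute S.Q 𝒰.H₀ := (commute_P_H₀ m).sub_left (commute_P_H₀ n)
  let F : VectObj D (RepSphere ρV) := S.obj (fun _ => 𝒰.H₀) isSymHam_H₀ (fun _ => hS)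
    continuous_const
  refine Eq.trans ?_ (VectObj.mk_sum (E := solution hn) (F := F) fun _ _ => rfl)
  have hincl : LinearMap.range (Summand.ofStage 𝒰 n).incl =
      LinearMap.range (Summand.ofStage 𝒰 n).Q := Summand.range_incl _
  refine (isSolution_solution hm).mk_eq ⟨hm, (Summand.ofStage 𝒰 n).incl.coprod S.incl,
    Summand.injective_coprod_compl _ _ (Summand.incl_injective _) hincl,
    Summand.range_coprod_compl _ _ hincl, fun a u => (map_add (𝒰.ρA a) _ _).symm, fun k u => ?_⟩
  have h1 : (Summand.ofStage 𝒰 n).incl ((solution hn).ε k u.1) =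
      (H.1 k).1 ((Summand.ofStage 𝒰 n).incl u.1) :=
    Summand.incl_compress _ (commute_P_loop hn k) _
  have h2 : S.incl (F.ε k u.2) = 𝒰.H₀ (S.incl u.2) := S.incl_compress hS _
  have h3 : (H.1 k).1 (S.incl u.2) = 𝒰.H₀ (S.incl u.2) := by
    rw [← sub_eq_zero, ← LinearMap.sub_apply, ← (hn k).1, Module.End.mul_apply]
    have : 𝒰.P n (S.incl u.2) = 0 := Summand.Q_incl_compl (S := Summand.ofStage 𝒰 n) _ _ u.2
    rw [this, map_zero]
  change (Summand.ofStage 𝒰 n).incl ((solution hn).ε k u.1) + S.incl (F.ε k u.2) =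
    (H.1 k).1 ((Summand.ofStage 𝒰 n).incl u.1 + S.incl u.2)
  rw [h1, h2, map_add, h3]

variable [FiniteDimensional ℝ V]

variable (𝒰) in
/-- The class obtained by solving a Hamiltonian. -/
def solveClass (H : 𝒰.HamLoops) : KTilde D (RepSphere ρV) :=
  KTilde.mk (solution (exists_stage_of_compact H.1.continuous).choose_spec)

theorem IsSolution.mk_eq_solveClass {T : VectObj D (RepSphere ρV)} (h : 𝒰.IsSolution H n T) :
    KTilde.mk T = 𝒰.solveClass H := by
  rw [h.mk_eq (isSolution_solution h.1), solveClass]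
  rcases le_total n (exists_stage_of_compact H.1.continuous).choose with hle | hle
  · exact (mk_solution_of_le hle _ _).symm
  · exact mk_solution_of_le hle _ _

/-- The adjoint of the path is continuous on the compact space `[0,1] × S^V` and so lies in a single
stage. There it is a homotopy of gradings of one fixed module, to which `mk_slice` applies. -/
theorem solveClass_eq_of_path {H H' : 𝒰.HamLoops} (γ : Path H H') :
    𝒰.solveClass H = 𝒰.solveClass H' := by
  have hc : Continuous fun p : unitInterval × RepSphere ρV => (γ p.1).1 p.2 :=
    ContinuousMap.continuous_uncurry_of_continuous
      ⟨fun t => (γ t).1, continuous_subtype_val.comp γ.continuous⟩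
  obtain ⟨n, hn⟩ := exists_stage_of_compact hc
  let T (t : unitInterval) : VectObj D (RepSphere ρV) :=
    solution (H := γ t) (n := n) fun k => hn (t, k)
  have hT : ∀ t, KTilde.mk (T t) = 𝒰.solveClass (γ t) := fun t =>
    (isSolution_solution fun k => hn (t, k)).mk_eq_solveClass
  have hε : Continuous fun p : unitInterval × RepSphere ρV =>
      (Summand.ofStage 𝒰 n).compress ((γ p.1).1 p.2).1 := continuous_summand_compress _ hc hn
  have key : KTilde.mk (T 0) = KTilde.mk (T 1) :=
    VectObj.mk_slice (U := (Summand.ofStage 𝒰 n).mod)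
      (ε := fun t k => (Summand.ofStage 𝒰 n).compress ((γ t).1 k).1)
      hε (fun t => (T t).sq) (fun t => (T t).comm_I) (fun t => (T t).equivariant) 0 1
  have h := (hT 0).symm.trans (key.trans (hT 1))
  rwa [γ.source, γ.target] at h

theorem existsUnique_solveMap (𝒰 : ModUniverse (DirAlg D ρV 1)) :
    ∃! S : ZerothHomotopy 𝒰.HamLoops → KTilde D (RepSphere ρV), 𝒰.IsSolveMap S := by
  have hex : ∀ H : 𝒰.HamLoops, ∃ n T, 𝒰.IsSolution H n T := fun H =>
    ⟨_, _, isSolution_solution (exists_stage_of_compact H.1.continuous).choose_spec⟩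
  refine ⟨ZerothHomotopy.lift 𝒰.solveClass fun H H' γ => ?_, fun H => ⟨hex H, fun n T hT =>
    hT.mk_eq_solveClass.symm⟩, fun S hS => funext fun x => ?_⟩
  · exact solveClass_eq_of_path γ
  · induction x with
    | mk H =>
      obtain ⟨n, T, hT⟩ := hex H
      exact ((hS H).2 n T hT).trans hT.mk_eq_solveClass

end Solve

end ModUniverse

end

end FreeFermion

/-! ### The ABS map and commutativity of the square. -/

namespace FreeFermion

noncomputable section

variable {G : Type*} [Group G] {D : SymData G}
variable {V : Type*} [NormedAddCommGroup V] [InnerProductSpace ℝ V] {ρV : G →* (V ≃ₗᵢ[ℝ] V)}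

theorem toGraded_M₀ (W : FDMod (DirAlg D ρV 1)) : (toGraded W).M₀ = massOp W := by
  have h : ∀ i (w : W.carrier), w ∈ (toGraded W).gr i → massOp W w = sgn i • w := fun i w hw =>
    sub_eq_zero.1 (LinearMap.mem_ker.1 hw)
  exact (toGraded W).hom_ext fun i w hw => ((toGraded W).M₀_apply hw).trans (h i w hw).symm

namespace ModUniverse

variable {𝒰 : ModUniverse (DirAlg D ρV 1)} {W : FDMod (DirAlg D ρV 1)}

/-- The image of an embedded module as a summand. -/
def Emb.summand (E : 𝒰.Emb W) : 𝒰.Summand where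
  Q := E.j ∘ₗ E.r
  idem := LinearMap.ext fun u => congrArg E.j (E.r_j _)
  comm a := LinearMap.ext fun u => (congrArg E.j (E.r_ρ _ u)).trans (E.j_ρ _ _)
  fin := by
    refine Submodule.finiteDimensional_of_le (S₂ := LinearMap.range E.j) ?_
    exact LinearMap.range_comp_le_range _ _

theorem Emb.range_summand (E : 𝒰.Emb W) :
    LinearMap.range E.j = LinearMap.range E.summand.Q := by
  apply le_antisymm
  · rintro _ ⟨w, rfl⟩
    exact ⟨E.j w, congrArg E.j (E.r_j w)⟩
  · rintro _ ⟨u, rfl⟩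
    exact ⟨E.r u, rfl⟩

theorem commute_dirac_base {Q : Module.End ℝ 𝒰.carrier} (hQ : ∀ b, Commute Q (𝒰.ρ b))
    (k : RepSphere ρV) : Commute Q (dirac 𝒰.M₀ 𝒰.M₀ 𝒰.Γ k) := by
  rw [dirac_eq]
  exact (((hQ _).smul_right _).neg_right.add_right ((hQ _).smul_right _)).add_right (hQ _)

/-- The Clifford terms cancel and the mass terms contribute `2 |k₀|`, with `|k₀|` written as `max -
min`. Its nonnegativity makes the part of the universe with unchanged mass contribute nothing. -/
theorem dirac_base_anticommutator (k : RepSphere ρV) :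
    dirac 𝒰.M₀ 𝒰.M₀ 𝒰.Γ k * 𝒰.H₀ + 𝒰.H₀ * dirac 𝒰.M₀ 𝒰.M₀ 𝒰.Γ k =
      (2 * (max k.1.1 0 - min k.1.1 0)) • 1 := by
  have h1 : 𝒰.M₀ * 𝒰.Γ k.1.2 = -(𝒰.Γ k.1.2 * 𝒰.M₀) := isMass_M₀.mul_Γ _
  rw [dirac_eq, H₀, mul_neg, neg_mul, add_mul, add_mul, mul_add, mul_add, neg_mul, mul_neg,
    smul_mul_assoc, smul_mul_assoc, mul_smul_comm, mul_smul_comm, M₀_mul_M₀, h1]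
  module

theorem Emb.dirac_signPoint_of_r_eq_zero (E : 𝒰.Emb W) {n : ℕ} (hE : E.InStage n)
    (k : RepSphere ρV) {u : 𝒰.carrier} (hP : 𝒰.P n u = u) (hr : E.r u = 0) :
    (dirac (E.signPoint hE).1 𝒰.M₀ 𝒰.Γ k * 𝒰.P n + 𝒰.H₀ * (1 - 𝒰.P n)) u =
      dirac 𝒰.M₀ 𝒰.M₀ 𝒰.Γ k u := by
  have hM : (E.signPoint hE).1 u = 𝒰.M₀ u := by
    change 𝒰.M₀ u + E.j ((-massOp W - massOp W) (E.r u)) = _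
    rw [hr, map_zero, map_zero, add_zero]
  rw [LinearMap.add_apply, Module.End.mul_apply, Module.End.mul_apply, LinearMap.sub_apply,
    Module.End.one_apply, hP, sub_self, map_zero, add_zero, dirac_eq, dirac_eq]
  simp only [LinearMap.add_apply, LinearMap.neg_apply, LinearMap.smul_apply, hM]

end ModUniverse

variable [FiniteDimensional ℝ V]

theorem toGraded_solved_ε (W : FDMod (DirAlg D ρV 1)) (k : RepSphere ρV) :
    (toGraded W).solved.ε k = k.1.1 • massOp W + W.ρ (fromAlgV D ρV 1 (algVec D ρV k.1.2)) := by
  refine ((toGraded W).dirac_neg k).trans ?_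
  rw [toGraded_M₀]
  rfl

/-- The class of the bundle obtained by solving the Dirac Hamiltonian of a module. -/
def absClass (W : FDMod (DirAlg D ρV 1)) : KTilde D (RepSphere ρV) :=
  KTilde.mk (toGraded W).solved

theorem absClass_of_iso {W W' : FDMod (DirAlg D ρV 1)} (h : W.Iso W') :
    absClass W = absClass W' := by
  obtain ⟨e, he⟩ := h
  have h1 : ∀ w, e (massOp W w) = massOp W' (e w) := he _
  have h2 : ∀ (k : RepSphere ρV) (u : W.carrier),
      e ((k.1.1 • massOp W + W.ρ (fromAlgV D ρV 1 (algVec D ρV k.1.2))) u) =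
        (k.1.1 • massOp W' + W'.ρ (fromAlgV D ρV 1 (algVec D ρV k.1.2))) (e u) := fun k u => by
    rw [LinearMap.add_apply, LinearMap.add_apply, LinearMap.smul_apply, LinearMap.smul_apply,
      map_add, map_smul, h1, he]
  refine VectObj.mk_eq_of_iso (VectObj.isoOfConst (E := (toGraded W).solved)
    (E' := (toGraded W').solved) e (fun k u => ?_) fun a u => he _ u)
  rw [toGraded_solved_ε, toGraded_solved_ε]
  exact h2 k u

/-- On the restricted summand, the second Clifford generator anticommutes with the mass operator and
with all vectors, hence with the Hamiltonian. It serves as a constant grading with anticommutator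
`0`. -/
theorem absClass_sum_res (W : FDMod (DirAlg D ρV 1)) (Y : FDMod (DirAlg D ρV 2)) :
    absClass (W.sum (Y.res (dirIncl D ρV))) = absClass W := by
  let Z := Y.res (dirIncl D ρV)
  have hY : ∀ {j : ZMod 2} {a : AlgV D ρV}, a ∈ degPart D ρV j →
      extraOp Y * Z.ρ (fromAlgV D ρV 1 a) =
        sgn ((-1 : ℤˣ) ^ j) • (Z.ρ (fromAlgV D ρV 1 a) * extraOp Y) := fun {j a} ha => by
    have h : Z.ρ (fromAlgV D ρV 1 a) = Y.ρ (fromAlgV D ρV 2 a) :=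
      congrArg Y.ρ (dirIncl_fromAlgV a)
    rw [h]
    exact extraOp_mul Y ha
  have h1 : KTilde.mk (toGraded (W.sum Z)).solved =
      KTilde.mk ((toGraded W).solved.sum (toGraded Z).solved) := by
    refine VectObj.mk_eq_of_iso (VectObj.isoOfConst (E := (toGraded (W.sum Z)).solved)
      (E' := (toGraded W).solved.sum (toGraded Z).solved) (LinearEquiv.refl ℝ _) (fun k u => ?_)
      fun a u => rfl)
    change (toGraded (W.sum Z)).solved.ε k u =
      ((toGraded W).solved.ε k u.1, (toGraded Z).solved.ε k u.2)
    rw [toGraded_solved_ε, toGraded_solved_ε, toGraded_solved_ε]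
    rfl
  refine h1.trans (VectObj.mk_sum_of_anticommutator (toGraded W).solved (toGraded Z).solved
    (T := extraOp Y) (extraOp_mul_extraOp Y) ?_ (fun g => ?_) (c := fun _ => 0) continuous_const
    (fun _ => le_rfl) fun k => ?_)
  · have := hY (GrMod.I_mem (D := D) (ρV := ρV))
    rw [uzpow_zero] at this
    simp only [sgn, Units.val_one, Int.cast_one, one_smul] at this
    exact this
  · obtain ⟨j, hj⟩ := GrMod.exists_deg (D.h g)
    rw [← hj]
    exact hY (GrMod.elt_mem g hj)
  · have h2 := hY (GrMod.algVec_mem (D := D) (ρV := ρV) k.1.2)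
    rw [uzpow_one] at h2
    simp only [sgn, Units.val_neg, Units.val_one, Int.cast_neg, Int.cast_one, neg_smul,
      one_smul] at h2
    have h3 : extraOp Y * massOp Z = -(massOp Z * extraOp Y) := extraOp_mul_massOp Y
    have h4 : (k.1.1 • massOp Z + Z.ρ (fromAlgV D ρV 1 (algVec D ρV k.1.2))) * extraOp Y +
        extraOp Y * (k.1.1 • massOp Z + Z.ρ (fromAlgV D ρV 1 (algVec D ρV k.1.2))) = 0 := by
      rw [mul_add, mul_smul_comm, h2, h3, add_mul, smul_mul_assoc, smul_neg]
      abel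
    rw [toGraded_solved_ε, zero_smul]
    exact h4

/-- Part 1 replaces the clutched bundle, which is not presented inside a product bundle, by the
solved one, which is. -/
theorem mk_eq_absClass {W : FDMod (DirAlg D ρV 1)} {T : VectObj D (RepSphere ρV)}
    (h : Nonempty (T.toFamily.Iso (toGraded W).abs)) : KTilde.mk T = absClass W :=
  h.elim fun e => VectObj.mk_eq_of_iso (e.trans (toGraded W).clutchIso.symm)

variable (D ρV) in
theorem existsUnique_absMap :
    ∃! Φ : AlgClass D ρV → KTilde D (RepSphere ρV), IsABSMap D ρV Φ := by
  have hex : ∀ W : FDMod (DirAlg D ρV 1), Nonempty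
      ((toGraded W).solved.toFamily.Iso (toGraded W).abs) := fun W => ⟨(toGraded W).clutchIso⟩
  refine ⟨fun x => absClass (AlgClass.mk_surjective x).choose, fun W => ⟨⟨_, hex W⟩, fun T hT => ?_⟩,
    fun Φ hΦ => funext fun x => ?_⟩
  · rw [mk_eq_absClass hT]
    exact AlgClass.eq_of_mk_eq absClass (fun _ _ => absClass_of_iso) absClass_sum_res
      (AlgClass.mk_surjective _).choose_spec
  · have := (hΦ (AlgClass.mk_surjective x).choose).2 _ (hex _)
    rwa [(AlgClass.mk_surjective x).choose_spec] at this

namespace ModUniverse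

variable {𝒰 : ModUniverse (DirAlg D ρV 1)} {W : FDMod (DirAlg D ρV 1)}

/-- This is the slice `s = 1` of the continuous family `shrunk`. -/
theorem continuous_dirac_base (S : 𝒰.Summand) :
    Continuous fun k : RepSphere ρV => S.compress (dirac 𝒰.M₀ 𝒰.M₀ 𝒰.Γ k) := by
  have h := continuous_compress_shrunk (𝒰 := 𝒰) S.compress
  have h1 : Continuous fun k : RepSphere ρV => ((1 : unitInterval), k) :=
    Continuous.prodMk_right 1
  simpa only [Function.comp_def, Set.Icc.coe_one, shrunk_one] using h.comp h1

/-- With changed sign the northern term `-k₀ M` becomes `k₀ M₀`, as in the south; in terms of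
`dirac_eq` this is `max + min = k₀`. So on the embedded `W` the loop restricts to the Hamiltonian of
Part 1. -/
theorem Emb.dirac_signPoint_j (E : 𝒰.Emb W) {n : ℕ} (hE : E.InStage n) (k : RepSphere ρV)
    (w : W.carrier) :
    (dirac (E.signPoint hE).1 𝒰.M₀ 𝒰.Γ k * 𝒰.P n + 𝒰.H₀ * (1 - 𝒰.P n)) (E.j w) =
      E.j ((toGraded W).solved.ε k w) := by
  have hM₀ : 𝒰.M₀ (E.j w) = E.j (massOp W w) := (E.j_ρ _ _).symm
  have hM : (E.signPoint hE).1 (E.j w) = -E.j (massOp W w) := by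
    change 𝒰.M₀ (E.j w) + E.j ((-massOp W - massOp W) (E.r (E.j w))) = _
    rw [E.r_j, hM₀, LinearMap.sub_apply, LinearMap.neg_apply, map_sub, map_neg]
    abel
  have hΓ : 𝒰.Γ k.1.2 (E.j w) = E.j (W.ρ (fromAlgV D ρV 1 (algVec D ρV k.1.2)) w) :=
    (E.j_ρ _ _).symm
  have hε : (toGraded W).solved.ε k w =
      k.1.1 • massOp W w + W.ρ (fromAlgV D ρV 1 (algVec D ρV k.1.2)) w := by
    rw [toGraded_solved_ε]
    rfl
  have hε' : E.j ((toGraded W).solved.ε k w) = k.1.1 • E.j (massOp W w) +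
      E.j (W.ρ (fromAlgV D ρV 1 (algVec D ρV k.1.2)) w) := by
    refine (congrArg E.j hε).trans ?_
    rw [map_add, map_smul]
  rw [LinearMap.add_apply, Module.End.mul_apply, Module.End.mul_apply, LinearMap.sub_apply,
    Module.End.one_apply, hE.1, sub_self, map_zero, add_zero, hε', dirac_eq, LinearMap.add_apply,
    LinearMap.add_apply, LinearMap.neg_apply, LinearMap.smul_apply, LinearMap.smul_apply, hM, hM₀,
    hΓ, smul_neg, neg_neg, ← add_smul, max_add_min, add_zero]

/-- The stage splits into `W` and an invariant complement. The Hamiltonian preserves both: on `W` it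
gives the solved bundle of Part 1, on the complement it is the Dirac Hamiltonian of `M₀` with
itself, which can be replaced by a trivial grading. -/
theorem IsSolution.of_signPoint {E : 𝒰.Emb W} {n : ℕ} (hE : E.InStage n) {H : 𝒰.HamLoops}
    (hH : ∀ k, (H.1 k).1 = dirac (E.signPoint hE).1 𝒰.M₀ 𝒰.Γ k * 𝒰.P n + 𝒰.H₀ * (1 - 𝒰.P n)) :
    ∃ T, 𝒰.IsSolution H n T ∧ KTilde.mk T = absClass W := by
  have hM : (E.signPoint hE).1 - 𝒰.M₀ ∈ stage 𝒰.P n := by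
    change E.massTerm _ - 𝒰.M₀ ∈ _
    rw [Emb.massTerm, add_sub_cancel_left]
    exact Emb.conj_mem_stage hE _
  let S := E.summand.compl (n := n) (LinearMap.ext fun u => hE.1 _)
    (LinearMap.ext fun u => congrArg E.j (hE.2 u))
  have hS : ∀ b, Commute S.Q (𝒰.ρ b) := fun b =>
    (show Commute (𝒰.P n) (𝒰.ρ b) from 𝒰.P_comm n b).sub_left
      (LinearMap.ext fun u => (congrArg E.j (E.r_ρ _ u)).trans (E.j_ρ _ _))
  let F := S.obj (dirac 𝒰.M₀ 𝒰.M₀ 𝒰.Γ) (isSymHam_dirac isMass_M₀) (commute_dirac_base hS)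
    (continuous_dirac_base S)
  have hS₀ : Commute S.Q 𝒰.H₀ := (hS _).neg_right
  let F₀ := S.obj (fun _ => 𝒰.H₀) isSymHam_H₀ (fun _ => hS₀) continuous_const
  refine ⟨(toGraded W).solved.sum F, ⟨fun k => ?_, E.j.coprod S.incl, ?_, ?_, fun a u => ?_,
    fun k u => ?_⟩, ?_⟩
  · rw [hH, ← H₀_add_compress (commute_P_dirac
      (commute_P_of_sub_mem le_rfl (commute_P_M₀ n) hM) k), add_sub_cancel_left]
    exact (compress n _).2
  · exact Summand.injective_coprod_compl _ _
      (fun w w' h => by rw [← E.r_j w, h, E.r_j]) E.range_summand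
  · exact Summand.range_coprod_compl _ _ E.range_summand
  · exact (congrArg (· + 𝒰.ρA a (S.incl u.2)) (E.j_ρ _ u.1)).trans (map_add (𝒰.ρA a) _ _).symm
  · have h1 : (H.1 k).1 (E.j u.1) = E.j ((toGraded W).solved.ε k u.1) := by
      rw [hH]
      exact E.dirac_signPoint_j hE k u.1
    have h2 : (H.1 k).1 (S.incl u.2) = S.incl (F.ε k u.2) := by
      have h3 : S.incl (F.ε k u.2) = dirac 𝒰.M₀ 𝒰.M₀ 𝒰.Γ k (S.incl u.2) :=
        S.incl_compress (commute_dirac_base hS k) _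
      have h4 : E.r (S.incl u.2) = 0 := by
        have : E.j (E.r (S.incl u.2)) = 0 := Summand.Q_incl_compl (S := E.summand) _ _ u.2
        rw [← E.r_j (E.r _), this, map_zero]
      rw [hH, h3]
      exact E.dirac_signPoint_of_r_eq_zero hE k (Summand.P_incl_compl _ _ u.2) h4
    exact (congrArg₂ (· + ·) h1.symm h2.symm).trans (map_add (H.1 k).1 _ _).symm
  -- The comparison grading is the compression of `H₀`; its properties are those of the constant
  -- object `F₀`, read off at one point.
  · refine VectObj.mk_sum_of_anticommutator (toGraded W).solved F (T := S.compress 𝒰.H₀)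
      (F₀.sq (infty ρV)) (F₀.comm_I (infty ρV)) (fun g => F₀.equivariant g (infty ρV))
      (c := fun k => 2 * (max k.1.1 0 - min k.1.1 0))
      (continuous_const.mul ((RepSphere.continuous_fst.max continuous_const).sub
        (RepSphere.continuous_fst.min continuous_const)))
      (fun k => mul_nonneg zero_le_two (sub_nonneg.2 min_le_max)) fun k => ?_
    have h := congrArg S.compress (dirac_base_anticommutator (𝒰 := 𝒰) k)
    rw [S.compress.map_add, S.compress.map_smul, S.compress_one,
      ← S.compress_mul (commute_dirac_base hS k) hS₀,
      ← S.compress_mul hS₀ (commute_dirac_base hS k)] at h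
    exact h

/-- The square of classifications commutes. -/
theorem solve_dirac_sign {L : AlgClass D ρV → ZerothHomotopy 𝒰.MassSpace}
    {F : ZerothHomotopy 𝒰.MassSpace → ZerothHomotopy 𝒰.HamLoops}
    {S : ZerothHomotopy 𝒰.HamLoops → KTilde D (RepSphere ρV)}
    {Φ : AlgClass D ρV → KTilde D (RepSphere ρV)} (hL : 𝒰.IsSignMap L) (hF : 𝒰.IsDiracMap F)
    (hS : 𝒰.IsSolveMap S) (hΦ : IsABSMap D ρV Φ) (x : AlgClass D ρV) : S (F (L x)) = Φ x := by
  obtain ⟨W, rfl⟩ := AlgClass.mk_surjective x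
  obtain ⟨⟨M, hM⟩, hL⟩ := hL W
  -- Any mass term representing the class is the sign change along an actual embedding, lying in the
  -- stage in which `M - M₀` lies; so the maps can be evaluated on explicit representatives.
  obtain ⟨E, hE⟩ := Emb.exists_of_signChange M hM
  obtain ⟨n, hn⟩ := M.2.1
  obtain ⟨hEn, rfl⟩ := hE n hn
  obtain ⟨H, hH, hFH⟩ := hF _ n hn
  obtain ⟨T, hT, hTW⟩ := IsSolution.of_signPoint hEn hH
  have h := (hΦ W).2 (toGraded W).solved ⟨(toGraded W).clutchIso⟩
  rw [hL _ hM, hFH, (hS H).2 n T hT, h, hTW]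
  rfl

end ModUniverse

end

end FreeFermion

theorem mainTheorem6 {G : Type*} [Group G] (D : SymData G)
    {V : Type*} [NormedAddCommGroup V] [InnerProductSpace ℝ V] [FiniteDimensional ℝ V]
    (ρV : G →* (V ≃ₗᵢ[ℝ] V)) :
    (∀ W : GrMod D ρV,
      W.abs.IsBundle ∧ W.solved.toFamily.IsBundle ∧
      ∃ Ψ : W.solved.toFamily.Iso W.abs,
        ∀ (i : ℤˣ) (k : RepSphere ρV),
          (∀ hk : 0 ≤ k.1.1,
            (∀ (v : W.W.carrier) (hv : v ∈ W.solved.fib i k), ∃ hw : v + sgn i • W.M₀ v ∈ W.gr i,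
              Ψ.toEquiv i k ⟨v, hv⟩ = W.north i k hk ⟨v + sgn i • W.M₀ v, hw⟩) ∧
            ∀ w : W.gr i, ((Ψ.toEquiv i k).symm (W.north i k hk w)).1 =
              (1 / (2 * (1 + k.1.1))) • (w.1 + sgn i • dirac (-W.M₀) W.M₀ W.Γ k w.1)) ∧
          (∀ hk : k.1.1 ≤ 0,
            (∀ (v : W.W.carrier) (hv : v ∈ W.solved.fib i k), ∃ hw : v - sgn i • W.M₀ v ∈ W.gr (-i),
              Ψ.toEquiv i k ⟨v, hv⟩ = W.south i k hk ⟨v - sgn i • W.M₀ v, hw⟩) ∧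
            ∀ w : W.gr (-i), ((Ψ.toEquiv i k).symm (W.south i k hk w)).1 =
              (1 / (2 * (1 - k.1.1))) • (w.1 + sgn i • dirac (-W.M₀) W.M₀ W.Γ k w.1))) ∧
    (Finite G → ∀ 𝒰 : ModUniverse (DirAlg D ρV 1),
      (∃! L : AlgClass D ρV → ZerothHomotopy 𝒰.MassSpace, 𝒰.IsSignMap L) ∧
      (∃! F : ZerothHomotopy 𝒰.MassSpace → ZerothHomotopy 𝒰.HamLoops, 𝒰.IsDiracMap F) ∧
      (∃! S : ZerothHomotopy 𝒰.HamLoops → KTilde D (RepSphere ρV), 𝒰.IsSolveMap S) ∧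
      (∃! Φ : AlgClass D ρV → KTilde D (RepSphere ρV), IsABSMap D ρV Φ) ∧
      ∀ L F S Φ, 𝒰.IsSignMap L → 𝒰.IsDiracMap F → 𝒰.IsSolveMap S → IsABSMap D ρV Φ →
        ∀ x, S (F (L x)) = Φ x) := by
  refine ⟨fun W => W.exists_clutchIso, fun _ 𝒰 => ⟨𝒰.existsUnique_signMap,
    𝒰.existsUnique_diracMap, 𝒰.existsUnique_solveMap, existsUnique_absMap D ρV,
    fun L F S Φ hL hF hS hΦ x => ModUniverse.solve_dirac_sign hL hF hS hΦ x⟩⟩
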